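/- **Setting.** Let $T>0$, let $U,V$ be nonempty compact subsets of Euclidean spaces, and $\Delta(I)\subset\mathbb{R}^I$ the simplex of probability vectors. Let $b:[0,T]\times\mathbb{R}^d\times U\times V\to\mathbb{R}^d$ and $l_i:[0,T]\times\mathbb{R}^d\times U\times V\to\mathbb{R}$ ($1\le i\le I$) be bounded, continuous, and Lipschitz in $(t,x)$ uniformly in $(u,v)$; let $g_i:\mathbb{R}^d\to\mathbb{R}$ be bounded and Lipschitz; let $\sigma:[0,T]\times\mathbb{R}^d\to\mathbb{R}^{d\times d}$ be bounded and Lipschitz, with transpose $\sigma^*(t,x)$ non-singular and $(\sigma^*)^{-1}$ bounded and Lipschitz. Assume Isaacs' condition: for all $(t,x,\xi,p)\in[0,T]\times\mathbb{R}^d\times\mathbb{R}^d\times\Delta(I)$, $$\inf_{u\in U}\sup_{v\in V}\Big\{\langle b(t,x,u,v),\xi\rangle+\sum_i p_il_i(t,x,u,v)\Big\}=\sup_{v\in V}\inf_{u\in U}\Big\{\langle b(t,x,u,v),\xi\rangle+\sum_i p_il_i(t,x,u,v)\Big\}=:H(t,x,\xi,p).$$ **Scheme.** Let $B$ be a standard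 $d$-dimensional Brownian motion. For $L\ge1$ put $\tau=T/L$, $t_k=k\tau$, $\Delta B^k=B_{t_{k+1}}-B_{t_k}$ and $\bar X^{k,x}_{k+1}=x+\sigma(t_k,x)\Delta B^k$. Define $V^\tau(t_L,x,p)=\sum_i p_ig_i(x)$ and, for $k=L-1,\dots,0$, $$V^\tau(t_k,x,p)=\mathrm{Vex}_p\Big(\mathbb{E}\big[V^\tau(t_{k+1},\bar X^{k,x}_{k+1},p)\big]+\tau H(t_k,x,\bar z_k(x,p),p)\Big),$$ $$\bar z_k(x,p)=\tfrac1\tau\,\mathbb{E}\big[V^\tau(t_{k+1},\bar X^{k,x}_{k+1},p)\,(\sigma^*)^{-1}(t_k,x)\Delta B^k\big],$$ where $\mathrm{Vex}_p f$ is the largest function that is convex in $p\in\Delta(I)$ and does not exceed $f$. **Proposition 4.5.** Let $w:[0,T]\times\mathbb{R}^d\times\Delta(I)\to\mathbb{R}$ be a locally uniform limit point of $(V^\tau)$ as $\tau\downarrow0$, i.e. there is a sequence $\tau_j=T/L_j$, $L_j\to\infty$, such that for all $(t,x,p)$ $$\lim_{j\to\infty,\ t_k\to t,\ x'\to x,\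 p'\to p}V^{\tau_j}(t_k,x',p')=w(t,x,p)\qquad(t_k\in\{0,\tau_j,2\tau_j,\dots,T\},\ p'\in\Delta(I)).$$ Then $w$ is a viscosity supersolution of $$\min\Big\{\frac{\partial w}{\partial t}+\tfrac12\mathrm{tr}\big(\sigma\sigma^*(t,x)D_x^2w\big)+H(t,x,D_xw,p),\ \lambda_{\min}\Big(p,\frac{\partial^2w}{\partial p^2}\Big)\Big\}=0\qquad(7)$$ on $[0,T)\times\mathbb{R}^d\times\Delta(I)$ (the boundary of $\Delta(I)$ included), and $w(T,x,p)=\sum_ip_ig_i(x)$ for all $(x,p)\in\mathbb{R}^d\times\Delta(I)$. Here $\lambda_{\min}(p,A)=\min_{z\in T_{\Delta(I)}(p)\setminus\{0\}}\langle Az,z\rangle/|z|^2$ ($=+\infty$ if the cone is $\{0\}$), with $T_{\Delta(I)}(p)=\overline{\bigcup_{\lambda>0}(\Delta(I)-p)/\lambda}$. Being a viscosity supersolution means: $w$ is lower semicontinuous on $[0,T]\times\mathbb{R}^d\times\Delta(I)$ and, whenever $\phi:\mathbb{R}\times\mathbb{R}^d\times\mathbb{R}^I\to\mathbb{R}$ is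 $C^2$ and $w-\phi$ has a local minimum relative to $[0,T]\times\mathbb{R}^d\times\Delta(I)$ at a point $(\bar t,\bar x,\bar p)$ with $\bar t<T$, the left-hand side of (7) evaluated with $\phi$ in place of $w$ at $(\bar t,\bar x,\bar p)$ is $\le0$. -/

import Mathlib

open MeasureTheory ProbabilityTheory Filter Topology Set
open scoped NNReal

noncomputable section

namespace IncompleteInfoGame

/-- Data of the game: horizon `T`, control sets `U`, `V` (subsets of Euclidean spaces), drift `b`,
volatility `σ`, running costs `l i` and terminal payoffs `g i`, for `i` in `Fin I`.
Only times in `[0, T]` are relevant. -/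
structure Game (d I m n : ℕ) where
  T : ℝ
  U : Set (EuclideanSpace ℝ (Fin m))
  V : Set (EuclideanSpace ℝ (Fin n))
  b : ℝ → EuclideanSpace ℝ (Fin d) → U → V → EuclideanSpace ℝ (Fin d)
  σ : ℝ → EuclideanSpace ℝ (Fin d) → Matrix (Fin d) (Fin d) ℝ
  l : Fin I → ℝ → EuclideanSpace ℝ (Fin d) → U → V → ℝ
  g : Fin I → EuclideanSpace ℝ (Fin d) → ℝ

/-- The simplex `Δ(I)` of probability vectors. -/
abbrev simplex (I : ℕ) : Set (Fin I → ℝ) := stdSimplex ℝ (Fin I)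

/-- The closed tangent cone `closure (⋃_{r > 0} (Δ(I) - p) / r)`. -/
def tangentCone {I : ℕ} (p : Fin I → ℝ) : Set (Fin I → ℝ) :=
  closure {z | ∃ r : ℝ, 0 < r ∧ ∃ q ∈ simplex I, z = r⁻¹ • (q - p)}

/-- `min ⟨A z, z⟩ / |z|²` over the nonzero `z` in the tangent cone at `p` (Euclidean inner product
and norm). It is extended-real valued, equal to `⊤` when the cone is `{0}`. -/
def lambdaMin {I : ℕ} (p : Fin I → ℝ) (A : Matrix (Fin I) (Fin I) ℝ) : EReal :=
  ⨅ z ∈ tangentCone p \ {0}, (((A.mulVec z ⬝ᵥ z) / (z ⬝ᵥ z) : ℝ) : EReal)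

/-- `Vex_p f`: the largest function that is convex on the simplex and does not exceed `f` there,
i.e. the pointwise supremum of the convex minorants of `f`. -/
def vex {I : ℕ} (f : (Fin I → ℝ) → ℝ) (p : Fin I → ℝ) : ℝ :=
  sSup {y | ∃ h : (Fin I → ℝ) → ℝ,
    ConvexOn ℝ (simplex I) h ∧ (∀ q ∈ simplex I, h q ≤ f q) ∧ y = h p}

/-- `B` is a standard `d`-dimensional Brownian motion under `P`: its coordinates are mutually
independent standard real Brownian motions. -/
structure IsBrownian {Ω : Type*} [MeasurableSpace Ω] {d : ℕ} (P : Measure Ω)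
    (B : ℝ≥0 → Ω → EuclideanSpace ℝ (Fin d)) : Prop where
  coord : ∀ i, IsBrownianReal (fun t ω ↦ B t ω i) P
  indep : iIndepFun (fun (i : Fin d) (ω : Ω) (t : ℝ≥0) ↦ B t ω i) P

namespace Game

variable {d I m n : ℕ}

/-- The standing assumptions on the game. -/
structure Assumptions (G : Game d I m n) : Prop where
  T_pos : 0 < G.T
  U_compact : IsCompact G.U
  U_nonempty : G.U.Nonempty
  V_compact : IsCompact G.V
  V_nonempty : G.V.Nonempty
  b_bounded : ∃ C, ∀ t ∈ Icc 0 G.T, ∀ x u v, ‖G.b t x u v‖ ≤ C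
  b_continuous : ContinuousOn
    (fun q : ℝ × EuclideanSpace ℝ (Fin d) × G.U × G.V ↦ G.b q.1 q.2.1 q.2.2.1 q.2.2.2)
    (Icc 0 G.T ×ˢ univ)
  b_lipschitz : ∃ C, ∀ t ∈ Icc 0 G.T, ∀ t' ∈ Icc 0 G.T, ∀ x x' u v,
    ‖G.b t x u v - G.b t' x' u v‖ ≤ C * (|t - t'| + ‖x - x'‖)
  σ_bounded : ∃ C, ∀ t ∈ Icc 0 G.T, ∀ x i j, |G.σ t x i j| ≤ C
  σ_lipschitz : ∃ C, ∀ t ∈ Icc 0 G.T, ∀ t' ∈ Icc 0 G.T, ∀ x x' i j,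
    |G.σ t x i j - G.σ t' x' i j| ≤ C * (|t - t'| + ‖x - x'‖)
  σ_nonsingular : ∀ t ∈ Icc 0 G.T, ∀ x, IsUnit (G.σ t x).transpose
  σ_inv_bounded : ∃ C, ∀ t ∈ Icc 0 G.T, ∀ x i j, |(G.σ t x).transpose⁻¹ i j| ≤ C
  σ_inv_lipschitz : ∃ C, ∀ t ∈ Icc 0 G.T, ∀ t' ∈ Icc 0 G.T, ∀ x x' i j,
    |(G.σ t x).transpose⁻¹ i j - (G.σ t' x').transpose⁻¹ i j| ≤ C * (|t - t'| + ‖x - x'‖)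
  l_bounded : ∀ i, ∃ C, ∀ t ∈ Icc 0 G.T, ∀ x u v, |G.l i t x u v| ≤ C
  l_continuous : ∀ i, ContinuousOn
    (fun q : ℝ × EuclideanSpace ℝ (Fin d) × G.U × G.V ↦ G.l i q.1 q.2.1 q.2.2.1 q.2.2.2)
    (Icc 0 G.T ×ˢ univ)
  l_lipschitz : ∀ i, ∃ C, ∀ t ∈ Icc 0 G.T, ∀ t' ∈ Icc 0 G.T, ∀ x x' u v,
    |G.l i t x u v - G.l i t' x' u v| ≤ C * (|t - t'| + ‖x - x'‖)
  g_bounded : ∀ i, ∃ C, ∀ x, |G.g i x| ≤ C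
  g_lipschitz : ∀ i, ∃ C, ∀ x x', |G.g i x - G.g i x'| ≤ C * ‖x - x'‖
  isaacs : ∀ t ∈ Icc 0 G.T, ∀ x ξ, ∀ p ∈ simplex I,
    (⨅ u : G.U, ⨆ v : G.V, (inner ℝ (G.b t x u v) ξ + ∑ i, p i * G.l i t x u v)) =
      ⨆ v : G.V, ⨅ u : G.U, (inner ℝ (G.b t x u v) ξ + ∑ i, p i * G.l i t x u v)

/-- The Hamiltonian `H(t, x, ξ, p)`. -/
def hamiltonian (G : Game d I m n) (t : ℝ) (x ξ : EuclideanSpace ℝ (Fin d))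
    (p : Fin I → ℝ) : ℝ :=
  ⨅ u : G.U, ⨆ v : G.V, (inner ℝ (G.b t x u v) ξ + ∑ i, p i * G.l i t x u v)

/-- Step size `τ = T / L`. -/
def step (G : Game d I m n) (L : ℕ) : ℝ := G.T / L

/-- Grid point `t_k = k τ`. -/
def gridTime (G : Game d I m n) (L k : ℕ) : ℝ := k * G.step L

/-- `⟨p, g(x)⟩`. -/
def terminal (G : Game d I m n) (x : EuclideanSpace ℝ (Fin d)) (p : Fin I → ℝ) : ℝ :=
  ∑ i, p i * G.g i x

section Scheme

variable {Ω : Type*} [MeasurableSpace Ω]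

/-- Brownian increment `ΔB^k = B_{t_{k+1}} - B_{t_k}`. -/
def increment (G : Game d I m n) (B : ℝ≥0 → Ω → EuclideanSpace ℝ (Fin d)) (L k : ℕ) (ω : Ω) :
    EuclideanSpace ℝ (Fin d) :=
  B (G.gridTime L (k + 1)).toNNReal ω - B (G.gridTime L k).toNNReal ω

/-- One Euler step `X̄^{k,x}_{k+1} = x + σ(t_k, x) ΔB^k`. -/
def eulerStep (G : Game d I m n) (B : ℝ≥0 → Ω → EuclideanSpace ℝ (Fin d)) (L k : ℕ)
    (x : EuclideanSpace ℝ (Fin d)) (ω : Ω) : EuclideanSpace ℝ (Fin d) :=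
  x + (G.σ (G.gridTime L k) x).toEuclideanLin (G.increment B L k ω)

/-- `z̄_k(x, p)` computed from the function `W = V^τ(t_{k+1}, ·, ·)`:
`(1/τ) E[W(X̄^{k,x}_{k+1}, p) (σ*)⁻¹(t_k, x) ΔB^k]`. -/
def zBar (G : Game d I m n) (P : Measure Ω) (B : ℝ≥0 → Ω → EuclideanSpace ℝ (Fin d)) (L k : ℕ)
    (W : EuclideanSpace ℝ (Fin d) → (Fin I → ℝ) → ℝ)
    (x : EuclideanSpace ℝ (Fin d)) (p : Fin I → ℝ) : EuclideanSpace ℝ (Fin d) :=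
  (G.step L)⁻¹ • ∫ ω, W (G.eulerStep B L k x ω) p •
    (G.σ (G.gridTime L k) x).transpose⁻¹.toEuclideanLin (G.increment B L k ω) ∂P

/-- One backward step of the scheme, from `W = V^τ(t_{k+1}, ·, ·)` to `V^τ(t_k, ·, ·)`. -/
def backwardStep (G : Game d I m n) (P : Measure Ω) (B : ℝ≥0 → Ω → EuclideanSpace ℝ (Fin d))
    (L k : ℕ) (W : EuclideanSpace ℝ (Fin d) → (Fin I → ℝ) → ℝ)
    (x : EuclideanSpace ℝ (Fin d)) : (Fin I → ℝ) → ℝ :=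
  vex fun p ↦ (∫ ω, W (G.eulerStep B L k x ω) p ∂P) +
    G.step L * G.hamiltonian (G.gridTime L k) x (G.zBar P B L k W x p) p

/-- The scheme indexed by the number `j` of steps remaining until the horizon. -/
def schemeAux (G : Game d I m n) (P : Measure Ω) (B : ℝ≥0 → Ω → EuclideanSpace ℝ (Fin d))
    (L : ℕ) : ℕ → EuclideanSpace ℝ (Fin d) → (Fin I → ℝ) → ℝ
  | 0 => G.terminal
  | j + 1 => G.backwardStep P B L (L - (j + 1)) (schemeAux G P B L j)

/-- `V^τ(t_k, x, p)` for `τ = T / L` and `k ≤ L`. -/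
def scheme (G : Game d I m n) (P : Measure Ω) (B : ℝ≥0 → Ω → EuclideanSpace ℝ (Fin d))
    (L k : ℕ) : EuclideanSpace ℝ (Fin d) → (Fin I → ℝ) → ℝ :=
  G.schemeAux P B L (L - k)

/-- `w` is a limit point of `V^τ` as `τ = T / L ↓ 0`, locally uniformly on
`[0, T] × ℝ^d × Δ(I)`: along some sequence `L j → ∞`,
`V^{T/L j}(t_k, x', p') → w(t, x, p)` as `j → ∞`, `t_k → t`, `x' → x`, `p' → p`. -/
def IsLimitPoint (G : Game d I m n) (P : Measure Ω) (B : ℝ≥0 → Ω → EuclideanSpace ℝ (Fin d))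
    (w : ℝ → EuclideanSpace ℝ (Fin d) → (Fin I → ℝ) → ℝ) : Prop :=
  ∃ L : ℕ → ℕ, Tendsto L atTop atTop ∧
    ∀ t ∈ Icc 0 G.T, ∀ x, ∀ p ∈ simplex I, ∀ ε > 0, ∃ δ > 0, ∃ N, ∀ j ≥ N, ∀ k ≤ L j,
      ∀ x', ∀ p' ∈ simplex I,
        |G.gridTime (L j) k - t| < δ → ‖x' - x‖ < δ → ‖p' - p‖ < δ →
          |G.scheme P B (L j) k x' p' - w t x p| < ε

end Scheme

/-- Hessian matrix in `x`. -/
def hessianX (f : EuclideanSpace ℝ (Fin d) → ℝ) (x : EuclideanSpace ℝ (Fin d)) :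
    Matrix (Fin d) (Fin d) ℝ :=
  fun i j ↦ iteratedFDeriv ℝ 2 f x ![EuclideanSpace.single i 1, EuclideanSpace.single j 1]

/-- Hessian matrix in `p`. -/
def hessianP (f : (Fin I → ℝ) → ℝ) (p : Fin I → ℝ) : Matrix (Fin I) (Fin I) ℝ :=
  fun i j ↦ iteratedFDeriv ℝ 2 f p ![Pi.single i 1, Pi.single j 1]

/-- `∂φ/∂t + ½ tr(σσ*(t,x) D²_x φ) + H(t, x, D_x φ, p)` at `(t, x, p)`. -/
def hjiOperator (G : Game d I m n) (φ : ℝ × EuclideanSpace ℝ (Fin d) × (Fin I → ℝ) → ℝ)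
    (t : ℝ) (x : EuclideanSpace ℝ (Fin d)) (p : Fin I → ℝ) : ℝ :=
  deriv (fun s ↦ φ (s, x, p)) t +
    (1 / 2) * (G.σ t x * (G.σ t x).transpose * hessianX (fun y ↦ φ (t, y, p)) x).trace +
    G.hamiltonian t x (gradient (fun y ↦ φ (t, y, p)) x) p

/-- The domain `[0, T] × ℝ^d × Δ(I)`. -/
def domain (G : Game d I m n) : Set (ℝ × EuclideanSpace ℝ (Fin d) × (Fin I → ℝ)) :=
  Icc 0 G.T ×ˢ univ ×ˢ simplex I

/-- Viscosity supersolution of the obstacle equation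
`min {∂w/∂t + ½ tr(σσ* D²_x w) + H(t, x, D_x w, p), λ_min(p, ∂²w/∂p²)} = 0`
on `[0, T) × ℝ^d × Δ(I)`, the faces of the simplex included: `w` is lower semicontinuous and, for
every `C²` test function `φ` such that `w - φ` has a minimum at `(t, x, p)` locally in the domain,
the left-hand side evaluated on `φ` at `(t, x, p)` is nonpositive. -/
def IsViscositySupersolution (G : Game d I m n)
    (w : ℝ → EuclideanSpace ℝ (Fin d) → (Fin I → ℝ) → ℝ) : Prop :=
  LowerSemicontinuousOn (fun q : ℝ × EuclideanSpace ℝ (Fin d) × (Fin I → ℝ) ↦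
      w q.1 q.2.1 q.2.2) G.domain ∧
    ∀ φ : ℝ × EuclideanSpace ℝ (Fin d) × (Fin I → ℝ) → ℝ, ContDiff ℝ 2 φ →
      ∀ t ∈ Ico 0 G.T, ∀ x, ∀ p ∈ simplex I,
        IsLocalMinOn (fun q ↦ w q.1 q.2.1 q.2.2 - φ q) G.domain (t, x, p) →
          min (G.hjiOperator φ t x p : EReal) (lambdaMin p (hessianP (fun q ↦ φ (t, x, q)) p)) ≤ 0

end Game

end IncompleteInfoGame

end

noncomputable section

/-! The minimum in (7) can be positive at a test point only if both entries are. Positivity of the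
second entry says that `φ` is strictly convex in `p` along the simplex at that point. The proof
shows that the Hamilton-Jacobi-Isaacs entry must then be `≤ 0`.

One step of the scheme is an expectation plus `τ H`, followed by `vex`. The first operation is
monotone up to an error `O(τ²)` (`HasBounds.stepValue_le`). It is consistent on test functions
because `N = ΔB` is centred with covariance `τ · Id`, so that the weight `(σ*)⁻¹ N` recovers the
gradient (`HasBounds.exists_stepValue_eval_ge`). The operation `vex` can only lower values, which is
the wrong direction for a lower bound on `V^τ`. Strict convexity repairs this. If `V^τ(t_{k+1}, ·)`
lies above a test function with a term `κ |p - p₀|²`, that term absorbs the error of size `τ |q -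
p|` at the cost `O(τ²)`, so the function under `vex` has an affine minorant in `q` that is nearly
sharp at `p`. Dividing by `τ` gives the differential inequality up to small errors
(`Assumptions.exists_nearMin_estimate`).

To use this, `φ` is replaced by an explicit `TestFn`: quadratic in `t`, linear and bilinear terms in
`x` and `p`, the term `κ |p - p₀|²`, and a penalty quartic in `x`. The penalty leaves all
derivatives in `x` up to order three at the base point unchanged but is coercive. The local lower
bound given by Taylor's formula near `p₀` spreads to the whole simplex because `w` is convex in `p`,
being a limit of convex functions (`exists_lower_bound_on_simplex`). A large penalty then makes the
minimum of `w - ψ` global and strict (`TestFn.exists_penalty`). Near-minimizers of `V^τ - ψ`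
therefore converge to the base point, and the inequality passes to the limit
(`Assumptions.testFn_le_zero`). The Taylor error costs a multiple of an arbitrary `ε`
(`Assumptions.hjiOperator_le`). -/

namespace IncompleteInfoGame

/-! ### Gaussian noise and Brownian increments. -/

/-- Moments of all orders, mean and covariance of a `d`-dimensional centred noise of variance `τ`,
with moment constants `C` that do not depend on `τ`. -/
structure IsNoise {Ω : Type*} [MeasurableSpace Ω] {d : ℕ} (P : Measure Ω)
    (N : Ω → EuclideanSpace ℝ (Fin d)) (τ : ℝ) (C : ℕ → ℝ) : Prop where
  aemeasurable : AEMeasurable N P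
  integrable_pow : ∀ n : ℕ, Integrable (fun ω ↦ ‖N ω‖ ^ n) P
  integral_pow_le : ∀ n : ℕ, ∫ ω, ‖N ω‖ ^ n ∂P ≤ C n * √τ ^ n
  integral_coord : ∀ i, ∫ ω, N ω i ∂P = 0
  integral_coord_mul : ∀ i j, ∫ ω, N ω i * N ω j ∂P = if i = j then τ else 0

/-- Moment constants of the standard `d`-dimensional Gaussian. -/
def momentConst (d n : ℕ) : ℝ := (d : ℝ) ^ n * ∫ x, |x| ^ n ∂gaussianReal 0 1

lemma integrable_abs_pow_gaussianReal (v : ℝ≥0) (n : ℕ) :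
    Integrable (fun x : ℝ ↦ |x| ^ n) (gaussianReal 0 v) := by
  have := (memLp_id_gaussianReal (μ := 0) (v := v) (n : ℝ≥0)).integrable_norm_pow'
  simpa using this

lemma integral_abs_pow_gaussianReal (v : ℝ≥0) (n : ℕ) :
    ∫ x, |x| ^ n ∂gaussianReal 0 v = √(v : ℝ) ^ n * ∫ x, |x| ^ n ∂gaussianReal 0 1 := by
  have h := gaussianReal_map_const_mul (μ := 0) (v := 1) (√(v : ℝ))
  have hv : (NNReal.mk (√(v : ℝ) ^ 2) (sq_nonneg _)) * 1 = v := by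
    ext; simp
  rw [mul_zero, hv] at h
  rw [← h, integral_map (by fun_prop) (by fun_prop), ← integral_const_mul]
  simp [abs_mul, mul_pow, abs_of_nonneg (Real.sqrt_nonneg _)]

lemma sum_pow_le_card_pow_mul {d : ℕ} (a : Fin d → ℝ) (ha : ∀ i, 0 ≤ a i) (n : ℕ) :
    (∑ i, a i) ^ (n + 1) ≤ (d : ℝ) ^ n * ∑ i, a i ^ (n + 1) := by
  rcases Nat.eq_zero_or_pos d with rfl | hd
  · simp
  have h := pow_sum_div_card_le_sum_pow (s := Finset.univ) (f := a) (fun i _ ↦ ha i) n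
  rw [div_le_iff₀ (by simpa using pow_pos (by exact_mod_cast hd) n)] at h
  simpa [mul_comm] using h

lemma norm_le_sum_abs {d : ℕ} (x : EuclideanSpace ℝ (Fin d)) : ‖x‖ ≤ ∑ i, |x i| := by
  rw [EuclideanSpace.norm_eq]
  apply Real.sqrt_le_iff.2 ⟨Finset.sum_nonneg fun _ _ ↦ abs_nonneg _, ?_⟩
  have := Finset.sum_sq_le_sq_sum_of_nonneg (s := Finset.univ) (f := fun i ↦ |x i|)
    (fun i _ ↦ abs_nonneg _)
  simpa using this

/-- Pairwise independence is enough: the only mixed moments that enter are those of order two, and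
moments of the norm reduce to one-dimensional ones by the power mean inequality. That inequality
concerns exponents `n + 1`, which is why the exponent zero is treated apart. -/
lemma isNoise_of_gaussian_coord {Ω : Type*} [MeasurableSpace Ω] {d : ℕ} {P : Measure Ω}
    [IsProbabilityMeasure P] {N : Ω → EuclideanSpace ℝ (Fin d)} {τ : ℝ≥0}
    (hlaw : ∀ i, HasLaw (fun ω ↦ N ω i) (gaussianReal 0 τ) P)
    (hind : ∀ i j, i ≠ j → IndepFun (fun ω ↦ N ω i) (fun ω ↦ N ω j) P) :
    IsNoise P N τ (momentConst d) := by
  have hm : ∀ i, AEMeasurable (fun ω ↦ N ω i) P := fun i ↦ (hlaw i).aemeasurable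
  have haem : AEMeasurable N P := by
    have h1 : AEMeasurable (fun ω i ↦ N ω i) P := aemeasurable_pi_lambda _ hm
    exact (MeasurableEquiv.toLp 2 (Fin d → ℝ)).measurable.comp_aemeasurable h1
  have hint : ∀ i n, Integrable (fun ω ↦ |N ω i| ^ n) P := fun i n ↦ by
    have := integrable_abs_pow_gaussianReal τ n
    rw [← (hlaw i).map_eq, integrable_map_measure (by fun_prop) (hm i)] at this
    exact this
  have hval : ∀ i n, ∫ ω, |N ω i| ^ n ∂P = √(τ : ℝ) ^ n * ∫ x, |x| ^ n ∂gaussianReal 0 1 :=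
    fun i n ↦ by
      rw [← integral_abs_pow_gaussianReal, ← (hlaw i).integral_comp (by fun_prop)]
      rfl
  have hbd : ∀ n ω, ‖N ω‖ ^ (n + 1) ≤ (d : ℝ) ^ n * ∑ i, |N ω i| ^ (n + 1) := fun n ω ↦
    (pow_le_pow_left₀ (norm_nonneg _) (norm_le_sum_abs _) _).trans
      (sum_pow_le_card_pow_mul _ (fun _ ↦ abs_nonneg _) n)
  have hsum : ∀ n, Integrable (fun ω ↦ (d : ℝ) ^ n * ∑ i, |N ω i| ^ (n + 1)) P := fun n ↦
    (integrable_finsetSum _ fun i _ ↦ hint i _).const_mul _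
  refine ⟨haem, ?_, ?_, ?_, ?_⟩
  · rintro (_ | n)
    · simp
    · refine (hsum n).mono' (haem.norm.pow_const _).aestronglyMeasurable (ae_of_all _ fun ω ↦ ?_)
      simpa using hbd n ω
  · rintro (_ | n)
    · simp [momentConst]
    · refine (integral_mono_of_nonneg (ae_of_all _ fun ω ↦ by positivity) (hsum n)
        (ae_of_all _ (hbd n))).trans (le_of_eq ?_)
      rw [integral_const_mul, integral_finsetSum _ fun i _ ↦ hint i _]
      simp only [hval, momentConst]
      simp
      ring
  · intro i
    rw [(hlaw i).integral_eq, integral_id_gaussianReal]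
  · intro i j
    split_ifs with hij
    · subst hij
      have := hval i 2
      simp only [sq_abs] at this
      have h1 : ∫ x : ℝ, x ^ 2 ∂gaussianReal 0 1 = 1 := by
        have := variance_fun_id_gaussianReal (μ := 0) (v := 1)
        rw [variance_of_integral_eq_zero (by fun_prop) (by simp)] at this
        simpa using this
      rw [h1, Real.sq_sqrt (NNReal.coe_nonneg τ), mul_one] at this
      simpa [sq] using this
    · rw [(hind i j hij).integral_fun_mul_eq_mul_integral (hm i).aestronglyMeasurable
        (hm j).aestronglyMeasurable, (hlaw i).integral_eq, integral_id_gaussianReal, zero_mul]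

lemma IsBrownian.isNoise_sub {Ω : Type*} [MeasurableSpace Ω] {d : ℕ} {P : Measure Ω}
    [IsProbabilityMeasure P] {B : ℝ≥0 → Ω → EuclideanSpace ℝ (Fin d)} (hB : IsBrownian P B)
    (s t : ℝ≥0) :
    IsNoise P (fun ω ↦ B t ω - B s ω) (nndist t s) (momentConst d) := by
  refine isNoise_of_gaussian_coord (fun i ↦ (hB.coord i).hasLaw_sub t s) fun i j hij ↦ ?_
  have := (hB.indep.indepFun hij).comp (φ := fun f : ℝ≥0 → ℝ ↦ f t - f s)
    (ψ := fun f : ℝ≥0 → ℝ ↦ f t - f s) (by fun_prop) (by fun_prop)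
  exact this

lemma Game.isNoise_increment {Ω : Type*} [MeasurableSpace Ω] {d I m n : ℕ} {P : Measure Ω}
    [IsProbabilityMeasure P] {B : ℝ≥0 → Ω → EuclideanSpace ℝ (Fin d)} (hB : IsBrownian P B)
    (G : Game d I m n) (hT : 0 < G.T) (L k : ℕ) :
    IsNoise P (G.increment B L k) (G.step L) (momentConst d) := by
  have hs : 0 ≤ G.step L := by unfold Game.step; positivity
  have h := hB.isNoise_sub (G.gridTime L k).toNNReal (G.gridTime L (k + 1)).toNNReal
  have h0 : ∀ k : ℕ, 0 ≤ G.gridTime L k := fun k ↦ by unfold Game.gridTime; positivity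
  -- Grid times are nonnegative, so `toNNReal` loses nothing. For `L = 0` both sides vanish, since
  -- division by zero gives `step = 0`.
  suffices hd : G.step L = nndist (G.gridTime L (k + 1)).toNNReal (G.gridTime L k).toNNReal by
    rw [hd]; exact h
  rw [coe_nndist, NNReal.dist_eq, Real.coe_toNNReal _ (h0 _), Real.coe_toNNReal _ (h0 _)]
  unfold Game.gridTime
  push_cast
  rw [← sub_mul]
  simp [abs_of_nonneg hs]

/-! ### Bounds for the Hamiltonian and the volatility. -/

/-- The uniform bounds are needed because a real `⨆` or `⨅` over an unbounded range takes a default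
value and is no longer monotone. -/
lemma iInf_iSup_le_iInf_iSup_add {U V : Type*} [Nonempty U] [Nonempty V] {f g : U → V → ℝ}
    {Cf Cg c : ℝ} (hf : ∀ u v, |f u v| ≤ Cf) (hg : ∀ u v, |g u v| ≤ Cg)
    (h : ∀ u v, f u v ≤ g u v + c) : ⨅ u, ⨆ v, f u v ≤ (⨅ u, ⨆ v, g u v) + c := by
  have bdd : ∀ (f : U → V → ℝ) (C : ℝ), (∀ u v, |f u v| ≤ C) → ∀ u, BddAbove (range (f u)) := by
    rintro f C h u
    exact ⟨C, by rintro _ ⟨v, rfl⟩; exact (abs_le.1 (h u v)).2⟩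
  have bdd' : BddBelow (range fun u ↦ ⨆ v, f u v) := by
    refine ⟨-Cf, ?_⟩
    rintro _ ⟨u, rfl⟩
    obtain ⟨v⟩ := ‹Nonempty V›
    exact (abs_le.1 (hf u v)).1.trans (le_ciSup (bdd f Cf hf u) v)
  rw [← sub_le_iff_le_add]
  refine le_ciInf fun u ↦ ?_
  rw [sub_le_iff_le_add]
  refine (ciInf_le bdd' u).trans (ciSup_le fun v ↦ (h u v).trans ?_)
  gcongr
  exact le_ciSup (bdd g Cg hg u) v

lemma abs_iInf_iSup_sub_le {U V : Type*} [Nonempty U] [Nonempty V] {f g : U → V → ℝ}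
    {Cf Cg c : ℝ} (hf : ∀ u v, |f u v| ≤ Cf) (hg : ∀ u v, |g u v| ≤ Cg)
    (h : ∀ u v, |f u v - g u v| ≤ c) : |(⨅ u, ⨆ v, f u v) - ⨅ u, ⨆ v, g u v| ≤ c := by
  have h1 := iInf_iSup_le_iInf_iSup_add hf hg (c := c) fun u v ↦ by
    linarith [(abs_le.1 (h u v)).2]
  have h2 := iInf_iSup_le_iInf_iSup_add hg hf (c := c) fun u v ↦ by
    linarith [(abs_le.1 (h u v)).1]
  rw [abs_le]; constructor <;> linarith

lemma exists_common_bound {ι : Type*} [Finite ι] {p : ι → ℝ → Prop}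
    (hp : ∀ i a b, a ≤ b → p i a → p i b) (h : ∀ i, ∃ C, p i C) : ∃ C, 0 ≤ C ∧ ∀ i, p i C := by
  cases nonempty_fintype ι
  choose C hC using h
  refine ⟨∑ i, |C i|, Finset.sum_nonneg fun _ _ ↦ abs_nonneg _, fun i ↦ hp i _ _ ?_ (hC i)⟩
  exact (le_abs_self _).trans
    (Finset.single_le_sum (f := fun i ↦ |C i|) (fun _ _ ↦ abs_nonneg _) (Finset.mem_univ i))

lemma abs_sum_mul_le {I : ℕ} (p a : Fin I → ℝ) {c : ℝ} (ha : ∀ i, |a i| ≤ c) :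
    |∑ i, p i * a i| ≤ I * ‖p‖ * c := by
  refine (Finset.abs_sum_le_sum_abs _ _).trans ?_
  have : ∀ i ∈ (Finset.univ : Finset (Fin I)), |p i * a i| ≤ ‖p‖ * c := fun i _ ↦ by
    rw [abs_mul]
    exact mul_le_mul (norm_le_pi_norm p i) (ha i) (abs_nonneg _) (norm_nonneg _)
  refine (Finset.sum_le_sum this).trans ?_
  simp [mul_assoc]

lemma norm_toEuclideanLin_le {d : ℕ} (A : Matrix (Fin d) (Fin d) ℝ) {c : ℝ}
    (hA : ∀ i j, |A i j| ≤ c) (y : EuclideanSpace ℝ (Fin d)) :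
    ‖A.toEuclideanLin y‖ ≤ d * d * c * ‖y‖ := by
  refine (norm_le_sum_abs _).trans ?_
  have : ∀ i ∈ (Finset.univ : Finset (Fin d)), |A.toEuclideanLin y i| ≤ d * c * ‖y‖ := by
    intro i _
    have h1 : A.toEuclideanLin y i = ∑ j, A i j * y j := by
      simp [Matrix.toEuclideanLin, Matrix.mulVec, dotProduct]
    rw [h1]
    refine (Finset.abs_sum_le_sum_abs _ _).trans ?_
    have : ∀ j ∈ (Finset.univ : Finset (Fin d)), |A i j * y j| ≤ c * ‖y‖ := fun j _ ↦ by
      rw [abs_mul]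
      exact mul_le_mul (hA i j) (PiLp.norm_apply_le y j) (abs_nonneg _)
        ((abs_nonneg _).trans (hA i j))
    refine (Finset.sum_le_sum this).trans ?_
    simp [mul_assoc]
  refine (Finset.sum_le_sum this).trans ?_
  simp [mul_assoc]

lemma norm_le_one_of_mem_simplex {I : ℕ} {p : Fin I → ℝ} (hp : p ∈ simplex I) : ‖p‖ ≤ 1 := by
  refine (pi_norm_le_iff_of_nonneg zero_le_one).2 fun i ↦ ?_
  have := mem_Icc_of_mem_stdSimplex hp i
  rw [Real.norm_eq_abs, abs_of_nonneg this.1]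
  exact this.2

namespace Game

variable {d I m n : ℕ} {G : Game d I m n}

/-- An inf-sup is 1-Lipschitz for the uniform norm, so it inherits the estimates of the expression
under it. That expression pairs `(b, l)` with `(ξ, p)` linearly: the modulus in `(ξ, p)` is uniform,
whereas the modulus in `(t, x)` is proportional to `‖ξ‖ + ‖p‖`. -/
lemma Assumptions.exists_hamiltonian_bounds (hG : G.Assumptions) : ∃ C, 0 ≤ C ∧
    (∀ t ∈ Icc 0 G.T, ∀ x ξ (p : Fin I → ℝ), |G.hamiltonian t x ξ p| ≤ C * (‖ξ‖ + ‖p‖)) ∧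
    ∀ t ∈ Icc 0 G.T, ∀ t' ∈ Icc 0 G.T, ∀ x x' ξ ξ' (p p' : Fin I → ℝ),
      |G.hamiltonian t x ξ p - G.hamiltonian t' x' ξ' p'| ≤
        C * ((|t - t'| + ‖x - x'‖) * (‖ξ‖ + ‖p‖) + ‖ξ - ξ'‖ + ‖p - p'‖) := by
  have : Nonempty G.U := hG.U_nonempty.to_subtype
  have : Nonempty G.V := hG.V_nonempty.to_subtype
  obtain ⟨Cb, hCb⟩ := hG.b_bounded
  obtain ⟨Lb, hLb⟩ := hG.b_lipschitz
  obtain ⟨Cl, hCl0, hCl⟩ := exists_common_bound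
    (p := fun i C ↦ ∀ t ∈ Icc 0 G.T, ∀ x u v, |G.l i t x u v| ≤ C)
    (fun i a b hab h t ht x u v ↦ (h t ht x u v).trans hab) hG.l_bounded
  obtain ⟨Ll, hLl0, hLl⟩ := exists_common_bound
    (p := fun i C ↦ ∀ t ∈ Icc 0 G.T, ∀ t' ∈ Icc 0 G.T, ∀ x x' u v,
      |G.l i t x u v - G.l i t' x' u v| ≤ C * (|t - t'| + ‖x - x'‖))
    (fun i a b hab h t ht t' ht' x x' u v ↦ (h t ht t' ht' x x' u v).trans (by gcongr))
    hG.l_lipschitz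
  set C := |Cb| + |Lb| + I * Cl + I * Ll with hC
  have e1 : Cb ≤ C := by have := le_abs_self Cb; have := abs_nonneg Lb; rw [hC]; nlinarith [mul_nonneg (Nat.cast_nonneg (α := ℝ) I) hCl0, mul_nonneg (Nat.cast_nonneg (α := ℝ) I) hLl0]
  have e2 : Lb ≤ C := by have := le_abs_self Lb; have := abs_nonneg Cb; rw [hC]; nlinarith [mul_nonneg (Nat.cast_nonneg (α := ℝ) I) hCl0, mul_nonneg (Nat.cast_nonneg (α := ℝ) I) hLl0]
  have e3 : I * Cl ≤ C := by have := abs_nonneg Lb; have := abs_nonneg Cb; rw [hC]; nlinarith [mul_nonneg (Nat.cast_nonneg (α := ℝ) I) hLl0]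
  have e4 : I * Ll ≤ C := by have := abs_nonneg Lb; have := abs_nonneg Cb; rw [hC]; nlinarith [mul_nonneg (Nat.cast_nonneg (α := ℝ) I) hCl0]
  have hbd : ∀ t ∈ Icc 0 G.T, ∀ x ξ (p : Fin I → ℝ) u v,
      |inner ℝ (G.b t x u v) ξ + ∑ i, p i * G.l i t x u v| ≤ C * (‖ξ‖ + ‖p‖) := by
    intro t ht x ξ p u v
    have h1 : |inner ℝ (G.b t x u v) ξ| ≤ C * ‖ξ‖ := (abs_real_inner_le_norm _ _).trans
      (by gcongr; exact (hCb t ht x u v).trans e1)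
    have h2 := abs_sum_mul_le p (fun i ↦ G.l i t x u v) fun i ↦ hCl i t ht x u v
    have h3 : I * ‖p‖ * Cl ≤ C * ‖p‖ := by
      calc I * ‖p‖ * Cl = (I * Cl) * ‖p‖ := by ring
        _ ≤ _ := by gcongr
    have := abs_add_le (inner ℝ (G.b t x u v) ξ) (∑ i, p i * G.l i t x u v)
    linarith
  refine ⟨C, by positivity, fun t ht x ξ p ↦ ?_, fun t ht t' ht' x x' ξ ξ' p p' ↦ ?_⟩
  -- Comparison with the zero function turns the Lipschitz property of inf-sup into a bound.
  · have := abs_iInf_iSup_sub_le (hbd t ht x ξ p) (g := fun _ _ ↦ 0) (Cg := 0) (by simp)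
      (c := C * (‖ξ‖ + ‖p‖)) (by simpa using hbd t ht x ξ p)
    simpa [hamiltonian] using this
  · refine abs_iInf_iSup_sub_le (hbd t ht x ξ p) (hbd t' ht' x' ξ' p') fun u v ↦ ?_
    have key : inner ℝ (G.b t x u v) ξ + ∑ i, p i * G.l i t x u v -
        (inner ℝ (G.b t' x' u v) ξ' + ∑ i, p' i * G.l i t' x' u v) =
        inner ℝ (G.b t x u v - G.b t' x' u v) ξ + inner ℝ (G.b t' x' u v) (ξ - ξ') +
        ∑ i, p i * (G.l i t x u v - G.l i t' x' u v) + ∑ i, (p - p') i * G.l i t' x' u v := by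
      simp only [inner_sub_left, inner_sub_right, mul_sub, Pi.sub_apply, sub_mul,
        Finset.sum_sub_distrib]
      ring
    rw [key]
    have hd : 0 ≤ |t - t'| + ‖x - x'‖ := by positivity
    have h1 : |inner ℝ (G.b t x u v - G.b t' x' u v) ξ| ≤ C * (|t - t'| + ‖x - x'‖) * ‖ξ‖ :=
      (abs_real_inner_le_norm _ _).trans
        (by gcongr; exact (hLb t ht t' ht' x x' u v).trans (by gcongr))
    have h2 : |inner ℝ (G.b t' x' u v) (ξ - ξ')| ≤ C * ‖ξ - ξ'‖ :=
      (abs_real_inner_le_norm _ _).trans (by gcongr; exact (hCb t' ht' x' u v).trans e1)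
    have h3 := abs_sum_mul_le p (fun i ↦ G.l i t x u v - G.l i t' x' u v)
      fun i ↦ hLl i t ht t' ht' x x' u v
    have h3' : I * ‖p‖ * (Ll * (|t - t'| + ‖x - x'‖)) ≤ C * (|t - t'| + ‖x - x'‖) * ‖p‖ := by
      calc _ = (I * Ll) * (|t - t'| + ‖x - x'‖) * ‖p‖ := by ring
        _ ≤ _ := by gcongr
    have h4 := abs_sum_mul_le (p - p') (fun i ↦ G.l i t' x' u v) fun i ↦ hCl i t' ht' x' u v
    have h4' : I * ‖p - p'‖ * Cl ≤ C * ‖p - p'‖ := by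
      calc _ = (I * Cl) * ‖p - p'‖ := by ring
        _ ≤ _ := by gcongr
    have a1 := abs_add_le (inner ℝ (G.b t x u v - G.b t' x' u v) ξ +
      inner ℝ (G.b t' x' u v) (ξ - ξ') + ∑ i, p i * (G.l i t x u v - G.l i t' x' u v))
      (∑ i, (p - p') i * G.l i t' x' u v)
    have a2 := abs_add_three (inner ℝ (G.b t x u v - G.b t' x' u v) ξ)
      (inner ℝ (G.b t' x' u v) (ξ - ξ')) (∑ i, p i * (G.l i t x u v - G.l i t' x' u v))
    linarith

lemma Assumptions.exists_sigma_bounds (hG : G.Assumptions) : ∃ C, 0 ≤ C ∧ ∀ t ∈ Icc 0 G.T,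
    (∀ x y, ‖(G.σ t x).toEuclideanLin y‖ ≤ C * ‖y‖) ∧
    (∀ x y, ‖(G.σ t x).transpose⁻¹.toEuclideanLin y‖ ≤ C * ‖y‖) ∧
    (∀ x x' y, ‖(G.σ t x).toEuclideanLin y - (G.σ t x').toEuclideanLin y‖ ≤
      C * ‖x - x'‖ * ‖y‖) ∧
    (∀ x x' y, ‖(G.σ t x).transpose⁻¹.toEuclideanLin y -
      (G.σ t x').transpose⁻¹.toEuclideanLin y‖ ≤ C * ‖x - x'‖ * ‖y‖) := by
  obtain ⟨C1, h1⟩ := hG.σ_bounded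
  obtain ⟨C2, h2⟩ := hG.σ_inv_bounded
  obtain ⟨C3, h3⟩ := hG.σ_lipschitz
  obtain ⟨C4, h4⟩ := hG.σ_inv_lipschitz
  set c := |C1| + |C2| + |C3| + |C4| with hc
  have b1 := abs_nonneg C1
  have b2 := abs_nonneg C2
  have b3 := abs_nonneg C3
  have b4 := abs_nonneg C4
  have l1 := le_abs_self C1
  have l2 := le_abs_self C2
  have l3 := le_abs_self C3
  have l4 := le_abs_self C4
  refine ⟨d * d * c, by positivity, fun t ht ↦ ⟨fun x y ↦ ?_, fun x y ↦ ?_, fun x x' y ↦ ?_,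
    fun x x' y ↦ ?_⟩⟩
  · exact norm_toEuclideanLin_le _ (fun i j ↦ (h1 t ht x i j).trans (by linarith)) y
  · exact norm_toEuclideanLin_le _ (fun i j ↦ (h2 t ht x i j).trans (by linarith)) y
  · rw [← LinearMap.sub_apply, ← map_sub]
    refine (norm_toEuclideanLin_le _ (c := c * ‖x - x'‖) (fun i j ↦ ?_) y).trans
      (le_of_eq (by ring))
    refine (h3 t ht t ht x x' i j).trans ?_
    simp only [sub_self, abs_zero, zero_add]
    gcongr
    linarith
  · rw [← LinearMap.sub_apply, ← map_sub]
    refine (norm_toEuclideanLin_le _ (c := c * ‖x - x'‖) (fun i j ↦ ?_) y).trans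
      (le_of_eq (by ring))
    refine (h4 t ht t ht x x' i j).trans ?_
    simp only [sub_self, abs_zero, zero_add]
    gcongr
    linarith

end Game

/-! ### The convex envelope on the simplex. -/

section Vex

variable {I : ℕ} {f f' h : (Fin I → ℝ) → ℝ} {p : Fin I → ℝ}

lemma le_vex (hp : p ∈ simplex I) (hc : ConvexOn ℝ (simplex I) h)
    (hf : ∀ q ∈ simplex I, h q ≤ f q) : h p ≤ vex f p := by
  refine le_csSup ⟨f p, ?_⟩ ⟨h, hc, hf, rfl⟩
  rintro _ ⟨k, _, hk, rfl⟩
  exact hk p hp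

/-- The lower bound `c` provides a convex minorant; without one the defining set could be empty and
its `sSup` would be zero. -/
lemma vex_le {a c : ℝ} (hf : ∀ q ∈ simplex I, c ≤ f q)
    (ha : ∀ k, ConvexOn ℝ (simplex I) k → (∀ q ∈ simplex I, k q ≤ f q) → k p ≤ a) :
    vex f p ≤ a := by
  refine csSup_le ⟨c, fun _ ↦ c, convexOn_const c (convex_stdSimplex ℝ _), hf, rfl⟩ ?_
  rintro _ ⟨k, hk, hkf, rfl⟩
  exact ha k hk hkf

lemma vex_le_self {c : ℝ} (hf : ∀ q ∈ simplex I, c ≤ f q) (hp : p ∈ simplex I) :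
    vex f p ≤ f p :=
  vex_le hf fun _ _ hk ↦ hk p hp

lemma convexOn_vex {c : ℝ} (hf : ∀ q ∈ simplex I, c ≤ f q) : ConvexOn ℝ (simplex I) (vex f) := by
  refine ⟨convex_stdSimplex ℝ _, fun p hp q hq a b ha hb hab ↦ ?_⟩
  refine vex_le hf fun k hk hkf ↦ (hk.2 hp hq ha hb hab).trans ?_
  have := le_vex hp hk hkf
  have := le_vex hq hk hkf
  simp only [smul_eq_mul]
  gcongr

/-- Shifting a convex minorant of `f` by `-e` gives one of `f'`. Hence `vex` is a contraction for
the uniform norm, which carries regularity in `x` through it. -/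
lemma vex_le_vex_add {c e : ℝ} (hf : ∀ q ∈ simplex I, c ≤ f q)
    (hff : ∀ q ∈ simplex I, f q ≤ f' q + e) (hp : p ∈ simplex I) : vex f p ≤ vex f' p + e := by
  refine vex_le hf fun k hk hkf ↦ ?_
  have h1 := le_vex (f := f') hp (hk.add_const (-e)) fun q hq ↦ by
    have := hkf q hq
    have := hff q hq
    simp only [Pi.add_apply]
    linarith
  simp only [Pi.add_apply] at h1
  linarith

end Vex

/-! ### Integrability of functions of the noise. -/

section Noise

variable {Ω : Type*} [MeasurableSpace Ω] {d : ℕ} {P : Measure Ω}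
  {N : Ω → EuclideanSpace ℝ (Fin d)} {τ : ℝ} {C : ℕ → ℝ}

/-- `W` is measurable and grows at most like `‖N‖ ^ 4`. -/
def QuarticGrowth (P : Measure Ω) (N : Ω → EuclideanSpace ℝ (Fin d)) (W : Ω → ℝ) : Prop :=
  AEStronglyMeasurable W P ∧ ∃ K, ∀ ω, |W ω| ≤ K * (1 + ‖N ω‖ ^ 4)

lemma QuarticGrowth.sub {W W' : Ω → ℝ} (h : QuarticGrowth P N W) (h' : QuarticGrowth P N W') :
    QuarticGrowth P N (fun ω ↦ W ω - W' ω) := by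
  obtain ⟨hm, K, hK⟩ := h
  obtain ⟨hm', K', hK'⟩ := h'
  refine ⟨hm.sub hm', K + K', fun ω ↦ (abs_sub _ _).trans ?_⟩
  linarith [hK ω, hK' ω]

lemma QuarticGrowth.of_bounded {W : Ω → ℝ} (hm : AEStronglyMeasurable W P) {S : ℝ}
    (h : ∀ ω, |W ω| ≤ S) : QuarticGrowth P N W := by
  refine ⟨hm, S, fun ω ↦ (h ω).trans ?_⟩
  have : 0 ≤ S := (abs_nonneg _).trans (h ω)
  nlinarith [mul_nonneg this (pow_nonneg (norm_nonneg (N ω)) 4)]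

lemma IsNoise.integrable_mul_pow (hN : IsNoise P N τ C) {W : Ω → ℝ} (hW : QuarticGrowth P N W)
    (k : ℕ) : Integrable (fun ω ↦ W ω * ‖N ω‖ ^ k) P := by
  obtain ⟨hm, K, hK⟩ := hW
  refine (((hN.integrable_pow k).add (hN.integrable_pow (4 + k))).const_mul K).mono'
    (hm.mul (hN.aemeasurable.norm.pow_const _).aestronglyMeasurable) (ae_of_all _ fun ω ↦ ?_)
  rw [norm_mul, norm_pow, norm_norm, Real.norm_eq_abs]
  refine (mul_le_mul_of_nonneg_right (hK ω) (by positivity)).trans (le_of_eq ?_)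
  simp only [Pi.add_apply]
  ring

lemma IsNoise.integrable (hN : IsNoise P N τ C) {W : Ω → ℝ} (hW : QuarticGrowth P N W) :
    Integrable W P := by
  simpa using hN.integrable_mul_pow hW 0

lemma IsNoise.integrable_smul (hN : IsNoise P N τ C) {W : Ω → ℝ} (hW : QuarticGrowth P N W)
    (A : EuclideanSpace ℝ (Fin d) →ₗ[ℝ] EuclideanSpace ℝ (Fin d)) :
    Integrable (fun ω ↦ W ω • A (N ω)) P := by
  set A' : EuclideanSpace ℝ (Fin d) →L[ℝ] EuclideanSpace ℝ (Fin d) :=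
    LinearMap.toContinuousLinearMap A
  have hA : ∀ y, A y = A' y := fun _ ↦ rfl
  simp only [hA]
  refine ((hN.integrable_mul_pow hW 1).norm.const_mul ‖A'‖).mono'
    (hW.1.smul (A'.continuous.measurable.comp_aemeasurable hN.aemeasurable).aestronglyMeasurable)
    (ae_of_all _ fun ω ↦ ?_)
  rw [norm_smul, norm_mul, pow_one, norm_norm]
  have := A'.le_opNorm (N ω)
  calc ‖W ω‖ * ‖A' (N ω)‖ ≤ ‖W ω‖ * (‖A'‖ * ‖N ω‖) := by gcongr
    _ = _ := by ring

lemma IsNoise.integrable_self (hN : IsNoise P N τ C) : Integrable N P := by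
  refine (hN.integrable_pow 1).mono' hN.aemeasurable.aestronglyMeasurable (ae_of_all _ fun ω ↦ ?_)
  simp

lemma IsNoise.integral_clm (hN : IsNoise P N τ C) {F : Type*} [NormedAddCommGroup F]
    [NormedSpace ℝ F] [CompleteSpace F] (A : EuclideanSpace ℝ (Fin d) →L[ℝ] F) :
    ∫ ω, A (N ω) ∂P = 0 := by
  rw [A.integral_comp_comm hN.integrable_self]
  have : ∫ ω, N ω ∂P = 0 := by
    ext i
    have h : ∫ ω, N ω i ∂P = (∫ ω, N ω ∂P) i :=
      (EuclideanSpace.proj (𝕜 := ℝ) i).integral_comp_comm hN.integrable_self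
    rw [← h, hN.integral_coord]
    rfl
  rw [this, map_zero]

end Noise

/-! ### One step of the scheme: monotonicity, bounds, regularity. -/

namespace Game

variable {d I m n : ℕ} {G : Game d I m n} {Ω : Type*} [MeasurableSpace Ω] {P : Measure Ω}

/-- `E[W] + τ H(t, x, (1/τ) E[W (σ*)⁻¹(t, x) N], p)`. -/
def stepValue (G : Game d I m n) (P : Measure Ω) (t τ : ℝ) (N : Ω → EuclideanSpace ℝ (Fin d))
    (x : EuclideanSpace ℝ (Fin d)) (p : Fin I → ℝ) (W : Ω → ℝ) : ℝ :=
  (∫ ω, W ω ∂P) + τ * G.hamiltonian t x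
    (τ⁻¹ • ∫ ω, W ω • (G.σ t x).transpose⁻¹.toEuclideanLin (N ω) ∂P) p

/-- Constants for the Hamiltonian (`CH`) and for the volatility and its inverse (`Cσ`). -/
structure HasBounds (G : Game d I m n) (CH Cσ : ℝ) : Prop where
  T_pos : 0 < G.T
  CH_nonneg : 0 ≤ CH
  Cσ_nonneg : 0 ≤ Cσ
  ham_le : ∀ t ∈ Icc 0 G.T, ∀ x ξ (p : Fin I → ℝ), |G.hamiltonian t x ξ p| ≤ CH * (‖ξ‖ + ‖p‖)
  ham_sub_le : ∀ t ∈ Icc 0 G.T, ∀ t' ∈ Icc 0 G.T, ∀ x x' ξ ξ' (p p' : Fin I → ℝ),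
    |G.hamiltonian t x ξ p - G.hamiltonian t' x' ξ' p'| ≤
      CH * ((|t - t'| + ‖x - x'‖) * (‖ξ‖ + ‖p‖) + ‖ξ - ξ'‖ + ‖p - p'‖)
  sigma_le : ∀ t ∈ Icc 0 G.T, ∀ x y, ‖(G.σ t x).toEuclideanLin y‖ ≤ Cσ * ‖y‖
  inv_le : ∀ t ∈ Icc 0 G.T, ∀ x y, ‖(G.σ t x).transpose⁻¹.toEuclideanLin y‖ ≤ Cσ * ‖y‖
  sigma_sub_le : ∀ t ∈ Icc 0 G.T, ∀ x x' y,
    ‖(G.σ t x).toEuclideanLin y - (G.σ t x').toEuclideanLin y‖ ≤ Cσ * ‖x - x'‖ * ‖y‖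
  inv_sub_le : ∀ t ∈ Icc 0 G.T, ∀ x x' y,
    ‖(G.σ t x).transpose⁻¹.toEuclideanLin y - (G.σ t x').transpose⁻¹.toEuclideanLin y‖ ≤
      Cσ * ‖x - x'‖ * ‖y‖

lemma Assumptions.exists_hasBounds (hG : G.Assumptions) : ∃ CH Cσ, G.HasBounds CH Cσ := by
  obtain ⟨CH, h0, h1, h2⟩ := hG.exists_hamiltonian_bounds
  obtain ⟨Cσ, h3, h4⟩ := hG.exists_sigma_bounds
  exact ⟨CH, Cσ, hG.T_pos, h0, h3, h1, h2, fun t ht ↦ (h4 t ht).1, fun t ht ↦ (h4 t ht).2.1,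
    fun t ht ↦ (h4 t ht).2.2.1, fun t ht ↦ (h4 t ht).2.2.2⟩

variable {CH Cσ t τ : ℝ} {N : Ω → EuclideanSpace ℝ (Fin d)} {C : ℕ → ℝ}

/-- Approximate monotonicity of one step of the scheme. -/
lemma HasBounds.stepValue_le (hb : G.HasBounds CH Cσ) (ht : t ∈ Icc 0 G.T) (hτ : 0 < τ)
    (hN : IsNoise P N τ C) (x : EuclideanSpace ℝ (Fin d)) (p : Fin I → ℝ) {W W' : Ω → ℝ}
    (hW : QuarticGrowth P N W) (hW' : QuarticGrowth P N W') (hle : ∀ ω, W ω ≤ W' ω) :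
    G.stepValue P t τ N x p W ≤ G.stepValue P t τ N x p W' +
      (CH * Cσ) ^ 4 * ∫ ω, (W' ω - W ω) * ‖N ω‖ ^ 4 ∂P := by
  have hD := hW'.sub hW
  set A := (G.σ t x).transpose⁻¹.toEuclideanLin
  have hz : ‖(τ⁻¹ • ∫ ω, W ω • A (N ω) ∂P) - (τ⁻¹ • ∫ ω, W' ω • A (N ω) ∂P)‖ ≤
      τ⁻¹ * (Cσ * ∫ ω, (W' ω - W ω) * ‖N ω‖ ^ 1 ∂P) := by
    rw [← smul_sub, ← integral_sub (hN.integrable_smul hW A) (hN.integrable_smul hW' A),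
      norm_smul, Real.norm_eq_abs, abs_of_pos (inv_pos.2 hτ), ← integral_const_mul]
    refine mul_le_mul_of_nonneg_left ?_ (inv_pos.2 hτ).le
    refine norm_integral_le_of_norm_le ((hN.integrable_mul_pow hD 1).const_mul _)
      (ae_of_all _ fun ω ↦ ?_)
    rw [← sub_smul, norm_smul, Real.norm_eq_abs, abs_of_nonpos (by linarith [hle ω]), pow_one]
    calc _ ≤ -(W ω - W' ω) * (Cσ * ‖N ω‖) := by
          gcongr
          · linarith [hle ω]
          · exact hb.inv_le t ht x _
      _ = _ := by ring
  have hH := (abs_le.1 (hb.ham_sub_le t ht t ht x x (τ⁻¹ • ∫ ω, W ω • A (N ω) ∂P)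
    (τ⁻¹ • ∫ ω, W' ω • A (N ω) ∂P) p p)).2
  simp only [sub_self, abs_zero, norm_zero, add_zero, zero_mul, zero_add] at hH
  have hH' := hH.trans (mul_le_mul_of_nonneg_left hz hb.CH_nonneg)
  have hH'' := mul_le_mul_of_nonneg_left hH' hτ.le
  have e : τ * (CH * (τ⁻¹ * (Cσ * ∫ ω, (W' ω - W ω) * ‖N ω‖ ^ 1 ∂P))) =
      CH * Cσ * ∫ ω, (W' ω - W ω) * ‖N ω‖ ^ 1 ∂P := by
    field_simp
  rw [e] at hH''
  have hI : ∫ ω, (W' ω - W ω) ∂P = (∫ ω, W' ω ∂P) - ∫ ω, W ω ∂P :=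
    integral_sub (hN.integrable hW') (hN.integrable hW)
  -- With `D = W' - W ≥ 0`, raising `W` to `W'` gains `E[D]` and loses at most `CH Cσ E[D ‖N‖]`
  -- through the Hamiltonian. The pointwise inequality `s - 1 ≤ s ^ 4` for `s = CH Cσ ‖N‖` leaves a
  -- fourth moment, of order `τ²` for bounded `D`.
  have key : CH * Cσ * (∫ ω, (W' ω - W ω) * ‖N ω‖ ^ 1 ∂P) - ∫ ω, (W' ω - W ω) ∂P ≤
      (CH * Cσ) ^ 4 * ∫ ω, (W' ω - W ω) * ‖N ω‖ ^ 4 ∂P := by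
    rw [← integral_const_mul, ← integral_const_mul,
      ← integral_sub ((hN.integrable_mul_pow hD 1).const_mul _) (hN.integrable hD)]
    refine integral_mono (((hN.integrable_mul_pow hD 1).const_mul _).sub (hN.integrable hD))
      ((hN.integrable_mul_pow hD 4).const_mul _) fun ω ↦ ?_
    have h0 : 0 ≤ W' ω - W ω := sub_nonneg.2 (hle ω)
    set s := CH * Cσ * ‖N ω‖
    have hs : s - 1 ≤ s ^ 4 := by nlinarith [sq_nonneg (s ^ 2 - 1 / 2), sq_nonneg (s - 1 / 2)]
    calc _ = (W' ω - W ω) * (s - 1) := by simp only [s]; ring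
      _ ≤ (W' ω - W ω) * s ^ 4 := by gcongr
      _ = _ := by simp only [s]; ring
  unfold stepValue
  linarith [mul_sub τ (G.hamiltonian t x (τ⁻¹ • ∫ ω, W ω • A (N ω) ∂P) p)
    (G.hamiltonian t x (τ⁻¹ • ∫ ω, W' ω • A (N ω) ∂P) p)]

lemma stepValue_const [IsProbabilityMeasure P] (hN : IsNoise P N τ C)
    (x : EuclideanSpace ℝ (Fin d)) (p : Fin I → ℝ) (c : ℝ) :
    G.stepValue P t τ N x p (fun _ ↦ c) = c + τ * G.hamiltonian t x 0 p := by
  have := hN.integral_clm (LinearMap.toContinuousLinearMap (G.σ t x).transpose⁻¹.toEuclideanLin)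
  simp only [LinearMap.coe_toContinuousLinearMap'] at this
  simp [stepValue, integral_smul, this]

/-- `W` is bounded by `S` and Lipschitz in `x`, uniformly on the simplex. -/
def BoundedLipschitz (W : EuclideanSpace ℝ (Fin d) → (Fin I → ℝ) → ℝ) (S : ℝ) : Prop :=
  (∀ x, ∀ p ∈ simplex I, |W x p| ≤ S) ∧
    ∃ Λ, 0 ≤ Λ ∧ ∀ x x', ∀ p ∈ simplex I, |W x p - W x' p| ≤ Λ * ‖x - x'‖

lemma BoundedLipschitz.mono {W : EuclideanSpace ℝ (Fin d) → (Fin I → ℝ) → ℝ} {S S' : ℝ}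
    (h : BoundedLipschitz W S) (hS : S ≤ S') : BoundedLipschitz W S' :=
  ⟨fun x p hp ↦ (h.1 x p hp).trans hS, h.2⟩

lemma BoundedLipschitz.continuous {W : EuclideanSpace ℝ (Fin d) → (Fin I → ℝ) → ℝ} {S : ℝ}
    (h : BoundedLipschitz W S) {p : Fin I → ℝ} (hp : p ∈ simplex I) :
    Continuous fun x ↦ W x p := by
  obtain ⟨Λ, h0, hΛ⟩ := h.2
  refine (LipschitzWith.of_dist_le_mul (K := ⟨Λ, h0⟩) fun x x' ↦ ?_).continuous
  rw [Real.dist_eq, dist_eq_norm]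
  exact hΛ x x' p hp

lemma BoundedLipschitz.quarticGrowth {W : EuclideanSpace ℝ (Fin d) → (Fin I → ℝ) → ℝ} {S : ℝ}
    (h : BoundedLipschitz W S) {p : Fin I → ℝ} (hp : p ∈ simplex I) (hN : IsNoise P N τ C)
    (x : EuclideanSpace ℝ (Fin d)) (A : EuclideanSpace ℝ (Fin d) →ₗ[ℝ] EuclideanSpace ℝ (Fin d)) :
    QuarticGrowth P N (fun ω ↦ W (x + A (N ω)) p) := by
  refine .of_bounded ?_ fun ω ↦ h.1 _ p hp
  have : Continuous fun y ↦ W (x + A y) p :=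
    (h.continuous hp).comp (continuous_const.add A.continuous_of_finiteDimensional)
  exact (this.measurable.comp_aemeasurable hN.aemeasurable).aestronglyMeasurable

/-- One step `x ↦ vex` applied to a terminal function `W`. -/
lemma backwardStep_eq (B : ℝ≥0 → Ω → EuclideanSpace ℝ (Fin d)) (L k : ℕ)
    (W : EuclideanSpace ℝ (Fin d) → (Fin I → ℝ) → ℝ) (x : EuclideanSpace ℝ (Fin d)) :
    G.backwardStep P B L k W x = vex fun p ↦
      G.stepValue P (G.gridTime L k) (G.step L) (G.increment B L k) x p
        fun ω ↦ W (x + (G.σ (G.gridTime L k) x).toEuclideanLin (G.increment B L k ω)) p := rfl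

/-- `W` lies between the constants `-S` and `S`, on which the step is computed exactly; approximate
monotonicity does the rest. -/
lemma HasBounds.abs_stepValue_le [IsProbabilityMeasure P] (hb : G.HasBounds CH Cσ)
    (ht : t ∈ Icc 0 G.T) (hτ : 0 < τ) (hN : IsNoise P N τ C)
    (x : EuclideanSpace ℝ (Fin d)) {p : Fin I → ℝ} (hp : p ∈ simplex I) {W : Ω → ℝ} {S : ℝ}
    (hS : ∀ ω, |W ω| ≤ S) (hm : AEStronglyMeasurable W P) :
    |G.stepValue P t τ N x p W| ≤ S + τ * CH + (CH * Cσ) ^ 4 * (2 * S * (C 4 * √τ ^ 4)) := by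
  have hW : QuarticGrowth P N W := .of_bounded hm hS
  have hc : ∀ c : ℝ, QuarticGrowth P N (fun _ ↦ c) := fun c ↦
    .of_bounded aestronglyMeasurable_const (S := |c|) fun _ ↦ le_rfl
  have h1 := hb.stepValue_le ht hτ hN x p (hc (-S)) hW fun ω ↦ (abs_le.1 (hS ω)).1
  have h2 := hb.stepValue_le ht hτ hN x p hW (hc S) fun ω ↦ (abs_le.1 (hS ω)).2
  rw [stepValue_const hN] at h1 h2
  have hint : ∀ (D : Ω → ℝ), QuarticGrowth P N D → (∀ ω, 0 ≤ D ω ∧ D ω ≤ 2 * S) →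
      (CH * Cσ) ^ 4 * ∫ ω, D ω * ‖N ω‖ ^ 4 ∂P ≤
        (CH * Cσ) ^ 4 * (2 * S * (C 4 * √τ ^ 4)) := fun D hD h ↦ by
    have := mul_nonneg hb.CH_nonneg hb.Cσ_nonneg
    refine mul_le_mul_of_nonneg_left ?_ (by positivity)
    have hle : ∫ ω, D ω * ‖N ω‖ ^ 4 ∂P ≤ ∫ ω, 2 * S * ‖N ω‖ ^ 4 ∂P := by
      refine integral_mono (hN.integrable_mul_pow hD 4) ((hN.integrable_pow 4).const_mul _)
        fun ω ↦ ?_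
      exact mul_le_mul_of_nonneg_right (h ω).2 (by positivity)
    rw [integral_const_mul] at hle
    refine hle.trans ?_
    -- A sample point is needed to deduce `0 ≤ 2 * S` from the pointwise bounds.
    have : Nonempty Ω := (inferInstance : (ae P).NeBot).nonempty
    obtain ⟨ω⟩ := this
    exact mul_le_mul_of_nonneg_left (hN.integral_pow_le 4) ((h ω).1.trans (h ω).2)
  have h3 := hint _ (hW.sub (hc (-S))) fun ω ↦ by
    have := abs_le.1 (hS ω); constructor <;> linarith
  have h4 := hint _ ((hc S).sub hW) fun ω ↦ by
    have := abs_le.1 (hS ω); constructor <;> linarith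
  have hH := abs_le.1 (hb.ham_le t ht x 0 p)
  have hp1 := norm_le_one_of_mem_simplex hp
  rw [norm_zero, zero_add] at hH
  have h5 : CH * ‖p‖ ≤ CH := by nlinarith [hb.CH_nonneg]
  have h6 : τ * G.hamiltonian t x 0 p ≤ τ * CH := by gcongr; linarith
  have h7 : τ * -CH ≤ τ * G.hamiltonian t x 0 p := by gcongr; linarith
  rw [abs_le]; constructor <;> linarith

/-- The dependence of `Λ` on `τ` and `W` is irrelevant: the Lipschitz property only keeps the
integrands of the recursion measurable, and no uniform modulus is ever used. -/
lemma HasBounds.exists_stepValue_lipschitz (hb : G.HasBounds CH Cσ)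
    (ht : t ∈ Icc 0 G.T) (hτ : 0 < τ) (hN : IsNoise P N τ C) [IsProbabilityMeasure P]
    {W : EuclideanSpace ℝ (Fin d) → (Fin I → ℝ) → ℝ} {S : ℝ} (hS : 0 ≤ S)
    (hW : BoundedLipschitz W S) :
    ∃ Λ, 0 ≤ Λ ∧ ∀ x x', ∀ p ∈ simplex I,
      G.stepValue P t τ N x p (fun ω ↦ W (x + (G.σ t x).toEuclideanLin (N ω)) p) ≤
      G.stepValue P t τ N x' p (fun ω ↦ W (x' + (G.σ t x').toEuclideanLin (N ω)) p) +
        Λ * ‖x - x'‖ := by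
  obtain ⟨Λ, hΛ0, hΛ⟩ := hW.2
  have hC := hb.Cσ_nonneg
  have hCH := hb.CH_nonneg
  set k : Ω → ℝ := fun ω ↦ Λ * (1 + Cσ * ‖N ω‖)
  set k' : Ω → ℝ := fun ω ↦ k ω * (Cσ * ‖N ω‖) + S * Cσ * ‖N ω‖
  have i1 : Integrable (fun ω ↦ ‖N ω‖) P := by simpa using hN.integrable_pow 1
  have ik : Integrable k P := ((integrable_const _).add (i1.const_mul _)).const_mul _
  have ik' : Integrable k' P := by
    have : k' = fun ω ↦ (Λ * Cσ + S * Cσ) * ‖N ω‖ + Λ * Cσ * Cσ * ‖N ω‖ ^ 2 := by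
      ext ω; simp only [k', k]; ring
    rw [this]
    exact (i1.const_mul _).add ((hN.integrable_pow 2).const_mul _)
  have k0 : ∀ ω, 0 ≤ k ω := fun ω ↦ by positivity
  have k0' : ∀ ω, 0 ≤ k' ω := fun ω ↦ by have := k0 ω; positivity
  set Z := τ⁻¹ * (S * Cσ * ∫ ω, ‖N ω‖ ∂P)
  have hZ0 : 0 ≤ Z := by
    have := integral_nonneg (μ := P) (f := fun ω ↦ ‖N ω‖) fun ω ↦ norm_nonneg (N ω)
    positivity
  have hk := integral_nonneg (μ := P) (f := k) k0
  have hk' := integral_nonneg (μ := P) (f := k') k0'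
  refine ⟨∫ ω, k ω ∂P + τ * (CH * (Z + 1 + τ⁻¹ * ∫ ω, k' ω ∂P)), by positivity,
    fun x x' p hp ↦ ?_⟩
  have hX : ∀ x, QuarticGrowth P N (fun ω ↦ W (x + (G.σ t x).toEuclideanLin (N ω)) p) :=
    fun x ↦ hW.quarticGrowth hp hN x _
  have hd : ∀ ω, |W (x + (G.σ t x).toEuclideanLin (N ω)) p -
      W (x' + (G.σ t x').toEuclideanLin (N ω)) p| ≤ k ω * ‖x - x'‖ := fun ω ↦ by
    refine (hΛ _ _ p hp).trans ?_
    have : ‖x + (G.σ t x).toEuclideanLin (N ω) - (x' + (G.σ t x').toEuclideanLin (N ω))‖ ≤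
        ‖x - x'‖ + Cσ * ‖x - x'‖ * ‖N ω‖ := by
      rw [add_sub_add_comm]
      exact (norm_add_le _ _).trans (add_le_add_right (hb.sigma_sub_le t ht x x' _) _)
    calc _ ≤ Λ * (‖x - x'‖ + Cσ * ‖x - x'‖ * ‖N ω‖) := by gcongr
      _ = _ := by simp only [k]; ring
  have hE : (∫ ω, W (x + (G.σ t x).toEuclideanLin (N ω)) p ∂P) -
      ∫ ω, W (x' + (G.σ t x').toEuclideanLin (N ω)) p ∂P ≤ (∫ ω, k ω ∂P) * ‖x - x'‖ := by
    rw [← integral_sub (hN.integrable (hX x)) (hN.integrable (hX x')), ← integral_mul_const]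
    exact integral_mono ((hN.integrable (hX x)).sub (hN.integrable (hX x')))
      (ik.mul_const _) fun ω ↦ (le_abs_self _).trans (hd ω)
  set z : EuclideanSpace ℝ (Fin d) → EuclideanSpace ℝ (Fin d) := fun x ↦
    τ⁻¹ • ∫ ω, W (x + (G.σ t x).toEuclideanLin (N ω)) p •
      (G.σ t x).transpose⁻¹.toEuclideanLin (N ω) ∂P with hz
  have hzn : ‖z x‖ ≤ Z := by
    rw [hz, norm_smul, Real.norm_eq_abs, abs_of_pos (inv_pos.2 hτ)]
    simp only [Z]
    rw [← integral_const_mul]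
    refine mul_le_mul_of_nonneg_left ?_ (inv_pos.2 hτ).le
    refine norm_integral_le_of_norm_le (i1.const_mul _) (ae_of_all _ fun ω ↦ ?_)
    rw [norm_smul, mul_assoc]
    exact mul_le_mul (hW.1 _ p hp) (hb.inv_le t ht x _) (norm_nonneg _) hS
  have hzd : ‖z x - z x'‖ ≤ τ⁻¹ * ((∫ ω, k' ω ∂P) * ‖x - x'‖) := by
    simp only [hz]
    rw [← smul_sub, ← integral_sub (hN.integrable_smul (hX x) _) (hN.integrable_smul (hX x') _),
      norm_smul, Real.norm_eq_abs, abs_of_pos (inv_pos.2 hτ), ← integral_mul_const]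
    refine mul_le_mul_of_nonneg_left ?_ (inv_pos.2 hτ).le
    refine norm_integral_le_of_norm_le (ik'.mul_const _) (ae_of_all _ fun ω ↦ ?_)
    set a := W (x + (G.σ t x).toEuclideanLin (N ω)) p
    set a' := W (x' + (G.σ t x').toEuclideanLin (N ω)) p
    set v := (G.σ t x).transpose⁻¹.toEuclideanLin (N ω)
    set v' := (G.σ t x').transpose⁻¹.toEuclideanLin (N ω)
    have e : a • v - a' • v' = (a - a') • v + a' • (v - v') := by
      rw [sub_smul, smul_sub]; abel
    rw [e]
    refine (norm_add_le _ _).trans ?_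
    rw [norm_smul, norm_smul]
    have h1 : ‖a - a'‖ * ‖v‖ ≤ (k ω * ‖x - x'‖) * (Cσ * ‖N ω‖) :=
      mul_le_mul (hd ω) (hb.inv_le t ht x _) (norm_nonneg _)
        (mul_nonneg (k0 ω) (norm_nonneg _))
    have h2 : ‖a'‖ * ‖v - v'‖ ≤ S * (Cσ * ‖x - x'‖ * ‖N ω‖) :=
      mul_le_mul (hW.1 _ p hp) (hb.inv_sub_le t ht x x' _) (norm_nonneg _) hS
    calc _ ≤ _ := add_le_add h1 h2
      _ = _ := by simp only [k']; ring
  have hH := (abs_le.1 (hb.ham_sub_le t ht t ht x x' (z x) (z x') p p)).2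
  have hp1 := norm_le_one_of_mem_simplex hp
  simp only [sub_self, abs_zero, norm_zero, add_zero, zero_add] at hH
  have hH2 : G.hamiltonian t x (z x) p - G.hamiltonian t x' (z x') p ≤
      CH * (‖x - x'‖ * (Z + 1) + τ⁻¹ * ((∫ ω, k' ω ∂P) * ‖x - x'‖)) := by
    refine hH.trans ?_
    gcongr
  have hH3 := mul_le_mul_of_nonneg_left hH2 hτ.le
  unfold stepValue
  have e : (∫ ω, k ω ∂P + τ * (CH * (Z + 1 + τ⁻¹ * ∫ ω, k' ω ∂P))) * ‖x - x'‖ =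
      (∫ ω, k ω ∂P) * ‖x - x'‖ +
        τ * (CH * (‖x - x'‖ * (Z + 1) + τ⁻¹ * ((∫ ω, k' ω ∂P) * ‖x - x'‖))) := by ring
  rw [e]
  linarith

end Game

/-! ### Bounds on the scheme, uniform in the discretization. -/

namespace Game

variable {d I m n : ℕ} {G : Game d I m n} {Ω : Type*} [MeasurableSpace Ω] {P : Measure Ω}
  {CH Cσ : ℝ}

lemma step_pos (hT : 0 < G.T) {L : ℕ} (hL : 0 < L) : 0 < G.step L := by
  unfold step; positivity

lemma step_mul (L : ℕ) (hL : 0 < L) : L * G.step L = G.T := by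
  unfold step; field_simp

lemma step_le (hT : 0 < G.T) {L : ℕ} (hL : 0 < L) : G.step L ≤ G.T := by
  have := step_pos hT hL
  have h1 : (1 : ℝ) ≤ L := by exact_mod_cast hL
  rw [← step_mul L hL]
  nlinarith

lemma gridTime_mem (hT : 0 < G.T) {L k : ℕ} (hL : 0 < L) (hk : k ≤ L) :
    G.gridTime L k ∈ Icc 0 G.T := by
  have := step_pos hT hL
  refine ⟨by unfold gridTime; positivity, ?_⟩
  rw [← step_mul L hL]
  unfold gridTime
  gcongr

lemma gridTime_succ (L k : ℕ) : G.gridTime L (k + 1) = G.gridTime L k + G.step L := by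
  unfold gridTime; push_cast; ring

/-- The growth `S ↦ S + c τ (1 + S)` is of Gronwall type, because the monotonicity error `√τ ^ 4 =
τ²` is at most `T τ`. Convexity in `p` is produced by `vex`, whatever `W` is. -/
lemma HasBounds.exists_backwardStep_boundedLipschitz [IsProbabilityMeasure P]
    (hb : G.HasBounds CH Cσ) {B : ℝ≥0 → Ω → EuclideanSpace ℝ (Fin d)} (hB : IsBrownian P B) :
    ∃ c, 0 ≤ c ∧ ∀ L k : ℕ, k < L → ∀ W S, 0 ≤ S → BoundedLipschitz W S →
      BoundedLipschitz (G.backwardStep P B L k W) (S + c * G.step L * (1 + S)) ∧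
      ∀ x, ConvexOn ℝ (simplex I) (G.backwardStep P B L k W x) := by
  have hM : 0 ≤ momentConst d 4 := by
    unfold momentConst
    exact mul_nonneg (by positivity) (integral_nonneg fun x ↦ by positivity)
  have hH := hb.CH_nonneg
  have hC := hb.Cσ_nonneg
  have hT := hb.T_pos
  refine ⟨CH + (CH * Cσ) ^ 4 * (2 * momentConst d 4 * G.T), by positivity, ?_⟩
  intro L k hk W S hS hW
  have hL : 0 < L := by omega
  have hτ := step_pos hT hL
  have ht := gridTime_mem hT hL hk.le
  have hN := isNoise_increment hB G hT L k
  have hbd : ∀ x, ∀ p ∈ simplex I, _ := fun x p hp ↦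
    hb.abs_stepValue_le ht hτ hN x hp (fun ω ↦ hW.1 _ p hp)
      (hW.quarticGrowth hp hN x (G.σ (G.gridTime L k) x).toEuclideanLin).1
  set S' := S + G.step L * CH + (CH * Cσ) ^ 4 * (2 * S * (momentConst d 4 * √(G.step L) ^ 4))
  have hS' : S' ≤ S + (CH + (CH * Cσ) ^ 4 * (2 * momentConst d 4 * G.T)) * G.step L * (1 + S) := by
    have e : √(G.step L) ^ 4 = G.step L * G.step L := by
      rw [show 4 = 2 * 2 from rfl, pow_mul, Real.sq_sqrt hτ.le, sq]
    have h1 : (CH * Cσ) ^ 4 * (2 * S * (momentConst d 4 * √(G.step L) ^ 4)) ≤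
        (CH * Cσ) ^ 4 * (2 * momentConst d 4 * G.T) * G.step L * S := by
      rw [e]
      calc _ = (CH * Cσ) ^ 4 * (2 * momentConst d 4 * G.step L) * G.step L * S := by ring
        _ ≤ _ := by
          gcongr
          exact step_le hT hL
    have h2 : 0 ≤ CH * G.step L * S := by positivity
    have h3 : 0 ≤ (CH * Cσ) ^ 4 * (2 * momentConst d 4 * G.T) * G.step L := by positivity
    simp only [S']
    linarith
  refine ⟨BoundedLipschitz.mono ⟨fun x p hp ↦ ?_, ?_⟩ hS', fun x ↦ ?_⟩
  · rw [backwardStep_eq, abs_le]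
    exact ⟨le_vex hp (convexOn_const _ (convex_stdSimplex ℝ _))
      fun q hq ↦ (abs_le.1 (hbd x q hq)).1,
      (vex_le_self (fun q hq ↦ (abs_le.1 (hbd x q hq)).1) hp).trans (abs_le.1 (hbd x p hp)).2⟩
  · obtain ⟨Λ, h0, hΛ⟩ := hb.exists_stepValue_lipschitz ht hτ hN hS hW
    refine ⟨Λ, h0, fun x x' p hp ↦ ?_⟩
    have h1 := vex_le_vex_add (fun q hq ↦ (abs_le.1 (hbd x q hq)).1) (hΛ x x') hp
    have h2 := vex_le_vex_add (fun q hq ↦ (abs_le.1 (hbd x' q hq)).1) (hΛ x' x) hp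
    rw [norm_sub_rev x' x] at h2
    rw [backwardStep_eq, backwardStep_eq, abs_le]
    constructor <;> linarith
  · rw [backwardStep_eq]
    exact convexOn_vex fun q hq ↦ (abs_le.1 (hbd x q hq)).1

lemma Assumptions.exists_terminal_boundedLipschitz (hG : G.Assumptions) :
    ∃ S, 0 ≤ S ∧ BoundedLipschitz G.terminal S := by
  obtain ⟨C, hC0, hC⟩ := exists_common_bound (p := fun i C ↦ ∀ x, |G.g i x| ≤ C)
    (fun i a b hab h x ↦ (h x).trans hab) hG.g_bounded
  obtain ⟨Λ, hΛ0, hΛ⟩ := exists_common_bound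
    (p := fun i C ↦ ∀ x x', |G.g i x - G.g i x'| ≤ C * ‖x - x'‖)
    (fun i a b hab h x x' ↦ (h x x').trans (by gcongr)) hG.g_lipschitz
  refine ⟨I * C, by positivity, fun x p hp ↦ ?_, I * Λ, by positivity, fun x x' p hp ↦ ?_⟩
  · refine (abs_sum_mul_le p (fun i ↦ G.g i x) fun i ↦ hC i x).trans ?_
    have := norm_le_one_of_mem_simplex hp
    calc _ ≤ I * 1 * C := by gcongr
      _ = _ := by ring
  · have h := abs_sum_mul_le p (fun i ↦ G.g i x - G.g i x') fun i ↦ hΛ i x x'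
    have := norm_le_one_of_mem_simplex hp
    have e : G.terminal x p - G.terminal x' p = ∑ i, p i * (G.g i x - G.g i x') := by
      simp [terminal, mul_sub]
    rw [e]
    calc _ ≤ _ := h
      _ ≤ I * 1 * (Λ * ‖x - x'‖) := by gcongr
      _ = _ := by ring

lemma convexOn_terminal (x : EuclideanSpace ℝ (Fin d)) :
    ConvexOn ℝ (simplex I) (G.terminal x) := by
  refine ⟨convex_stdSimplex ℝ _, fun p _ q _ a b _ _ _ ↦ le_of_eq ?_⟩
  simp [terminal, add_mul, Finset.sum_add_distrib, Finset.mul_sum, mul_assoc]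

/-- Bounds on the scheme, uniform in the discretization, and convexity in `p`. -/
theorem Assumptions.exists_scheme_bound [IsProbabilityMeasure P] (hG : G.Assumptions)
    {B : ℝ≥0 → Ω → EuclideanSpace ℝ (Fin d)} (hB : IsBrownian P B) :
    ∃ C, 0 ≤ C ∧ ∀ L k : ℕ, 0 < L → k ≤ L → BoundedLipschitz (G.scheme P B L k) C ∧
      ∀ x, ConvexOn ℝ (simplex I) (G.scheme P B L k x) := by
  obtain ⟨CH, Cσ, hb⟩ := hG.exists_hasBounds
  obtain ⟨c, hc0, hc⟩ := hb.exists_backwardStep_boundedLipschitz (P := P) hB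
  obtain ⟨S, hS0, hS⟩ := hG.exists_terminal_boundedLipschitz
  have hT := hG.T_pos
  -- Each step multiplies `1 +` (the bound) by `1 + c τ`, which gives this closed form; `L` steps
  -- give at most `exp (c T)`.
  have main : ∀ L : ℕ, 0 < L → ∀ j ≤ L, BoundedLipschitz (G.schemeAux P B L j)
      ((1 + c * G.step L) ^ j * (1 + S) - 1) ∧
      ∀ x, ConvexOn ℝ (simplex I) (G.schemeAux P B L j x) := by
    intro L hL j
    induction j with
    | zero => exact fun _ ↦ ⟨hS.mono (by simp), convexOn_terminal⟩
    | succ j ih =>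
      intro hj
      have hτ := step_pos hT hL
      have h1 : (1 : ℝ) ≤ (1 + c * G.step L) ^ j := one_le_pow₀ (by nlinarith)
      obtain ⟨h2, h3⟩ := hc L (L - (j + 1)) (by omega) _ _ (by nlinarith) (ih (by omega)).1
      refine ⟨h2.mono (le_of_eq (by ring)), h3⟩
  refine ⟨Real.exp (c * G.T) * (1 + S), by positivity, fun L k hL hk ↦ ?_⟩
  obtain ⟨h1, h2⟩ := main L hL (L - k) (by omega)
  refine ⟨h1.mono ?_, h2⟩
  have hτ := step_pos hT hL
  have h3 : (1 + c * G.step L) ^ (L - k) ≤ Real.exp (c * G.T) := by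
    calc _ ≤ (1 + c * G.step L) ^ L := pow_le_pow_right₀ (by nlinarith) (by omega)
      _ ≤ Real.exp (c * G.step L) ^ L := by
        gcongr
        linarith [Real.add_one_le_exp (c * G.step L)]
      _ = _ := by
        rw [← Real.exp_nat_mul, ← step_mul L hL]
        ring_nf
  nlinarith

lemma scheme_eq_backwardStep (B : ℝ≥0 → Ω → EuclideanSpace ℝ (Fin d)) {L k : ℕ} (hk : k < L) :
    G.scheme P B L k = G.backwardStep P B L k (G.scheme P B L (k + 1)) := by
  unfold scheme
  obtain ⟨j, rfl⟩ : ∃ j, L = k + 1 + j := ⟨L - (k + 1), by omega⟩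
  have e1 : k + 1 + j - k = j + 1 := by omega
  have e2 : k + 1 + j - (k + 1) = j := by omega
  rw [e1, e2]
  change G.backwardStep P B _ (k + 1 + j - (j + 1)) _ = _
  have e3 : k + 1 + j - (j + 1) = k := by omega
  rw [e3]

lemma scheme_self (B : ℝ≥0 → Ω → EuclideanSpace ℝ (Fin d)) (L : ℕ) :
    G.scheme P B L L = G.terminal := by
  simp only [scheme, Nat.sub_self]
  rfl

end Game

/-! ### First and second order integrals against the noise. -/

section NoiseIntegrals

variable {Ω : Type*} [MeasurableSpace Ω] {d : ℕ} {P : Measure Ω}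
  {N : Ω → EuclideanSpace ℝ (Fin d)} {τ : ℝ} {C : ℕ → ℝ}

lemma IsNoise.integrable_coord_mul (hN : IsNoise P N τ C) (i j : Fin d) :
    Integrable (fun ω ↦ N ω i * N ω j) P := by
  have hm : ∀ i, AEMeasurable (fun ω ↦ N ω i) P := fun i ↦
    (EuclideanSpace.proj (𝕜 := ℝ) i).continuous.measurable.comp_aemeasurable hN.aemeasurable
  refine (hN.integrable_pow 2).mono' ((hm i).mul (hm j)).aestronglyMeasurable
    (ae_of_all _ fun ω ↦ ?_)
  rw [norm_mul, sq]
  exact mul_le_mul (PiLp.norm_apply_le _ i) (PiLp.norm_apply_le _ j) (norm_nonneg _)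
    (norm_nonneg _)

lemma euclidean_eq_sum (x : EuclideanSpace ℝ (Fin d)) :
    x = ∑ i, x i • EuclideanSpace.single i (1 : ℝ) := by
  ext j
  simp [Finset.sum_apply, Pi.single_apply]

lemma IsNoise.integral_bilin (hN : IsNoise P N τ C)
    (R : EuclideanSpace ℝ (Fin d) →L[ℝ] EuclideanSpace ℝ (Fin d) →L[ℝ] ℝ) :
    ∫ ω, R (N ω) (N ω) ∂P =
      τ * ∑ i, R (EuclideanSpace.single i 1) (EuclideanSpace.single i 1) := by
  have e : ∀ ω, R (N ω) (N ω) = ∑ i, ∑ j, (N ω i * N ω j) *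
      R (EuclideanSpace.single i 1) (EuclideanSpace.single j 1) := fun ω ↦ by
    conv_lhs => rw [euclidean_eq_sum (N ω)]
    simp only [map_sum, map_smul, sum_apply, smul_apply,
      smul_eq_mul, Finset.mul_sum]
    rw [Finset.sum_comm]
    refine Finset.sum_congr rfl fun i _ ↦ Finset.sum_congr rfl fun j _ ↦ by ring
  simp only [e]
  rw [integral_finsetSum _ fun i _ ↦ integrable_finsetSum _ fun j _ ↦
    (hN.integrable_coord_mul i j).mul_const _]
  simp only [integral_finsetSum _ fun j _ ↦ (hN.integrable_coord_mul _ j).mul_const _,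
    integral_mul_const, hN.integral_coord_mul]
  simp [Finset.mul_sum]

lemma IsNoise.integral_inner_smul (hN : IsNoise P N τ C) (u : EuclideanSpace ℝ (Fin d)) :
    ∫ ω, inner ℝ u (N ω) • N ω ∂P = τ • u := by
  have hi : Integrable (fun ω ↦ inner ℝ u (N ω) • N ω) P := by
    refine ((hN.integrable_pow 2).const_mul ‖u‖).mono' ?_ (ae_of_all _ fun ω ↦ ?_)
    · exact (((innerSL ℝ u).continuous.measurable.comp_aemeasurable
        hN.aemeasurable).smul hN.aemeasurable).aestronglyMeasurable
    · rw [norm_smul, sq, ← mul_assoc]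
      gcongr
      exact norm_inner_le_norm _ _
  ext i
  have h : ∫ ω, (inner ℝ u (N ω) • N ω) i ∂P = (∫ ω, inner ℝ u (N ω) • N ω ∂P) i :=
    (EuclideanSpace.proj (𝕜 := ℝ) i).integral_comp_comm hi
  rw [← h]
  have e : ∀ ω, (inner ℝ u (N ω) • N ω) i = ∑ j, u j * (N ω j * N ω i) := fun ω ↦ by
    simp only [PiLp.smul_apply, smul_eq_mul, PiLp.inner_apply, Finset.sum_mul]
    refine Finset.sum_congr rfl fun j _ ↦ ?_
    simp
    ring
  simp only [e]
  rw [integral_finsetSum _ fun j _ ↦ (hN.integrable_coord_mul j i).const_mul _]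
  simp only [integral_const_mul, hN.integral_coord_mul]
  simp [mul_comm]

lemma inv_transpose_toEuclideanLin (A : Matrix (Fin d) (Fin d) ℝ) (hA : IsUnit A.transpose)
    (v : EuclideanSpace ℝ (Fin d)) :
    A.transpose⁻¹.toEuclideanLin (A.transpose.toEuclideanLin v) = v := by
  have h : A.transpose⁻¹ * A.transpose = 1 :=
    Matrix.nonsing_inv_mul _ ((Matrix.isUnit_iff_isUnit_det _).1 hA)
  ext i
  simp [Matrix.toEuclideanLin, Matrix.mulVec_mulVec, h]

lemma inner_toEuclideanLin (A : Matrix (Fin d) (Fin d) ℝ) (v y : EuclideanSpace ℝ (Fin d)) :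
    inner ℝ v (A.toEuclideanLin y) = inner ℝ (A.transpose.toEuclideanLin v) y := by
  have := Matrix.toEuclideanLin_conjTranspose_eq_adjoint (𝕜 := ℝ) A
  rw [Matrix.conjTranspose_eq_transpose_of_trivial] at this
  rw [this, LinearMap.adjoint_inner_left]

/-- This is why `zBar` approximates a gradient: `⟪v, σ N⟫ = ⟪σ* v, N⟫`, the covariance `τ · Id`
returns `τ σ* v`, and `(σ*)⁻¹` removes `σ*`. -/
lemma IsNoise.integral_inner_smul_inv (hN : IsNoise P N τ C) (A : Matrix (Fin d) (Fin d) ℝ)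
    (hA : IsUnit A.transpose) (v : EuclideanSpace ℝ (Fin d)) :
    ∫ ω, inner ℝ v (A.toEuclideanLin (N ω)) • A.transpose⁻¹.toEuclideanLin (N ω) ∂P = τ • v := by
  set u := A.transpose.toEuclideanLin v
  set A' := LinearMap.toContinuousLinearMap A.transpose⁻¹.toEuclideanLin
  have e : ∀ ω, inner ℝ v (A.toEuclideanLin (N ω)) • A.transpose⁻¹.toEuclideanLin (N ω) =
      A' (inner ℝ u (N ω) • N ω) := fun ω ↦ by
    rw [map_smul, inner_toEuclideanLin]
    rfl
  simp only [e]
  have hi : Integrable (fun ω ↦ inner ℝ u (N ω) • N ω) P := by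
    refine ((hN.integrable_pow 2).const_mul ‖u‖).mono' ?_ (ae_of_all _ fun ω ↦ ?_)
    · exact (((innerSL ℝ u).continuous.measurable.comp_aemeasurable
        hN.aemeasurable).smul hN.aemeasurable).aestronglyMeasurable
    · rw [norm_smul, sq, ← mul_assoc]
      gcongr
      exact norm_inner_le_norm _ _
  rw [A'.integral_comp_comm hi, hN.integral_inner_smul, map_smul]
  congr 1
  exact inv_transpose_toEuclideanLin A hA v

end NoiseIntegrals

/-! ### Explicit test functions. -/

/-- Parameters of a test function which is quadratic in `p`, with a quartic penalty in `x`. -/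
structure TestFn (d I : ℕ) where
  t₀ : ℝ
  x₀ : EuclideanSpace ℝ (Fin d)
  p₀ : Fin I → ℝ
  c : ℝ
  α : ℝ
  K : ℝ
  κ : ℝ
  ξ : EuclideanSpace ℝ (Fin d)
  Q : EuclideanSpace ℝ (Fin d) →L[ℝ] EuclideanSpace ℝ (Fin d) →L[ℝ] ℝ
  ℓ : (Fin I → ℝ) →L[ℝ] ℝ
  M : EuclideanSpace ℝ (Fin d) →L[ℝ] (Fin I → ℝ) →L[ℝ] ℝ

namespace TestFn

variable {d I : ℕ}

/-- The test function with the given parameters. -/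
def eval (ψ : TestFn d I) (t : ℝ) (x : EuclideanSpace ℝ (Fin d)) (p : Fin I → ℝ) : ℝ :=
  ψ.c + ψ.α * (t - ψ.t₀) - ψ.K * (t - ψ.t₀) ^ 2 + inner ℝ ψ.ξ (x - ψ.x₀) +
    ψ.Q (x - ψ.x₀) (x - ψ.x₀) - ψ.K * ‖x - ψ.x₀‖ ^ 4 + ψ.ℓ (p - ψ.p₀) +
    ψ.M (x - ψ.x₀) (p - ψ.p₀) + ψ.κ * ((p - ψ.p₀) ⬝ᵥ (p - ψ.p₀))

/-- The remainder of `‖y + h‖ ^ 4` after the terms of order at most one in `h`. -/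
def quarticRem (y h : EuclideanSpace ℝ (Fin d)) : ℝ :=
  ‖y + h‖ ^ 4 - ‖y‖ ^ 4 - 4 * ‖y‖ ^ 2 * inner ℝ y h

lemma quarticRem_eq (y h : EuclideanSpace ℝ (Fin d)) :
    quarticRem y h = (2 * inner ℝ y h + ‖h‖ ^ 2) ^ 2 + 2 * ‖y‖ ^ 2 * ‖h‖ ^ 2 := by
  unfold quarticRem
  rw [show ‖y + h‖ ^ 4 = (‖y + h‖ ^ 2) ^ 2 by ring, norm_add_sq_real]
  ring

lemma quarticRem_nonneg (y h : EuclideanSpace ℝ (Fin d)) : 0 ≤ quarticRem y h := by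
  rw [quarticRem_eq]; positivity

/-- The part quadratic in `h` carries the factor `‖y‖ ^ 2`, so near the base point the penalty does
not contribute to the diffusion term. -/
lemma quarticRem_le (y h : EuclideanSpace ℝ (Fin d)) :
    quarticRem y h ≤ 10 * ‖y‖ ^ 2 * ‖h‖ ^ 2 + 2 * ‖h‖ ^ 4 := by
  rw [quarticRem_eq]
  have h1 : (inner ℝ y h : ℝ) ^ 2 ≤ ‖y‖ ^ 2 * ‖h‖ ^ 2 := by
    rw [← mul_pow, ← sq_abs]
    exact pow_le_pow_left₀ (abs_nonneg _) (abs_real_inner_le_norm y h) 2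
  nlinarith [sq_nonneg (2 * inner ℝ y h - ‖h‖ ^ 2)]

/-- The linear part in `h` of `ψ(t, x + h, p) - ⟪ξ, h⟫`. -/
def lin (ψ : TestFn d I) (x : EuclideanSpace ℝ (Fin d)) (p : Fin I → ℝ) :
    EuclideanSpace ℝ (Fin d) →L[ℝ] ℝ :=
  ψ.M.flip (p - ψ.p₀) + ψ.Q (x - ψ.x₀) + ψ.Q.flip (x - ψ.x₀) -
    (4 * ψ.K * ‖x - ψ.x₀‖ ^ 2) • innerSL ℝ (x - ψ.x₀)

/-- The expansion in `h` is exact: a part linear in `h`, and a remainder whose mean gives the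
diffusion. -/
lemma eval_add (ψ : TestFn d I) (t : ℝ) (x h : EuclideanSpace ℝ (Fin d)) (p : Fin I → ℝ) :
    ψ.eval t (x + h) p = ψ.eval t x p + (inner ℝ ψ.ξ h + ψ.lin x p h) +
      (ψ.Q h h - ψ.K * quarticRem (x - ψ.x₀) h) := by
  unfold eval lin quarticRem
  rw [show x + h - ψ.x₀ = x - ψ.x₀ + h from add_sub_right_comm _ _ _]
  simp only [map_add, add_apply, sub_apply,
    smul_apply, ContinuousLinearMap.flip_apply, inner_add_right,
    innerSL_apply_apply, smul_eq_mul]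
  ring

lemma abs_bilin_le {E F : Type*} [NormedAddCommGroup E] [NormedSpace ℝ E] [NormedAddCommGroup F]
    [NormedSpace ℝ F] (R : E →L[ℝ] F →L[ℝ] ℝ) (x : E) (y : F) : |R x y| ≤ ‖R‖ * ‖x‖ * ‖y‖ :=
  R.le_opNorm₂ x y

/-- `ψ.lin` vanishes at the base point, so `ψ.ξ` is the gradient of `ψ` there and a good
approximation nearby. The restriction `‖x - x₀‖ ≤ 1` makes the cubic term at most linear. -/
lemma norm_lin_le (ψ : TestFn d I) (hK : 0 ≤ ψ.K) {x : EuclideanSpace ℝ (Fin d)}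
    (hx : ‖x - ψ.x₀‖ ≤ 1) (p : Fin I → ℝ) :
    ‖ψ.lin x p‖ ≤ ‖ψ.M‖ * ‖p - ψ.p₀‖ + (2 * ‖ψ.Q‖ + 4 * ψ.K) * ‖x - ψ.x₀‖ := by
  have h0 := norm_nonneg (x - ψ.x₀)
  refine ContinuousLinearMap.opNorm_le_bound _ (by positivity) fun h ↦ ?_
  have h1 := abs_bilin_le ψ.M h (p - ψ.p₀)
  have h2 := abs_bilin_le ψ.Q (x - ψ.x₀) h
  have h3 := abs_bilin_le ψ.Q h (x - ψ.x₀)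
  have h4 : |4 * ψ.K * ‖x - ψ.x₀‖ ^ 2 * inner ℝ (x - ψ.x₀) h| ≤
      4 * ψ.K * ‖x - ψ.x₀‖ * ‖h‖ := by
    rw [abs_mul, abs_of_nonneg (by positivity)]
    calc _ ≤ 4 * ψ.K * ‖x - ψ.x₀‖ ^ 2 * (‖x - ψ.x₀‖ * ‖h‖) := by
          gcongr; exact abs_real_inner_le_norm _ _
      _ = 4 * ψ.K * ‖x - ψ.x₀‖ * ‖h‖ * ‖x - ψ.x₀‖ ^ 2 := by ring
      _ ≤ 4 * ψ.K * ‖x - ψ.x₀‖ * ‖h‖ * 1 := by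
          gcongr; nlinarith
      _ = _ := by ring
  have e : ψ.lin x p h = ψ.M h (p - ψ.p₀) + ψ.Q (x - ψ.x₀) h + ψ.Q h (x - ψ.x₀) -
      4 * ψ.K * ‖x - ψ.x₀‖ ^ 2 * inner ℝ (x - ψ.x₀) h := by
    simp only [lin, add_apply, sub_apply, smul_apply, ContinuousLinearMap.flip_apply,
      innerSL_apply_apply, smul_eq_mul]
  rw [e, Real.norm_eq_abs, abs_le]
  rw [abs_le] at h1 h2 h3 h4
  constructor <;> linarith

lemma continuous_eval (ψ : TestFn d I) :
    Continuous fun q : ℝ × EuclideanSpace ℝ (Fin d) × (Fin I → ℝ) ↦ ψ.eval q.1 q.2.1 q.2.2 := by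
  unfold eval dotProduct
  simp only [Pi.sub_apply]
  fun_prop

lemma norm_sub_le_one_of_mem_simplex {p q : Fin I → ℝ} (hp : p ∈ simplex I) (hq : q ∈ simplex I) :
    ‖p - q‖ ≤ 1 := by
  refine (pi_norm_le_iff_of_nonneg zero_le_one).2 fun i ↦ ?_
  have h1 := mem_Icc_of_mem_stdSimplex hp i
  have h2 := mem_Icc_of_mem_stdSimplex hq i
  rw [Pi.sub_apply, Real.norm_eq_abs, abs_le]
  constructor <;> linarith [h1.1, h1.2, h2.1, h2.2]

lemma dotProduct_self_nonneg' (r : Fin I → ℝ) : 0 ≤ r ⬝ᵥ r :=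
  Finset.sum_nonneg fun i _ ↦ mul_self_nonneg (r i)

/-- `Fin I → ℝ` carries the sup norm, while `lambdaMin` and the `κ` term are Euclidean; this bound
and `dotProduct_self_le` pass between the two. -/
lemma norm_sq_le_dotProduct_self (r : Fin I → ℝ) : ‖r‖ ^ 2 ≤ r ⬝ᵥ r := by
  have h : ‖r‖ ≤ √(r ⬝ᵥ r) := by
    refine (pi_norm_le_iff_of_nonneg (Real.sqrt_nonneg _)).2 fun i ↦ ?_
    refine Real.abs_le_sqrt ?_
    rw [sq]
    exact Finset.single_le_sum (f := fun i ↦ r i * r i) (fun i _ ↦ mul_self_nonneg (r i))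
      (Finset.mem_univ i)
  calc ‖r‖ ^ 2 ≤ √(r ⬝ᵥ r) ^ 2 := by gcongr
    _ = _ := Real.sq_sqrt (dotProduct_self_nonneg' r)

lemma dotProduct_self_le (r : Fin I → ℝ) : r ⬝ᵥ r ≤ I * ‖r‖ ^ 2 := by
  have : ∀ i ∈ (Finset.univ : Finset (Fin I)), r i * r i ≤ ‖r‖ ^ 2 := fun i _ ↦ by
    rw [← sq, ← sq_abs]
    exact pow_le_pow_left₀ (abs_nonneg _) (norm_le_pi_norm r i) 2
  refine (Finset.sum_le_sum this).trans ?_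
  simp

/-- Growth of a test function over the domain. -/
lemma exists_growth (ψ : TestFn d I) (hK : 0 ≤ ψ.K) (hp₀ : ψ.p₀ ∈ simplex I) (T : ℝ) :
    ∃ C, 0 ≤ C ∧ ∀ t ∈ Icc 0 T, ∀ x, ∀ p ∈ simplex I,
      |ψ.eval t x p + ψ.K * ‖x - ψ.x₀‖ ^ 4| ≤ C * (1 + ‖x - ψ.x₀‖ ^ 2) := by
  set T' := |T| + |ψ.t₀|
  have hT' : 0 ≤ T' := by positivity
  refine ⟨|ψ.c| + |ψ.α| * T' + ψ.K * T' ^ 2 + ‖ψ.ξ‖ + ‖ψ.Q‖ + ‖ψ.ℓ‖ + ‖ψ.M‖ + |ψ.κ| * I,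
    by positivity, fun t ht x p hp ↦ ?_⟩
  set y := x - ψ.x₀
  set r := p - ψ.p₀
  have hs : |t - ψ.t₀| ≤ T' := by
    refine (abs_sub _ _).trans ?_
    rw [abs_of_nonneg ht.1]
    have := le_abs_self T
    simp only [T']
    linarith [ht.2]
  have hr : ‖r‖ ≤ 1 := norm_sub_le_one_of_mem_simplex hp hp₀
  have hy := norm_nonneg y
  have hy2 : ‖y‖ ≤ 1 + ‖y‖ ^ 2 := by nlinarith [sq_nonneg (‖y‖ - 1)]
  have h0 : 1 ≤ 1 + ‖y‖ ^ 2 := by nlinarith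
  have h1 : |ψ.α * (t - ψ.t₀)| ≤ |ψ.α| * T' := by rw [abs_mul]; gcongr
  have h2 : |ψ.K * (t - ψ.t₀) ^ 2| ≤ ψ.K * T' ^ 2 := by
    rw [abs_mul, abs_of_nonneg hK, abs_pow]; gcongr
  have h3 : |inner ℝ ψ.ξ y| ≤ ‖ψ.ξ‖ * (1 + ‖y‖ ^ 2) :=
    (abs_real_inner_le_norm _ _).trans (by gcongr)
  have h4 : |ψ.Q y y| ≤ ‖ψ.Q‖ * (1 + ‖y‖ ^ 2) := (abs_bilin_le _ _ _).trans (by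
    rw [mul_assoc, ← sq]; gcongr; linarith)
  have h5 : |ψ.ℓ r| ≤ ‖ψ.ℓ‖ := (ψ.ℓ.le_opNorm r).trans
    (mul_le_of_le_one_right (norm_nonneg _) hr)
  have h6 : |ψ.M y r| ≤ ‖ψ.M‖ * (1 + ‖y‖ ^ 2) := (abs_bilin_le _ _ _).trans (by
    refine (mul_le_of_le_one_right (by positivity) hr).trans ?_
    gcongr)
  have h7 : |ψ.κ * (r ⬝ᵥ r)| ≤ |ψ.κ| * I := by
    rw [abs_mul, abs_of_nonneg (dotProduct_self_nonneg' r)]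
    gcongr
    refine (dotProduct_self_le r).trans (mul_le_of_le_one_right (by positivity) ?_)
    nlinarith [norm_nonneg r]
  have e : ψ.eval t x p + ψ.K * ‖y‖ ^ 4 = ψ.c + ψ.α * (t - ψ.t₀) - ψ.K * (t - ψ.t₀) ^ 2 +
      inner ℝ ψ.ξ y + ψ.Q y y + ψ.ℓ r + ψ.M y r + ψ.κ * (r ⬝ᵥ r) := by
    unfold eval; ring
  rw [e]
  have h8 : (|ψ.c| + |ψ.α| * T' + ψ.K * T' ^ 2 + ‖ψ.ℓ‖ + |ψ.κ| * I) * 1 ≤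
      (|ψ.c| + |ψ.α| * T' + ψ.K * T' ^ 2 + ‖ψ.ℓ‖ + |ψ.κ| * I) * (1 + ‖y‖ ^ 2) := by
    gcongr
  have h9 := abs_le.1 (le_refl |ψ.c|)
  rw [abs_le] at h1 h2 h3 h4 h5 h6 h7 ⊢
  constructor <;> linarith

end TestFn

namespace TestFn

variable {d I : ℕ}

/-- `∑ₖ Q(S eₖ, S eₖ)`. -/
def diffusion (ψ : TestFn d I) (S : Matrix (Fin d) (Fin d) ℝ) : ℝ :=
  ∑ k, ψ.Q (S.toEuclideanLin (EuclideanSpace.single k 1))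
    (S.toEuclideanLin (EuclideanSpace.single k 1))

lemma exists_abs_eval_add_le (ψ : TestFn d I) (hK : 0 ≤ ψ.K) (hp₀ : ψ.p₀ ∈ simplex I) (T : ℝ) :
    ∃ C, 0 ≤ C ∧ ∀ t ∈ Icc 0 T, ∀ x, ‖x - ψ.x₀‖ ≤ 1 → ∀ h, ∀ p ∈ simplex I,
      |ψ.eval t (x + h) p| ≤ C * (1 + ‖h‖ ^ 4) := by
  obtain ⟨C, hC0, hC⟩ := ψ.exists_growth hK hp₀ T
  -- With `u = ‖x + h - x₀‖`, the constants come from `u ^ 4 ≤ 8 (1 + ‖h‖ ^ 4)` and `1 + u ^ 2 ≤ 2 +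
  -- u ^ 4`.
  refine ⟨10 * C + 8 * ψ.K, by positivity, fun t ht x hx h p hp ↦ ?_⟩
  have h1 := hC t ht (x + h) p hp
  set u := ‖x + h - ψ.x₀‖
  have hu0 : 0 ≤ u := norm_nonneg _
  have hu : u ≤ 1 + ‖h‖ := by
    calc u = ‖(x - ψ.x₀) + h‖ := by simp only [u]; congr 1; abel
      _ ≤ _ := norm_add_le _ _
      _ ≤ _ := by gcongr
  have hh := norm_nonneg h
  have hu4 : u ^ 4 ≤ 8 * (1 + ‖h‖ ^ 4) := by
    calc u ^ 4 ≤ (1 + ‖h‖) ^ 4 := by gcongr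
      _ = ((1 + ‖h‖) ^ 2) ^ 2 := by ring
      _ ≤ (2 * (1 + ‖h‖ ^ 2)) ^ 2 := by
        gcongr
        nlinarith [sq_nonneg (1 - ‖h‖)]
      _ ≤ _ := by nlinarith [sq_nonneg (1 - ‖h‖ ^ 2)]
  have hu2 : 1 + u ^ 2 ≤ 2 + u ^ 4 := by nlinarith [sq_nonneg (u ^ 2 - 1)]
  have h2 : C * (1 + u ^ 2) ≤ C * (10 * (1 + ‖h‖ ^ 4)) := by
    gcongr
    have : 0 ≤ ‖h‖ ^ 4 := by positivity
    linarith
  have h3 : ψ.K * u ^ 4 ≤ ψ.K * (8 * (1 + ‖h‖ ^ 4)) := by gcongr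
  have h4 : 0 ≤ ψ.K * u ^ 4 := by positivity
  have h5 : 0 ≤ C * (10 * (1 + ‖h‖ ^ 4)) := by positivity
  rw [abs_le] at h1 ⊢
  constructor <;> linarith

lemma continuous_quarticRem (y : EuclideanSpace ℝ (Fin d)) : Continuous (quarticRem y) := by
  unfold quarticRem
  fun_prop

end TestFn

section

variable {Ω : Type*} [MeasurableSpace Ω] {d : ℕ} {P : Measure Ω}
  {N : Ω → EuclideanSpace ℝ (Fin d)} {τ : ℝ} {C : ℕ → ℝ}

lemma IsNoise.integral_pow_le_abs (hN : IsNoise P N τ C) (k : ℕ) :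
    ∫ ω, ‖N ω‖ ^ k ∂P ≤ |C k| * √τ ^ k :=
  (hN.integral_pow_le k).trans (by gcongr; exact le_abs_self _)

lemma QuarticGrowth.comp_of_continuous (hN : IsNoise P N τ C)
    {f : EuclideanSpace ℝ (Fin d) → ℝ} (hf : Continuous f) {K : ℝ}
    (h : ∀ y, |f y| ≤ K * (1 + ‖y‖ ^ 4)) : QuarticGrowth P N (fun ω ↦ f (N ω)) :=
  ⟨(hf.measurable.comp_aemeasurable hN.aemeasurable).aestronglyMeasurable, K, fun ω ↦ h (N ω)⟩

end

/-! ### Consistency of the step on test functions. -/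

namespace Game

variable {d I m n : ℕ} {G : Game d I m n} {Ω : Type*} [MeasurableSpace Ω] {P : Measure Ω}
  {CH Cσ : ℝ}

/-- The noise is centred, so a constant does not change the gradient term. -/
lemma stepValue_add_const [IsProbabilityMeasure P] {t τ : ℝ} {N : Ω → EuclideanSpace ℝ (Fin d)}
    {C : ℕ → ℝ} (hN : IsNoise P N τ C) (x : EuclideanSpace ℝ (Fin d)) (p : Fin I → ℝ)
    {W : Ω → ℝ} (hW : QuarticGrowth P N W) (c : ℝ) :
    G.stepValue P t τ N x p (fun ω ↦ W ω + c) = G.stepValue P t τ N x p W + c := by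
  have hc : QuarticGrowth P N (fun _ ↦ c) :=
    .of_bounded aestronglyMeasurable_const (S := |c|) fun _ ↦ le_rfl
  have h0 := hN.integral_clm (LinearMap.toContinuousLinearMap (G.σ t x).transpose⁻¹.toEuclideanLin)
  simp only [LinearMap.coe_toContinuousLinearMap'] at h0
  unfold stepValue
  simp only [add_smul]
  rw [integral_add (hN.integrable hW) (integrable_const c),
    integral_add (hN.integrable_smul hW _) (hN.integrable_smul hc _), integral_smul, h0]
  simp
  ring

-- Consistency. The linear part `⟪v, σ N⟫` has mean zero and contributes exactly `v` to the gradient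
-- term. The remainder `R` contributes `τ ψ.diffusion` to the mean and `O(√τ)` to the gradient term.
-- The Hamiltonian is frozen at `(ψ.ξ, ψ.p₀)`, and the price is the distance to the base point in
-- the error.
set_option maxHeartbeats 1000000 in
lemma HasBounds.exists_stepValue_eval_ge [IsProbabilityMeasure P] (hb : G.HasBounds CH Cσ)
    (hσ : ∀ t ∈ Icc 0 G.T, ∀ x, IsUnit (G.σ t x).transpose) (ψ : TestFn d I) (hK : 0 ≤ ψ.K)
    (Cm : ℕ → ℝ) :
    ∃ C, 0 ≤ C ∧ ∀ t ∈ Icc 0 G.T, ∀ t' τ, 0 < τ → τ ≤ G.T →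
      ∀ N : Ω → EuclideanSpace ℝ (Fin d), IsNoise P N τ Cm → ∀ x, ‖x - ψ.x₀‖ ≤ 1 →
      ∀ p : Fin I → ℝ,
      ψ.eval t' x p + τ * (ψ.diffusion (G.σ t x) + G.hamiltonian t x ψ.ξ ψ.p₀) -
          C * τ * (‖x - ψ.x₀‖ + √τ + ‖p - ψ.p₀‖) ≤
        G.stepValue P t τ N x p
          (fun ω ↦ ψ.eval t' (x + (G.σ t x).toEuclideanLin (N ω)) p) := by
  have hCH := hb.CH_nonneg
  have hC := hb.Cσ_nonneg
  have hT := hb.T_pos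
  set a := ‖ψ.Q‖ * Cσ ^ 2 + ψ.K * (10 * Cσ ^ 2)
  set b := ψ.K * (2 * Cσ ^ 4)
  have ha : 0 ≤ a := by positivity
  have hbb : 0 ≤ b := by positivity
  -- `D₁` and `D₂` bound the quadratic and quartic parts of the penalty remainder in the mean, `D₃`
  -- bounds the remainder in the gradient term, and `D₄` the variation of the gradient of `ψ` in
  -- `x`.
  set D₁ := ψ.K * (10 * Cσ ^ 2 * |Cm 2|)
  set D₂ := ψ.K * (2 * Cσ ^ 4 * |Cm 4| * √G.T)
  set D₃ := Cσ * (a * |Cm 3| + b * (|Cm 5| * G.T))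
  set D₄ := 2 * ‖ψ.Q‖ + 4 * ψ.K
  have hD₁ : 0 ≤ D₁ := by positivity
  have hD₂ : 0 ≤ D₂ := by positivity
  have hD₃ : 0 ≤ D₃ := by positivity
  have hD₄ : 0 ≤ D₄ := by positivity
  refine ⟨D₁ + D₂ + CH * (D₃ + D₄ + ‖ψ.M‖ + 1), by positivity,
    fun t ht t' τ hτ hτT N hN x hx p ↦ ?_⟩
  set y := x - ψ.x₀
  set S := (G.σ t x).toEuclideanLin
  set S' : EuclideanSpace ℝ (Fin d) →L[ℝ] EuclideanSpace ℝ (Fin d) :=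
    LinearMap.toContinuousLinearMap S
  set A := (G.σ t x).transpose⁻¹.toEuclideanLin
  set R : EuclideanSpace ℝ (Fin d) → ℝ := fun h ↦
    ψ.Q (S' h) (S' h) - ψ.K * TestFn.quarticRem y (S' h) with hR
  have hy := norm_nonneg y
  have hs := Real.sqrt_nonneg τ
  have hsq : √τ ^ 2 = τ := Real.sq_sqrt hτ.le
  have hsT : √τ ≤ √G.T := Real.sqrt_le_sqrt hτT
  have hS : ∀ h, ‖S' h‖ ≤ Cσ * ‖h‖ := hb.sigma_le t ht x
  have hrem : ∀ h, TestFn.quarticRem y (S' h) ≤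
      10 * ‖y‖ ^ 2 * (Cσ ^ 2 * ‖h‖ ^ 2) + 2 * (Cσ ^ 4 * ‖h‖ ^ 4) := fun h ↦ by
    refine (TestFn.quarticRem_le _ _).trans ?_
    rw [← mul_pow, ← mul_pow]
    have := hS h
    gcongr
  have hRabs : ∀ h, |R h| ≤ a * ‖h‖ ^ 2 + b * ‖h‖ ^ 4 := fun h ↦ by
    have h1 : |ψ.Q (S' h) (S' h)| ≤ ‖ψ.Q‖ * (Cσ ^ 2 * ‖h‖ ^ 2) := by
      refine (TestFn.abs_bilin_le _ _ _).trans ?_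
      rw [mul_assoc, ← sq, ← mul_pow]
      have := hS h
      gcongr
    have h2 := hrem h
    have h3 : 10 * ‖y‖ ^ 2 * (Cσ ^ 2 * ‖h‖ ^ 2) ≤ 10 * 1 * (Cσ ^ 2 * ‖h‖ ^ 2) := by
      gcongr
      nlinarith
    have h4 : ψ.K * TestFn.quarticRem y (S' h) ≤
        ψ.K * (10 * (Cσ ^ 2 * ‖h‖ ^ 2) + 2 * (Cσ ^ 4 * ‖h‖ ^ 4)) := by gcongr; linarith
    have h5 := mul_nonneg hK (TestFn.quarticRem_nonneg y (S' h))
    have h6 : 0 ≤ ψ.K * (10 * (Cσ ^ 2 * ‖h‖ ^ 2) + 2 * (Cσ ^ 4 * ‖h‖ ^ 4)) := by positivity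
    simp only [hR, a, b]
    rw [abs_le] at h1 ⊢
    constructor <;> linarith
  have hRc : Continuous R := by
    have := (TestFn.continuous_quarticRem y).comp S'.continuous
    simp only [hR]
    refine Continuous.sub (by fun_prop) (continuous_const.mul this)
  have hRq : QuarticGrowth P N (fun ω ↦ R (N ω)) := by
    refine .comp_of_continuous hN hRc (K := a + b) fun h ↦ (hRabs h).trans ?_
    have h1 : ‖h‖ ^ 2 ≤ 1 + ‖h‖ ^ 4 := by nlinarith [sq_nonneg (‖h‖ ^ 2 - 1)]
    have h2 : ‖h‖ ^ 4 ≤ 1 + ‖h‖ ^ 4 := by linarith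
    calc _ ≤ a * (1 + ‖h‖ ^ 4) + b * (1 + ‖h‖ ^ 4) := by gcongr
      _ = _ := by ring
  -- Riesz representative of `ψ.lin`, so that the linear part has the form required by
  -- `IsNoise.integral_inner_smul_inv`.
  set v₁ := (InnerProductSpace.toDual ℝ (EuclideanSpace ℝ (Fin d))).symm (ψ.lin x p) with hv₁
  set v := ψ.ξ + v₁
  have hv : ∀ h, inner ℝ ψ.ξ h + ψ.lin x p h = inner ℝ v h := fun h ↦ by
    rw [inner_add_left, hv₁, InnerProductSpace.toDual_symm_apply]
  have hW : ∀ ω, ψ.eval t' (x + S (N ω)) p =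
      inner ℝ v (S' (N ω)) + R (N ω) + ψ.eval t' x p := fun ω ↦ by
    have e : S (N ω) = S' (N ω) := rfl
    rw [e, ψ.eval_add, ← hv]
    simp only [hR, y]
    ring
  have hlinq : QuarticGrowth P N (fun ω ↦ inner ℝ v (S' (N ω))) := by
    refine .comp_of_continuous (f := fun h ↦ inner ℝ v (S' h)) hN (by fun_prop)
      (K := ‖v‖ * Cσ) fun h ↦ ?_
    have h2 : ‖h‖ ≤ 1 + ‖h‖ ^ 4 := by
      nlinarith [sq_nonneg (‖h‖ ^ 2 - 1 / 2), sq_nonneg (‖h‖ - 1 / 2)]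
    calc |inner ℝ v (S' h)| ≤ ‖v‖ * ‖S' h‖ := abs_real_inner_le_norm _ _
      _ ≤ ‖v‖ * (Cσ * (1 + ‖h‖ ^ 4)) := by
        gcongr
        exact (hS h).trans (by gcongr)
      _ = _ := by ring
  have hsum : QuarticGrowth P N (fun ω ↦ inner ℝ v (S' (N ω)) + R (N ω)) := by
    obtain ⟨h1, K₁, h2⟩ := hlinq
    obtain ⟨h3, K₂, h4⟩ := hRq
    refine ⟨h1.add h3, K₁ + K₂, fun ω ↦ (abs_add_le _ _).trans ?_⟩
    linarith [h2 ω, h4 ω]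
  simp only [hW]
  rw [stepValue_add_const hN x p hsum]
  unfold stepValue
  simp only [add_smul]
  rw [integral_add (hN.integrable hlinq) (hN.integrable hRq),
    integral_add (hN.integrable_smul hlinq _) (hN.integrable_smul hRq _)]
  have hz1 : ∫ ω, inner ℝ v (S' (N ω)) ∂P = 0 := hN.integral_clm ((innerSL ℝ v).comp S')
  have hz2 : ∫ ω, inner ℝ v (S' (N ω)) • A (N ω) ∂P = τ • v :=
    hN.integral_inner_smul_inv _ (hσ t ht x) v
  rw [hz1, hz2, zero_add, smul_add, smul_smul, inv_mul_cancel₀ hτ.ne', one_smul]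
  have hER : τ * ψ.diffusion (G.σ t x) - τ * (D₁ * ‖y‖ + D₂ * √τ) ≤ ∫ ω, R (N ω) ∂P := by
    have hQ := hN.integral_bilin (ψ.Q.bilinearComp S' S')
    simp only [ContinuousLinearMap.bilinearComp_apply] at hQ
    have hQi : Integrable (fun ω ↦ ψ.Q (S' (N ω)) (S' (N ω))) P := by
      refine hN.integrable (.comp_of_continuous (f := fun h ↦ ψ.Q (S' h) (S' h)) hN (by fun_prop)
        (K := ‖ψ.Q‖ * Cσ ^ 2) fun h ↦ ?_)
      refine (TestFn.abs_bilin_le _ _ _).trans ?_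
      have h1 : ‖h‖ ^ 2 ≤ 1 + ‖h‖ ^ 4 := by nlinarith [sq_nonneg (‖h‖ ^ 2 - 1)]
      calc ‖ψ.Q‖ * ‖S' h‖ * ‖S' h‖ ≤ ‖ψ.Q‖ * (Cσ * ‖h‖) * (Cσ * ‖h‖) := by
            have := hS h; gcongr
        _ = ‖ψ.Q‖ * Cσ ^ 2 * ‖h‖ ^ 2 := by ring
        _ ≤ _ := by gcongr
    have i2 := hN.integrable_pow 2
    have i4 := hN.integrable_pow 4
    have i24 : Integrable (fun ω ↦ ψ.K * (10 * ‖y‖ ^ 2 * Cσ ^ 2) * ‖N ω‖ ^ 2 +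
        ψ.K * (2 * Cσ ^ 4) * ‖N ω‖ ^ 4) P := (i2.const_mul _).add (i4.const_mul _)
    have hle : ∫ ω, (ψ.Q (S' (N ω)) (S' (N ω)) - (ψ.K * (10 * ‖y‖ ^ 2 * Cσ ^ 2) * ‖N ω‖ ^ 2 +
        ψ.K * (2 * Cσ ^ 4) * ‖N ω‖ ^ 4)) ∂P ≤ ∫ ω, R (N ω) ∂P := by
      refine integral_mono (hQi.sub i24)
        (hN.integrable hRq) fun ω ↦ ?_
      have := mul_le_mul_of_nonneg_left (hrem (N ω)) hK
      simp only [hR]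
      linarith
    rw [integral_sub hQi i24,
      integral_add (i2.const_mul _) (i4.const_mul _), integral_const_mul, integral_const_mul,
      hQ] at hle
    refine le_trans ?_ hle
    have h2 : ψ.K * (10 * ‖y‖ ^ 2 * Cσ ^ 2) * ∫ ω, ‖N ω‖ ^ 2 ∂P ≤ τ * (D₁ * ‖y‖) := by
      calc _ ≤ ψ.K * (10 * ‖y‖ ^ 2 * Cσ ^ 2) * (|Cm 2| * √τ ^ 2) := by
            gcongr; exact hN.integral_pow_le_abs 2
        _ = τ * (D₁ * (‖y‖ * ‖y‖)) := by rw [hsq]; simp only [D₁]; ring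
        _ ≤ τ * (D₁ * (‖y‖ * 1)) := by gcongr
        _ = _ := by ring
    have h4 : ψ.K * (2 * Cσ ^ 4) * ∫ ω, ‖N ω‖ ^ 4 ∂P ≤ τ * (D₂ * √τ) := by
      calc _ ≤ ψ.K * (2 * Cσ ^ 4) * (|Cm 4| * √τ ^ 4) := by
            gcongr; exact hN.integral_pow_le_abs 4
        _ = √τ ^ 2 * (ψ.K * (2 * Cσ ^ 4 * |Cm 4| * √τ) * √τ) := by ring
        _ ≤ √τ ^ 2 * (ψ.K * (2 * Cσ ^ 4 * |Cm 4| * √G.T) * √τ) := by gcongr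
        _ = _ := by rw [hsq]
    have e : ∑ i, ψ.Q (S' (EuclideanSpace.single i 1)) (S' (EuclideanSpace.single i 1)) =
      ψ.diffusion (G.σ t x) := rfl
    rw [e]
    linarith
  set E := ∫ ω, R (N ω) • A (N ω) ∂P
  have hE : ‖τ⁻¹ • E‖ ≤ D₃ * √τ := by
    rw [norm_smul, Real.norm_eq_abs, abs_of_pos (inv_pos.2 hτ), inv_mul_le_iff₀ hτ]
    have i3 := (hN.integrable_pow 3).const_mul (Cσ * a)
    have i5 := (hN.integrable_pow 5).const_mul (Cσ * b)
    have h1 : ‖E‖ ≤ ∫ ω, (Cσ * a * ‖N ω‖ ^ 3 + Cσ * b * ‖N ω‖ ^ 5) ∂P := by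
      refine norm_integral_le_of_norm_le (i3.add i5) (ae_of_all _ fun ω ↦ ?_)
      rw [norm_smul]
      calc ‖R (N ω)‖ * ‖A (N ω)‖ ≤ (a * ‖N ω‖ ^ 2 + b * ‖N ω‖ ^ 4) * (Cσ * ‖N ω‖) :=
            mul_le_mul (hRabs _) (hb.inv_le t ht x _) (norm_nonneg _) (by positivity)
        _ = _ := by ring
    rw [integral_add i3 i5, integral_const_mul, integral_const_mul] at h1
    refine h1.trans ?_
    have h3 : Cσ * a * ∫ ω, ‖N ω‖ ^ 3 ∂P ≤ τ * (Cσ * (a * |Cm 3|) * √τ) := by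
      calc _ ≤ Cσ * a * (|Cm 3| * √τ ^ 3) := by gcongr; exact hN.integral_pow_le_abs 3
        _ = √τ ^ 2 * (Cσ * (a * |Cm 3|) * √τ) := by ring
        _ = _ := by rw [hsq]
    have h5 : Cσ * b * ∫ ω, ‖N ω‖ ^ 5 ∂P ≤ τ * (Cσ * (b * (|Cm 5| * G.T)) * √τ) := by
      calc _ ≤ Cσ * b * (|Cm 5| * √τ ^ 5) := by gcongr; exact hN.integral_pow_le_abs 5
        _ = √τ ^ 2 * (Cσ * (b * (|Cm 5| * √τ ^ 2)) * √τ) := by ring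
        _ ≤ _ := by rw [hsq]; gcongr
    calc _ ≤ _ := add_le_add h3 h5
      _ = _ := by simp only [D₃]; ring
  have hvn : ‖v + τ⁻¹ • E - ψ.ξ‖ ≤ ‖ψ.M‖ * ‖p - ψ.p₀‖ + D₄ * ‖y‖ + D₃ * √τ := by
    have e : v + τ⁻¹ • E - ψ.ξ = v₁ + τ⁻¹ • E := by simp only [v]; abel
    rw [e]
    refine (norm_add_le _ _).trans (add_le_add ?_ hE)
    rw [hv₁, LinearIsometryEquiv.norm_map]
    exact ψ.norm_lin_le hK hx p
  clear_value D₁ D₂ D₃ D₄ E v y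
  have hH := (abs_le.1 (hb.ham_sub_le t ht t ht x x (v + τ⁻¹ • E) ψ.ξ p ψ.p₀)).1
  simp only [sub_self, abs_zero, norm_zero, add_zero, zero_mul, zero_add] at hH
  have hH2 : CH * (‖v + τ⁻¹ • E - ψ.ξ‖ + ‖p - ψ.p₀‖) ≤
      CH * ((‖ψ.M‖ * ‖p - ψ.p₀‖ + D₄ * ‖y‖ + D₃ * √τ) + ‖p - ψ.p₀‖) := by gcongr
  have hp := norm_nonneg (p - ψ.p₀)
  have hH3 : CH * ((‖ψ.M‖ * ‖p - ψ.p₀‖ + D₄ * ‖y‖ + D₃ * √τ) + ‖p - ψ.p₀‖) ≤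
      CH * (D₃ + D₄ + ‖ψ.M‖ + 1) * (‖y‖ + √τ + ‖p - ψ.p₀‖) := by
    rw [mul_assoc CH]
    refine mul_le_mul_of_nonneg_left ?_ hCH
    have := mul_nonneg hD₃ hy
    have := mul_nonneg hD₃ hp
    have := mul_nonneg hD₄ hs
    have := mul_nonneg hD₄ hp
    have := mul_nonneg (norm_nonneg ψ.M) hy
    have := mul_nonneg (norm_nonneg ψ.M) hs
    nlinarith
  have hD : D₁ * ‖y‖ + D₂ * √τ ≤ (D₁ + D₂) * (‖y‖ + √τ + ‖p - ψ.p₀‖) := by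
    have := mul_nonneg hD₁ hs
    have := mul_nonneg hD₁ hp
    have := mul_nonneg hD₂ hy
    have := mul_nonneg hD₂ hp
    nlinarith
  have hτD := mul_le_mul_of_nonneg_left hD hτ.le
  have hτH : τ * (G.hamiltonian t x ψ.ξ ψ.p₀ -
      CH * (D₃ + D₄ + ‖ψ.M‖ + 1) * (‖y‖ + √τ + ‖p - ψ.p₀‖)) ≤
      τ * G.hamiltonian t x (v + τ⁻¹ • E) p := by
    gcongr
    linarith
  linarith

end Game

/-! ### The scheme at a near-minimum of its difference with a test function. -/

namespace TestFn

variable {d I : ℕ}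

lemma continuous_eval_space (ψ : TestFn d I) (t : ℝ) (p : Fin I → ℝ) :
    Continuous fun x ↦ ψ.eval t x p := by
  unfold eval
  fun_prop

lemma eval_sub_time (ψ : TestFn d I) (t t' : ℝ) (x : EuclideanSpace ℝ (Fin d)) (p : Fin I → ℝ) :
    ψ.eval t' x p = ψ.eval t x p + (t' - t) * (ψ.α - ψ.K * (t' + t - 2 * ψ.t₀)) := by
  unfold eval; ring

/-- In `p` the test function is affine plus `κ |·|²`; the affine part becomes the minorant handed to
`vex`, and the square is the reserve for errors. -/
lemma eval_add_right (ψ : TestFn d I) (t : ℝ) (x : EuclideanSpace ℝ (Fin d)) (p z : Fin I → ℝ) :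
    ψ.eval t x (p + z) = ψ.eval t x p + (ψ.ℓ z + ψ.M (x - ψ.x₀) z +
      2 * ψ.κ * ((p - ψ.p₀) ⬝ᵥ z)) + ψ.κ * (z ⬝ᵥ z) := by
  unfold eval
  rw [show p + z - ψ.p₀ = p - ψ.p₀ + z from add_sub_right_comm _ _ _]
  simp only [map_add, add_dotProduct, dotProduct_add]
  rw [dotProduct_comm z (p - ψ.p₀)]
  ring

end TestFn

namespace Game

variable {d I m n : ℕ} {G : Game d I m n} {Ω : Type*} [MeasurableSpace Ω] {P : Measure Ω}
  {CH Cσ : ℝ}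

/-- The step value of a function lying above a shifted test function. -/
lemma HasBounds.exists_stepValue_ge_of_eval_le [IsProbabilityMeasure P] (hb : G.HasBounds CH Cσ)
    (hσ : ∀ t ∈ Icc 0 G.T, ∀ x, IsUnit (G.σ t x).transpose) (ψ : TestFn d I) (hK : 0 ≤ ψ.K)
    (hp₀ : ψ.p₀ ∈ simplex I) (Cm : ℕ → ℝ) {C₀ E₀ : ℝ} (hC₀ : 0 ≤ C₀) (hE₀ : 0 ≤ E₀) :
    ∃ C, 0 ≤ C ∧ ∀ t ∈ Icc 0 G.T, ∀ t' ∈ Icc 0 G.T, ∀ τ, 0 < τ → τ ≤ G.T →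
      ∀ N : Ω → EuclideanSpace ℝ (Fin d), IsNoise P N τ Cm → ∀ x, ‖x - ψ.x₀‖ ≤ 1 →
      ∀ p ∈ simplex I, ∀ V : EuclideanSpace ℝ (Fin d) → (Fin I → ℝ) → ℝ,
      BoundedLipschitz V C₀ → ∀ e, |e| ≤ E₀ →
      (∀ x' : EuclideanSpace ℝ (Fin d), ∀ q ∈ simplex I, ψ.eval t' x' q + e ≤ V x' q) →
      e + ψ.eval t' x p + τ * (ψ.diffusion (G.σ t x) + G.hamiltonian t x ψ.ξ ψ.p₀) -
          C * τ * (‖x - ψ.x₀‖ + √τ + ‖p - ψ.p₀‖) ≤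
        G.stepValue P t τ N x p (fun ω ↦ V (x + (G.σ t x).toEuclideanLin (N ω)) p) := by
  have hCH := hb.CH_nonneg
  have hC := hb.Cσ_nonneg
  have hT := hb.T_pos
  obtain ⟨C₁, hC₁, h₁⟩ := hb.exists_stepValue_eval_ge (P := P) hσ ψ hK Cm
  obtain ⟨C₂, hC₂, h₂⟩ := ψ.exists_abs_eval_add_le hK hp₀ G.T
  set D := C₀ + C₂ * (1 + Cσ ^ 4) + E₀
  have hD : 0 ≤ D := by positivity
  -- Bounds the monotonicity error: the gap `V - ψ - e` is at most `D (1 + ‖N‖ ^ 4)`, so its product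
  -- with `‖N‖ ^ 4` involves moments of orders four and eight, hence `O(τ²)`, and `τ² ≤ √T τ √τ`.
  set F := (CH * Cσ) ^ 4 * (D * (|Cm 4| + |Cm 8| * G.T ^ 2)) * √G.T
  have hF : 0 ≤ F := by positivity
  refine ⟨C₁ + F, by positivity, fun t ht t' ht' τ hτ hτT N hN x hx p hp V hV e he hle ↦ ?_⟩
  set S := (G.σ t x).toEuclideanLin
  have hSc : Continuous S := S.continuous_of_finiteDimensional
  have hbd : ∀ y, |ψ.eval t' (x + S y) p| ≤ C₂ * (1 + Cσ ^ 4) * (1 + ‖y‖ ^ 4) := fun y ↦ by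
    refine (h₂ t' ht' x hx (S y) p hp).trans ?_
    rw [mul_assoc]
    refine mul_le_mul_of_nonneg_left ?_ hC₂
    have h3 : ‖S y‖ ^ 4 ≤ (Cσ * ‖y‖) ^ 4 := by
      have := hb.sigma_le t ht x y
      gcongr
    rw [mul_pow] at h3
    have : 0 ≤ ‖y‖ ^ 4 := by positivity
    have : 0 ≤ Cσ ^ 4 := by positivity
    nlinarith
  have hψq : QuarticGrowth P N (fun ω ↦ ψ.eval t' (x + S (N ω)) p) := by
    refine .comp_of_continuous (f := fun y ↦ ψ.eval t' (x + S y) p) hN ?_ hbd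
    exact (ψ.continuous_eval_space t' p).comp (continuous_const.add hSc)
  have hψeq : QuarticGrowth P N (fun ω ↦ ψ.eval t' (x + S (N ω)) p + e) := by
    refine ⟨hψq.1.add_const e, C₂ * (1 + Cσ ^ 4) + |e|, fun ω ↦ (abs_add_le _ _).trans ?_⟩
    have := hbd (N ω)
    nlinarith [mul_nonneg (abs_nonneg e) (pow_nonneg (norm_nonneg (N ω)) 4)]
  have hVq := hV.quarticGrowth hp hN x S
  have hmono := hb.stepValue_le ht hτ hN x p hψeq hVq fun ω ↦ hle _ p hp
  rw [stepValue_add_const hN x p hψq] at hmono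
  have hmain := h₁ t ht t' τ hτ hτT N hN x hx p
  have i4 := hN.integrable_pow 4
  have i8 := hN.integrable_pow 8
  have hint : ∫ ω, (V (x + S (N ω)) p - (ψ.eval t' (x + S (N ω)) p + e)) * ‖N ω‖ ^ 4 ∂P ≤
      D * (|Cm 4| + |Cm 8| * G.T ^ 2) * τ ^ 2 := by
    have hle : ∫ ω, (V (x + S (N ω)) p - (ψ.eval t' (x + S (N ω)) p + e)) * ‖N ω‖ ^ 4 ∂P ≤
        ∫ ω, D * (‖N ω‖ ^ 4 + ‖N ω‖ ^ 8) ∂P := by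
      refine integral_mono (hN.integrable_mul_pow (hVq.sub hψeq) 4) ((i4.add i8).const_mul D)
        fun ω ↦ ?_
      have a1 := (abs_le.1 (hV.1 (x + S (N ω)) p hp)).2
      have a2 := (abs_le.1 (hbd (N ω))).1
      have a3 := (abs_le.1 he).1
      have a4 : 0 ≤ ‖N ω‖ ^ 4 := by positivity
      have a5 : V (x + S (N ω)) p - (ψ.eval t' (x + S (N ω)) p + e) ≤ D * (1 + ‖N ω‖ ^ 4) := by
        have := mul_nonneg hC₀ a4
        have := mul_nonneg hE₀ a4
        simp only [D]
        linarith
      calc _ ≤ D * (1 + ‖N ω‖ ^ 4) * ‖N ω‖ ^ 4 := mul_le_mul_of_nonneg_right a5 a4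
        _ = _ := by ring
    have hadd : ∫ ω, (‖N ω‖ ^ 4 + ‖N ω‖ ^ 8) ∂P = (∫ ω, ‖N ω‖ ^ 4 ∂P) + ∫ ω, ‖N ω‖ ^ 8 ∂P :=
      integral_add i4 i8
    rw [integral_const_mul, hadd] at hle
    refine hle.trans ?_
    rw [mul_assoc]
    refine mul_le_mul_of_nonneg_left ?_ hD
    have e4 : √τ ^ 4 = τ ^ 2 := by
      rw [show 4 = 2 * 2 from rfl, pow_mul, Real.sq_sqrt hτ.le]
    have e8 : √τ ^ 8 = τ ^ 2 * τ ^ 2 := by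
      rw [show 8 = 2 * 4 from rfl, pow_mul, Real.sq_sqrt hτ.le]; ring
    have b4 := hN.integral_pow_le_abs 4
    have b8 := hN.integral_pow_le_abs 8
    rw [e4] at b4
    rw [e8] at b8
    have b9 : |Cm 8| * (τ ^ 2 * τ ^ 2) ≤ |Cm 8| * (G.T ^ 2 * τ ^ 2) := by gcongr
    linarith
  have hc4 : 0 ≤ (CH * Cσ) ^ 4 := by positivity
  have hint2 := mul_le_mul_of_nonneg_left hint hc4
  have hτs : τ ^ 2 ≤ √G.T * τ * √τ := by
    have h1 : √τ ≤ √G.T := Real.sqrt_le_sqrt hτT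
    calc τ ^ 2 = √τ * τ * √τ := by nlinarith [Real.mul_self_sqrt hτ.le]
      _ ≤ _ := by gcongr
  have hfin : (CH * Cσ) ^ 4 * (D * (|Cm 4| + |Cm 8| * G.T ^ 2) * τ ^ 2) ≤
      F * τ * (‖x - ψ.x₀‖ + √τ + ‖p - ψ.p₀‖) := by
    calc _ ≤ (CH * Cσ) ^ 4 * (D * (|Cm 4| + |Cm 8| * G.T ^ 2) * (√G.T * τ * √τ)) := by gcongr
      _ = F * τ * √τ := by simp only [F]; ring
      _ ≤ _ := by
        gcongr
        linarith [norm_nonneg (x - ψ.x₀), norm_nonneg (p - ψ.p₀)]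
  linarith

/-- The inequality satisfied by the scheme at an approximate minimum point of its difference with
a test function. -/
theorem Assumptions.exists_nearMin_estimate [IsProbabilityMeasure P] (hG : G.Assumptions)
    {B : ℝ≥0 → Ω → EuclideanSpace ℝ (Fin d)} (hB : IsBrownian P B) (ψ : TestFn d I)
    (hK : 0 ≤ ψ.K) (hκ : 0 < ψ.κ) (hp₀ : ψ.p₀ ∈ simplex I) :
    ∃ C, 0 ≤ C ∧ ∀ L k : ℕ, k < L → ∀ x, ‖x - ψ.x₀‖ ≤ 1 → ∀ p ∈ simplex I,
      (∀ x', ∀ q ∈ simplex I, G.scheme P B L k x p - ψ.eval (G.gridTime L k) x p ≤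
        G.scheme P B L (k + 1) x' q - ψ.eval (G.gridTime L (k + 1)) x' q + G.step L ^ 2) →
      ψ.α + ψ.diffusion (G.σ (G.gridTime L k) x) + G.hamiltonian (G.gridTime L k) x ψ.ξ ψ.p₀ ≤
        C * (|G.gridTime L k - ψ.t₀| + ‖x - ψ.x₀‖ + √(G.step L) + ‖p - ψ.p₀‖) := by
  obtain ⟨CH, Cσ, hb⟩ := hG.exists_hasBounds
  have hT := hG.T_pos
  obtain ⟨C₀, hC₀, hsch⟩ := hG.exists_scheme_bound (P := P) hB
  obtain ⟨C₂, hC₂, h₂⟩ := ψ.exists_abs_eval_add_le hK hp₀ G.T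
  obtain ⟨C, hC, h⟩ := hb.exists_stepValue_ge_of_eval_le (P := P) hG.σ_nonsingular ψ hK hp₀
    (momentConst d) hC₀ (E₀ := C₀ + C₂ + G.T ^ 2) (by positivity)
  -- Collects the terms of order `τ²`: the absorption of `C τ ‖q - p‖` by the `κ` term, the
  -- quadratic time dependence, and the tolerance of the near-minimum.
  set D := C ^ 2 / (4 * ψ.κ) + ψ.K + 1
  have hD : 0 ≤ D := by positivity
  refine ⟨C + 2 * ψ.K + D * √G.T, by positivity, fun L k hk x hx p hp hmin ↦ ?_⟩
  have hL : 0 < L := by omega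
  have hτ := step_pos hT hL
  have hτT := step_le hT hL
  have ht := gridTime_mem hT hL hk.le
  have ht' := gridTime_mem hT hL (k := k + 1) hk
  have hN := isNoise_increment hB G hT L k
  have hsucc := G.gridTime_succ L k
  set τ := G.step L
  set t := G.gridTime L k
  set t' := G.gridTime L (k + 1)
  set v := G.scheme P B L k x p with hv
  -- The largest shift for which near-minimality guarantees `ψ + e ≤ V^τ` at the next grid time.
  set e := v - ψ.eval t x p - τ ^ 2 with he
  have heE : |e| ≤ C₀ + C₂ + G.T ^ 2 := by
    have h1 := (hsch L k hL hk.le).1.1 x p hp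
    have h2 := h₂ t ht x hx 0 p hp
    have h3 : τ ^ 2 ≤ G.T ^ 2 := by gcongr
    have h4 : 0 ≤ τ ^ 2 := by positivity
    simp only [add_zero, norm_zero, ne_eq, OfNat.ofNat_ne_zero, not_false_eq_true, zero_pow,
      mul_one] at h2
    rw [abs_le] at h1 h2 ⊢
    constructor <;> linarith
  have hstep := fun q hq ↦ h t ht t' ht' τ hτ hτT (G.increment B L k) hN x hx q hq
    (G.scheme P B L (k + 1)) (hsch L (k + 1) hL hk).1 e heE fun x' q' hq' ↦ by
      linarith [hmin x' q' hq']
  set Z := ψ.diffusion (G.σ t x) + G.hamiltonian t x ψ.ξ ψ.p₀ with hZ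
  set ρ := ‖x - ψ.x₀‖ + √τ + ‖p - ψ.p₀‖ with hρ
  have hτt : t' - t = τ := by rw [hsucc]; ring
  -- `a + Λ (q - p)` is the affine minorant: `a` gathers the value at `q = p` and all errors, and
  -- `Λ` is the derivative of `ψ(t, x, ·)` at `p`.
  set a := e + ψ.eval t x p + τ * (ψ.α - ψ.K * (t' + t - 2 * ψ.t₀)) + τ * Z - C * τ * ρ -
    C ^ 2 * τ ^ 2 / (4 * ψ.κ) with ha
  set Λ : (Fin I → ℝ) →ₗ[ℝ] ℝ := (ψ.ℓ : (Fin I → ℝ) →ₗ[ℝ] ℝ) + (ψ.M (x - ψ.x₀) : (Fin I → ℝ) →ₗ[ℝ] ℝ) +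
    (2 * ψ.κ) • dotProductBilin ℝ ℝ (p - ψ.p₀) with hΛ
  have hΛz : ∀ z, Λ z = ψ.ℓ z + ψ.M (x - ψ.x₀) z + 2 * ψ.κ * ((p - ψ.p₀) ⬝ᵥ z) := fun z ↦ by
    simp [hΛ]
  have hvex : a + Λ (p - p) ≤ v := by
    rw [hv, scheme_eq_backwardStep B hk, backwardStep_eq]
    refine le_vex (h := fun q ↦ a + Λ (q - p)) hp ?_ fun q hq ↦ ?_
    · refine ⟨convex_stdSimplex ℝ _, fun q _ q' _ r r' _ _ hr ↦ le_of_eq ?_⟩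
      obtain rfl : r' = 1 - r := by linarith
      simp only [map_sub, map_add, map_smul, smul_eq_mul]
      ring
    · refine le_trans ?_ (hstep q hq)
      have h1 := ψ.eval_add_right t x p (q - p)
      rw [add_sub_cancel] at h1
      rw [ψ.eval_sub_time t t' x q, h1, hτt, hΛz]
      have h2 : ‖q - ψ.p₀‖ ≤ ‖q - p‖ + ‖p - ψ.p₀‖ := norm_sub_le_norm_sub_add_norm_sub _ _ _
      have h3 : C * τ * (‖x - ψ.x₀‖ + √τ + ‖q - ψ.p₀‖) ≤ C * τ * (ρ + ‖q - p‖) := by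
        refine mul_le_mul_of_nonneg_left ?_ (by positivity)
        simp only [hρ]
        linarith
      have h4 := mul_le_mul_of_nonneg_left (TestFn.norm_sq_le_dotProduct_self (q - p)) hκ.le
      -- The place where `κ > 0` is decisive: the consistency error grows linearly in `‖q - p‖`, and
      -- only the convexity of `ψ` in `p` keeps an affine function below.
      have h5 : C * τ * ‖q - p‖ ≤ ψ.κ * ‖q - p‖ ^ 2 + C ^ 2 * τ ^ 2 / (4 * ψ.κ) := by
        have h6 : 0 ≤ (2 * ψ.κ * ‖q - p‖ - C * τ) ^ 2 / (4 * ψ.κ) := by positivity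
        have h7 : (2 * ψ.κ * ‖q - p‖ - C * τ) ^ 2 / (4 * ψ.κ) =
            ψ.κ * ‖q - p‖ ^ 2 + C ^ 2 * τ ^ 2 / (4 * ψ.κ) - C * τ * ‖q - p‖ := by
          field_simp
          ring
        linarith
      linarith
  rw [sub_self, map_zero, add_zero] at hvex
  -- Since `e` contains `v` itself, the unknown value cancels from `a ≤ v`, leaving a relation of
  -- order `τ`.
  have hineq : τ * (ψ.α + Z) ≤ τ * (C * ρ + ψ.K * (2 * |t - ψ.t₀|) + D * τ) := by
    have h1 : t' + t - 2 * ψ.t₀ ≤ 2 * |t - ψ.t₀| + τ := by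
      have := le_abs_self (t - ψ.t₀)
      linarith
    have h2 := mul_le_mul_of_nonneg_left (mul_le_mul_of_nonneg_left h1 hK) hτ.le
    have h3 : D * τ ^ 2 = C ^ 2 * τ ^ 2 / (4 * ψ.κ) + ψ.K * τ ^ 2 + τ ^ 2 := by
      simp only [D]; ring
    simp only [ha, he] at hvex
    linarith
  have hfin := le_of_mul_le_mul_left hineq hτ
  have hss : τ ≤ √G.T * √τ := by
    calc τ = √τ * √τ := (Real.mul_self_sqrt hτ.le).symm
      _ ≤ _ := by gcongr
  have h1 := mul_le_mul_of_nonneg_left hss hD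
  have hDT : 0 ≤ D * √G.T := by positivity
  have p1 := abs_nonneg (t - ψ.t₀)
  have p2 := norm_nonneg (x - ψ.x₀)
  have p3 := Real.sqrt_nonneg τ
  have p4 := norm_nonneg (p - ψ.p₀)
  calc _ = ψ.α + Z := by simp only [hZ]; ring
    _ ≤ C * ρ + ψ.K * (2 * |t - ψ.t₀|) + D * √G.T * √τ := by linarith
    _ ≤ C * (|t - ψ.t₀| + ρ) + 2 * ψ.K * (|t - ψ.t₀| + ρ) + D * √G.T * (|t - ψ.t₀| + ρ) := by
      have q1 : C * ρ ≤ C * (|t - ψ.t₀| + ρ) := by gcongr; linarith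
      have q2 : 2 * ψ.K * |t - ψ.t₀| ≤ 2 * ψ.K * (|t - ψ.t₀| + ρ) := by
        gcongr; simp only [hρ]; linarith
      have q3 : D * √G.T * √τ ≤ D * √G.T * (|t - ψ.t₀| + ρ) := by
        gcongr; simp only [hρ]; linarith
      linarith
    _ = _ := by simp only [hρ]; ring

end Game

/-! ### Passage to the limit along near-minimizers. -/

namespace TestFn

variable {d I : ℕ}

lemma continuous_diffusion (ψ : TestFn d I) : Continuous ψ.diffusion := by
  have h : ∀ y : EuclideanSpace ℝ (Fin d),
      Continuous fun S : Matrix (Fin d) (Fin d) ℝ ↦ S.toEuclideanLin y := fun y ↦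
    ((LinearMap.applyₗ y).comp
      (Matrix.toEuclideanLin (𝕜 := ℝ) (m := Fin d) (n := Fin d)).toLinearMap
      ).continuous_of_finiteDimensional
  unfold diffusion
  refine continuous_finsetSum _ fun k _ ↦ ?_
  have := h (EuclideanSpace.single k 1)
  fun_prop

lemma eval_base (ψ : TestFn d I) : ψ.eval ψ.t₀ ψ.x₀ ψ.p₀ = ψ.c := by
  simp [eval]

end TestFn

namespace Game

variable {d I m n : ℕ} {G : Game d I m n} {Ω : Type*} [MeasurableSpace Ω] {P : Measure Ω}

/-- `w` is the limit of the scheme along the numbers of steps `L j`. -/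
def IsLimitAlong (G : Game d I m n) (P : Measure Ω) (B : ℝ≥0 → Ω → EuclideanSpace ℝ (Fin d))
    (w : ℝ → EuclideanSpace ℝ (Fin d) → (Fin I → ℝ) → ℝ) (L : ℕ → ℕ) : Prop :=
  ∀ t ∈ Icc 0 G.T, ∀ x, ∀ p ∈ simplex I, ∀ ε > 0, ∃ δ > 0, ∃ N, ∀ j ≥ N, ∀ k ≤ L j,
    ∀ x', ∀ p' ∈ simplex I,
      |G.gridTime (L j) k - t| < δ → ‖x' - x‖ < δ → ‖p' - p‖ < δ →
        |G.scheme P B (L j) k x' p' - w t x p| < ε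

lemma tendsto_step {L : ℕ → ℕ} (hL : Tendsto L atTop atTop) :
    Tendsto (fun j ↦ G.step (L j)) atTop (𝓝 0) :=
  (tendsto_const_div_atTop_nhds_zero_nat G.T).comp hL

lemma exists_gridTime_near (hT : 0 < G.T) {L : ℕ} (hL : 0 < L) {t : ℝ} (ht : t ∈ Icc 0 G.T) :
    ∃ k ≤ L, |G.gridTime L k - t| ≤ G.step L := by
  have hτ := step_pos hT hL
  refine ⟨⌊t / G.step L⌋₊, ?_, ?_⟩
  · refine Nat.floor_le_of_le ?_
    rw [div_le_iff₀ hτ, step_mul L hL]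
    exact ht.2
  · have h1 := Nat.floor_le (div_nonneg ht.1 hτ.le)
    have h2 := Nat.lt_floor_add_one (t / G.step L)
    rw [le_div_iff₀ hτ] at h1
    rw [div_lt_iff₀ hτ] at h2
    unfold gridTime
    rw [abs_le]
    constructor <;> linarith

/-- The differential inequality at a strict global minimum of `w - ψ`. -/
theorem Assumptions.testFn_le_zero [IsProbabilityMeasure P] (hG : G.Assumptions)
    {B : ℝ≥0 → Ω → EuclideanSpace ℝ (Fin d)} (hB : IsBrownian P B)
    {w : ℝ → EuclideanSpace ℝ (Fin d) → (Fin I → ℝ) → ℝ} {L : ℕ → ℕ}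
    (hL : Tendsto L atTop atTop) (hw : G.IsLimitAlong P B w L) (ψ : TestFn d I)
    (hK : 0 < ψ.K) (hκ : 0 < ψ.κ) (ht₀ : ψ.t₀ ∈ Ico 0 G.T) (hp₀ : ψ.p₀ ∈ simplex I)
    (hbase : w ψ.t₀ ψ.x₀ ψ.p₀ = ψ.c)
    (hstrict : ∀ t ∈ Icc 0 G.T, ∀ x, ∀ p ∈ simplex I, w t x p ≤ ψ.eval t x p →
      t = ψ.t₀ ∧ x = ψ.x₀ ∧ p = ψ.p₀) :
    ψ.α + ψ.diffusion (G.σ ψ.t₀ ψ.x₀) + G.hamiltonian ψ.t₀ ψ.x₀ ψ.ξ ψ.p₀ ≤ 0 := by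
  have hT := hG.T_pos
  have ht₀' : ψ.t₀ ∈ Icc 0 G.T := Ico_subset_Icc_self ht₀
  obtain ⟨C₀, hC₀, hsch⟩ := hG.exists_scheme_bound (P := P) hB
  obtain ⟨C₁, hC₁, hgr⟩ := ψ.exists_growth hK.le hp₀ G.T
  obtain ⟨C, hC, hest⟩ := hG.exists_nearMin_estimate (P := P) hB ψ hK.le hκ hp₀
  obtain ⟨CH, Cσ, hb⟩ := hG.exists_hasBounds
  have hupper : ∀ t ∈ Icc 0 G.T, ∀ x, ∀ p ∈ simplex I,
      ψ.eval t x p ≤ C₁ * (1 + ‖x - ψ.x₀‖ ^ 2) - ψ.K * ‖x - ψ.x₀‖ ^ 4 := fun t ht x p hp ↦ by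
    linarith [(abs_le.1 (hgr t ht x p hp)).2]
  -- Completing the square in `‖x - x₀‖ ^ 2`: the quartic penalty dominates the quadratic growth.
  have hψbdd : ∀ t ∈ Icc 0 G.T, ∀ x, ∀ p ∈ simplex I,
      ψ.eval t x p ≤ C₁ + C₁ ^ 2 / (4 * ψ.K) := fun t ht x p hp ↦ by
    refine (hupper t ht x p hp).trans ?_
    have h1 : 0 ≤ (2 * ψ.K * ‖x - ψ.x₀‖ ^ 2 - C₁) ^ 2 / (4 * ψ.K) := by positivity
    have h2 : (2 * ψ.K * ‖x - ψ.x₀‖ ^ 2 - C₁) ^ 2 / (4 * ψ.K) =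
        ψ.K * ‖x - ψ.x₀‖ ^ 4 - C₁ * ‖x - ψ.x₀‖ ^ 2 + C₁ ^ 2 / (4 * ψ.K) := by
      field_simp
      ring
    linarith
  set F : ℕ → ℕ → EuclideanSpace ℝ (Fin d) → (Fin I → ℝ) → ℝ := fun j k x p ↦
    G.scheme P B (L j) k x p - ψ.eval (G.gridTime (L j) k) x p with hF
  -- Near-minimizers avoid any question of attainment, and the tolerance `τ²` is negligible after
  -- division by `τ`. When `L j = 0` there is no grid and the choice is a dummy.
  have hex : ∀ j, ∃ u : ℕ × EuclideanSpace ℝ (Fin d) × (Fin I → ℝ), 0 < L j →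
      u.1 ≤ L j ∧ u.2.2 ∈ simplex I ∧ ∀ k ≤ L j, ∀ x, ∀ p ∈ simplex I,
        F j u.1 u.2.1 u.2.2 ≤ F j k x p + G.step (L j) ^ 2 := by
    intro j
    by_cases hj : 0 < L j
    swap
    · exact ⟨(0, 0, 0), fun h ↦ absurd h hj⟩
    set A : Set ℝ := {y | ∃ k ≤ L j, ∃ x, ∃ p ∈ simplex I, y = F j k x p}
    have hA : A.Nonempty := ⟨_, 0, Nat.zero_le _, ψ.x₀, ψ.p₀, hp₀, rfl⟩
    have hA' : BddBelow A := by
      refine ⟨-C₀ - (C₁ + C₁ ^ 2 / (4 * ψ.K)), ?_⟩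
      rintro _ ⟨k, hk, x, p, hp, rfl⟩
      have h1 := (abs_le.1 ((hsch (L j) k hj hk).1.1 x p hp)).1
      have h2 := hψbdd _ (gridTime_mem hT hj hk) x p hp
      simp only [hF]
      linarith
    have hτ := step_pos hT hj
    obtain ⟨_, ⟨k, hk, x, p, hp, rfl⟩, hlt⟩ :=
      exists_lt_of_csInf_lt hA (lt_add_of_pos_right (sInf A) (pow_pos hτ 2))
    refine ⟨(k, x, p), fun _ ↦ ⟨hk, hp, fun k' hk' x' p' hp' ↦ hlt.le.trans ?_⟩⟩
    gcongr
    exact csInf_le hA' ⟨k', hk', x', p', hp', rfl⟩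
  choose u hu using hex
  have hLpos : ∀ᶠ j in atTop, 0 < L j := hL.eventually_gt_atTop 0
  have hstep := tendsto_step (G := G) hL
  set z : ℕ → ℝ × EuclideanSpace ℝ (Fin d) × (Fin I → ℝ) := fun j ↦
    (G.gridTime (L j) (u j).1, (u j).2.1, (u j).2.2) with hz
  -- Grid points approaching the base point compete in the minimum, and there the difference tends
  -- to `w - ψ = 0`.
  have hsmall : ∀ ε > 0, ∀ᶠ j in atTop, F j (u j).1 (u j).2.1 (u j).2.2 ≤ ε := by
    intro ε hε
    obtain ⟨δ, hδ, N, hN⟩ := hw ψ.t₀ ht₀' ψ.x₀ ψ.p₀ hp₀ (ε / 3) (by positivity)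
    have hcont : ContinuousAt (fun t ↦ ψ.eval t ψ.x₀ ψ.p₀) ψ.t₀ := by
      have : Continuous (fun t ↦ ψ.eval t ψ.x₀ ψ.p₀) := by
        unfold TestFn.eval; fun_prop
      exact this.continuousAt
    obtain ⟨δ', hδ', hc⟩ := Metric.continuousAt_iff.1 hcont (ε / 3) (by positivity)
    have hsq : ∀ᶠ j in atTop, G.step (L j) ^ 2 < ε / 3 := by
      have : Tendsto (fun j ↦ G.step (L j) ^ 2) atTop (𝓝 (0 ^ 2)) := hstep.pow 2
      rw [zero_pow two_ne_zero] at this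
      exact this.eventually_lt_const (by positivity)
    filter_upwards [hLpos, hstep.eventually_lt_const (lt_min hδ hδ'), hsq,
      eventually_ge_atTop N] with j hj hj1 hj2 hj3
    obtain ⟨k, hk, hkt⟩ := exists_gridTime_near hT hj ht₀'
    have h1 := hN j hj3 k hk ψ.x₀ ψ.p₀ hp₀ (hkt.trans_lt (hj1.trans_le (min_le_left _ _)))
      (by simpa using hδ) (by simpa using hδ)
    have h2 := hc (x := G.gridTime (L j) k)
      (by rw [Real.dist_eq]; exact hkt.trans_lt (hj1.trans_le (min_le_right _ _)))
    rw [Real.dist_eq, ψ.eval_base] at h2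
    have h3 := (hu j hj).2.2 k hk ψ.x₀ ψ.p₀ hp₀
    rw [hbase] at h1
    simp only [hF] at h3 ⊢
    rw [abs_lt] at h1 h2
    linarith
  -- Outside this radius the penalty pushes `V^τ - ψ` above `1`, so near-minimizers eventually stay
  -- in a compact set.
  set R := 1 + (2 * C₁ + C₀ + 1) / ψ.K with hR
  have hR1 : 1 ≤ R := by
    have : 0 ≤ (2 * C₁ + C₀ + 1) / ψ.K := by positivity
    linarith
  have hKR : ψ.K * R = ψ.K + (2 * C₁ + C₀ + 1) := by
    rw [hR]; field_simp
  have hcomp : IsCompact (Icc 0 G.T ×ˢ Metric.closedBall ψ.x₀ R ×ˢ simplex I) :=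
    isCompact_Icc.prod ((isCompact_closedBall _ _).prod (isCompact_stdSimplex ℝ _))
  have hzmem : ∀ᶠ j in atTop, z j ∈ Icc 0 G.T ×ˢ Metric.closedBall ψ.x₀ R ×ˢ simplex I := by
    filter_upwards [hLpos, hsmall 1 one_pos] with j hj hj1
    obtain ⟨h1, h2, -⟩ := hu j hj
    have ht := gridTime_mem hT hj h1
    refine ⟨ht, ?_, h2⟩
    rw [Metric.mem_closedBall, dist_eq_norm]
    by_contra! hlt
    change R < ‖(u j).2.1 - ψ.x₀‖ at hlt
    have h3 := hupper _ ht (u j).2.1 _ h2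
    have h4 := (abs_le.1 ((hsch (L j) _ hj h1).1.1 (u j).2.1 _ h2)).1
    simp only [hF] at hj1
    set s := ‖(u j).2.1 - ψ.x₀‖
    have h5 : ψ.K * s ^ 4 ≤ C₁ * (1 + s ^ 2) + C₀ + 1 := by linarith
    have hs1 : 1 < s := hR1.trans_lt hlt
    have h6 : 1 ≤ s ^ 2 := one_le_pow₀ hs1.le
    have h7 : (ψ.K + (2 * C₁ + C₀ + 1)) * s ^ 2 ≤ ψ.K * s ^ 4 := by
      rw [← hKR]
      calc ψ.K * R * s ^ 2 ≤ ψ.K * s ^ 2 * s ^ 2 := by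
            gcongr
            nlinarith
        _ = _ := by ring
    nlinarith
  -- Every cluster point satisfies `w ≤ ψ`, hence is the base point by strictness; compactness
  -- upgrades this to convergence.
  have hlim : Tendsto z atTop (𝓝 (ψ.t₀, ψ.x₀, ψ.p₀)) := by
    refine hcomp.tendsto_nhds_of_unique_mapClusterPt hzmem ?_
    rintro ⟨t, x, p⟩ ⟨ht, -, hp⟩ hcl
    have hle : w t x p ≤ ψ.eval t x p := by
      refine le_of_forall_pos_le_add fun ε hε ↦ ?_
      obtain ⟨δ, hδ, N, hN⟩ := hw t ht x p hp (ε / 3) (by positivity)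
      have hcont := ψ.continuous_eval.continuousAt (x := (t, x, p))
      have hnb : ∀ᶠ q : ℝ × EuclideanSpace ℝ (Fin d) × (Fin I → ℝ) in 𝓝 (t, x, p),
          dist q (t, x, p) < δ ∧ ψ.eval q.1 q.2.1 q.2.2 < ψ.eval t x p + ε / 3 :=
        Filter.Eventually.and (Metric.ball_mem_nhds (t, x, p) hδ)
          (hcont.eventually_lt_const (lt_add_of_pos_right _ (by positivity)))
      have hfr := hcl.frequently hnb
      obtain ⟨j, ⟨hj1, hj2⟩, hj3, hj4, hj5⟩ := (hfr.and_eventually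
        (hLpos.and ((hsmall (ε / 3) (by positivity)).and (eventually_ge_atTop N)))).exists
      obtain ⟨h1, h2, -⟩ := hu j hj3
      rw [Prod.dist_eq, Prod.dist_eq, max_lt_iff, max_lt_iff, Real.dist_eq, dist_eq_norm,
        dist_eq_norm] at hj1
      have h3 := hN j hj5 _ h1 _ _ h2 hj1.1 hj1.2.1 hj1.2.2
      simp only [hF] at hj4
      simp only [hz] at hj2
      rw [abs_lt] at h3
      linarith
    obtain ⟨rfl, rfl, rfl⟩ := hstrict t ht x p hp hle
    rfl
  have hlt : Tendsto (fun j ↦ G.gridTime (L j) (u j).1) atTop (𝓝 ψ.t₀) :=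
    (continuous_fst.tendsto _).comp hlim
  have hlx : Tendsto (fun j ↦ (u j).2.1) atTop (𝓝 ψ.x₀) :=
    ((continuous_fst.comp continuous_snd).tendsto _).comp hlim
  have hlp : Tendsto (fun j ↦ (u j).2.2) atTop (𝓝 ψ.p₀) :=
    ((continuous_snd.comp continuous_snd).tendsto _).comp hlim
  have hlt0 : Tendsto (fun j ↦ |G.gridTime (L j) (u j).1 - ψ.t₀|) atTop (𝓝 0) := by
    have := (hlt.sub_const ψ.t₀).abs
    simpa using this
  have hlx0 : Tendsto (fun j ↦ ‖(u j).2.1 - ψ.x₀‖) atTop (𝓝 0) := by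
    have := (hlx.sub_const ψ.x₀).norm
    simpa using this
  have hlp0 : Tendsto (fun j ↦ ‖(u j).2.2 - ψ.p₀‖) atTop (𝓝 0) := by
    have := (hlp.sub_const ψ.p₀).norm
    simpa using this
  have hsum0 : Tendsto (fun j ↦ |G.gridTime (L j) (u j).1 - ψ.t₀| + ‖(u j).2.1 - ψ.x₀‖)
      atTop (𝓝 0) := by simpa using hlt0.add hlx0
  have hrhs : Tendsto (fun j ↦ C * (|G.gridTime (L j) (u j).1 - ψ.t₀| + ‖(u j).2.1 - ψ.x₀‖ +
      √(G.step (L j)) + ‖(u j).2.2 - ψ.p₀‖)) atTop (𝓝 0) := by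
    have hs : Tendsto (fun j ↦ √(G.step (L j))) atTop (𝓝 0) := by
      have := hstep.sqrt
      simpa using this
    have := ((hsum0.add hs).add hlp0).const_mul C
    simpa using this
  have hgt : ∀ᶠ j in atTop, G.gridTime (L j) (u j).1 ∈ Icc 0 G.T := by
    filter_upwards [hLpos] with j hj using gridTime_mem hT hj (hu j hj).1
  have hσ : Tendsto (fun j ↦ G.σ (G.gridTime (L j) (u j).1) (u j).2.1) atTop
      (𝓝 (G.σ ψ.t₀ ψ.x₀)) := by
    obtain ⟨D, hD⟩ := hG.σ_lipschitz
    refine tendsto_pi_nhds.2 fun a ↦ tendsto_pi_nhds.2 fun b ↦ ?_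
    rw [tendsto_iff_dist_tendsto_zero]
    have h0 : Tendsto (fun j ↦ D * (|G.gridTime (L j) (u j).1 - ψ.t₀| + ‖(u j).2.1 - ψ.x₀‖))
      atTop (𝓝 0) := by simpa using hsum0.const_mul D
    refine squeeze_zero' (Eventually.of_forall fun _ ↦ dist_nonneg) ?_ h0
    filter_upwards [hgt] with j hj
    exact hD _ hj _ ht₀' _ _ a b
  have hdiff := (ψ.continuous_diffusion.tendsto _).comp hσ
  have hham : Tendsto (fun j ↦ G.hamiltonian (G.gridTime (L j) (u j).1) (u j).2.1 ψ.ξ ψ.p₀)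
      atTop (𝓝 (G.hamiltonian ψ.t₀ ψ.x₀ ψ.ξ ψ.p₀)) := by
    rw [tendsto_iff_dist_tendsto_zero]
    have h0 : Tendsto (fun j ↦ CH * ((|G.gridTime (L j) (u j).1 - ψ.t₀| + ‖(u j).2.1 - ψ.x₀‖) *
        (‖ψ.ξ‖ + ‖ψ.p₀‖) + ‖ψ.ξ - ψ.ξ‖ + ‖ψ.p₀ - ψ.p₀‖)) atTop (𝓝 0) := by
      simpa using (hsum0.mul_const (‖ψ.ξ‖ + ‖ψ.p₀‖)).const_mul CH
    refine squeeze_zero' (Eventually.of_forall fun _ ↦ dist_nonneg) ?_ h0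
    filter_upwards [hgt] with j hj
    exact hb.ham_sub_le _ hj _ ht₀' _ _ _ _ _ _
  refine le_of_tendsto_of_tendsto ((hdiff.const_add ψ.α).add hham) hrhs ?_
  filter_upwards [hLpos, hlt.eventually_lt_const ht₀.2, hlx0.eventually_le_const one_pos]
    with j hj hj1 hj2
  obtain ⟨h1, h2, h3⟩ := hu j hj
  -- At `k = L j` there is no scheme equation; `t₀ < T` excludes that case for large `j`.
  have hk : (u j).1 < L j := by
    refine lt_of_le_of_ne h1 fun heq ↦ ?_
    rw [heq, gridTime, step_mul _ hj] at hj1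
    exact lt_irrefl _ hj1
  exact hest (L j) _ hk _ hj2 _ h2 fun x' q hq ↦ h3 _ hk x' q hq

end Game

/-! ### From a local minimum to a strict global one. -/

lemma max_max_sq_le (a b c : ℝ) :
    max a (max b c) ^ 2 ≤ a ^ 2 + b ^ 2 + c ^ 2 := by
  have := sq_nonneg a
  have := sq_nonneg b
  have := sq_nonneg c
  rcases max_choice a (max b c) with h | h
  · rw [h]; linarith
  · rw [h]
    rcases max_choice b c with h | h <;> rw [h] <;> linarith

/-- Differentiability of `fderiv ℝ f` at the single point `z` controls the derivative of the
remainder along the segment from `z` to `z + h`; the mean value inequality concludes. -/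
lemma exists_taylor_two {F : Type*} [NormedAddCommGroup F] [NormedSpace ℝ F] {f : F → ℝ}
    (hf : ContDiff ℝ 2 f) (z : F) {ε : ℝ} (hε : 0 < ε) :
    ∃ δ > 0, ∀ h, ‖h‖ < δ →
      |f (z + h) - f z - fderiv ℝ f z h - (1 / 2) * fderiv ℝ (fderiv ℝ f) z h h| ≤
        ε * ‖h‖ ^ 2 := by
  have hd : Differentiable ℝ f := hf.differentiable (by norm_num)
  have hd2 : DifferentiableAt ℝ (fderiv ℝ f) z :=
    ((hf.fderiv_right (m := 1) (by norm_num)).differentiable (by norm_num)) z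
  have h1 := (hasFDerivAt_iff_isLittleO_nhds_zero.1 hd2.hasFDerivAt).def hε
  obtain ⟨δ, hδ, hball⟩ := Metric.eventually_nhds_iff_ball.1 h1
  refine ⟨δ, hδ, fun h hh ↦ ?_⟩
  set g : ℝ → ℝ := fun s ↦ f (z + s • h) - s * fderiv ℝ f z h -
    (1 / 2) * s ^ 2 * fderiv ℝ (fderiv ℝ f) z h h
  have hg : ∀ s, HasDerivAt g (fderiv ℝ f (z + s • h) h - fderiv ℝ f z h -
      s * fderiv ℝ (fderiv ℝ f) z h h) s := fun s ↦ by
    have e1 : HasDerivAt (fun s : ℝ ↦ z + s • h) h s := by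
      simpa using ((hasDerivAt_id s).smul_const h).const_add z
    have e2 := (hd (z + s • h)).hasFDerivAt.comp_hasDerivAt s e1
    have e3 : HasDerivAt (fun s : ℝ ↦ s * fderiv ℝ f z h) (fderiv ℝ f z h) s := by
      simpa using (hasDerivAt_id s).mul_const (fderiv ℝ f z h)
    have e4 : HasDerivAt (fun s : ℝ ↦ (1 / 2) * s ^ 2 * fderiv ℝ (fderiv ℝ f) z h h)
        (s * fderiv ℝ (fderiv ℝ f) z h h) s := by
      have := ((hasDerivAt_pow 2 s).const_mul (1 / 2 : ℝ)).mul_const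
        (fderiv ℝ (fderiv ℝ f) z h h)
      refine this.congr_deriv ?_
      rw [show (2 : ℕ) - 1 = 1 from rfl]
      push_cast
      ring
    exact (e2.sub e3).sub e4
  have hbound : ∀ s ∈ Ico (0 : ℝ) 1, ‖fderiv ℝ f (z + s • h) h - fderiv ℝ f z h -
      s * fderiv ℝ (fderiv ℝ f) z h h‖ ≤ ε * ‖h‖ ^ 2 := fun s hs ↦ by
    have hsh : ‖s • h‖ ≤ ‖h‖ := by
      rw [norm_smul, Real.norm_eq_abs, abs_of_nonneg hs.1]
      exact mul_le_of_le_one_left (norm_nonneg _) hs.2.le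
    have h2 := hball (s • h) (by rw [mem_ball_zero_iff]; exact hsh.trans_lt hh)
    have h3 := (fderiv ℝ f (z + s • h) - fderiv ℝ f z -
      fderiv ℝ (fderiv ℝ f) z (s • h)).le_opNorm h
    simp only [sub_apply, map_smul, smul_apply, smul_eq_mul] at h3
    calc _ ≤ _ := h3
      _ ≤ (ε * ‖s • h‖) * ‖h‖ := by
        gcongr
        simpa using h2
      _ ≤ (ε * ‖h‖) * ‖h‖ := by gcongr
      _ = _ := by ring
  have := norm_image_sub_le_of_norm_deriv_le_segment_01'
    (fun s _ ↦ (hg s).hasDerivWithinAt) hbound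
  rw [Real.norm_eq_abs] at this
  refine le_trans (le_of_eq ?_) this
  congr 1
  simp only [g, one_smul, zero_smul, add_zero]
  ring

section

variable {d I : ℕ}

/-- Quadratic lower bound near a local minimum of `w - φ`, with the pure time-dependence of order
two, and the convexity in `p` of `φ` along the simplex, isolated. -/
lemma exists_quadratic_lower_bound {w : ℝ → EuclideanSpace ℝ (Fin d) → (Fin I → ℝ) → ℝ}
    {φ : ℝ × EuclideanSpace ℝ (Fin d) × (Fin I → ℝ) → ℝ} (hφ : ContDiff ℝ 2 φ)
    {D : ℝ × EuclideanSpace ℝ (Fin d) × (Fin I → ℝ) →L[ℝ] ℝ}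
    {D₂ : ℝ × EuclideanSpace ℝ (Fin d) × (Fin I → ℝ) →L[ℝ]
      ℝ × EuclideanSpace ℝ (Fin d) × (Fin I → ℝ) →L[ℝ] ℝ}
    {S : Set (ℝ × EuclideanSpace ℝ (Fin d) × (Fin I → ℝ))}
    {t₀ : ℝ} {x₀ : EuclideanSpace ℝ (Fin d)} {p₀ : Fin I → ℝ}
    (hD : fderiv ℝ φ (t₀, x₀, p₀) = D) (hD₂ : fderiv ℝ (fderiv ℝ φ) (t₀, x₀, p₀) = D₂)
    (hmin : IsLocalMinOn (fun q ↦ w q.1 q.2.1 q.2.2 - φ q) S (t₀, x₀, p₀))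
    {lam ε : ℝ} (hlam : 0 < lam) (hε : 0 < ε)
    (hconv : ∀ q ∈ S, lam * ((q.2.2 - p₀) ⬝ᵥ (q.2.2 - p₀)) ≤
      D₂ (0, 0, q.2.2 - p₀) (0, 0, q.2.2 - p₀)) :
    ∃ C κ δ : ℝ, 0 ≤ C ∧ 0 < κ ∧ 0 < δ ∧ ∀ t x p, (t, x, p) ∈ S → |t - t₀| < δ → ‖x - x₀‖ < δ →
      ‖p - p₀‖ < δ →
      w t₀ x₀ p₀ + D (1, 0, 0) * (t - t₀) - C * (t - t₀) ^ 2 + D (0, x - x₀, 0) +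
          (1 / 2) * D₂ (0, x - x₀, 0) (0, x - x₀, 0) - ε * ‖x - x₀‖ ^ 2 +
        (D (0, 0, p - p₀) + (1 / 2) * (D₂ (0, x - x₀, 0) (0, 0, p - p₀) +
          D₂ (0, 0, p - p₀) (0, x - x₀, 0))) + κ * ((p - p₀) ⬝ᵥ (p - p₀)) ≤ w t x p := by
  -- The Taylor error and Young's inequality against the time increment each cost one `η` in `‖y‖ ^
  -- 2` and in `‖r‖ ^ 2`. In `p` this leaves `lam / 2 - 2 η ≥ lam / 4`. Any multiple of `s ^ 2` is
  -- harmless, as only the first time derivative enters the equation. The mixed `x`-`p` terms are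
  -- kept, since absorbing them would spoil the Hessian in `x` or the convexity in `p`.
  set η := min (ε / 2) (lam / 8)
  have hη : 0 < η := lt_min (by positivity) (by positivity)
  have hηε : 2 * η ≤ ε := by have := min_le_left (ε / 2) (lam / 8); simp only [η]; linarith
  have hηl : 2 * η ≤ lam / 4 := by have := min_le_right (ε / 2) (lam / 8); simp only [η]; linarith
  obtain ⟨δ₁, hδ₁, htay⟩ := exists_taylor_two hφ (t₀, x₀, p₀) hη
  rw [hD, hD₂] at htay
  obtain ⟨δ₂, hδ₂, hloc⟩ := Metric.mem_nhdsWithin_iff.1 hmin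
  set b := ‖D₂‖
  refine ⟨b / 2 + b ^ 2 / (2 * η) + η, lam / 4, min δ₁ δ₂, by positivity, by positivity,
    lt_min hδ₁ hδ₂, fun t x p hS ht hx hp ↦ ?_⟩
  set s := t - t₀ with hs
  set y := x - x₀ with hy
  set r := p - p₀ with hr
  have hnorm : ‖(s, y, r)‖ = max |s| (max ‖y‖ ‖r‖) := rfl
  have hlt : ‖(s, y, r)‖ < min δ₁ δ₂ := by
    rw [hnorm]; exact max_lt ht (max_lt hx hp)
  have hz : (t₀, x₀, p₀) + (s, y, r) = (t, x, p) := by simp [hs, hy, hr]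
  have h1 := htay (s, y, r) (hlt.trans_le (min_le_left _ _))
  rw [hz] at h1
  have h2 : w t₀ x₀ p₀ - φ (t₀, x₀, p₀) ≤ w t x p - φ (t, x, p) := by
    refine hloc ⟨?_, hS⟩
    rw [Metric.mem_ball, dist_eq_norm, ← hz, add_sub_cancel_left]
    exact hlt.trans_le (min_le_right _ _)
  have hsplit : ((s, y, r) : ℝ × EuclideanSpace ℝ (Fin d) × (Fin I → ℝ)) =
      (s, 0, 0) + (0, y, 0) + (0, 0, r) := by simp
  have hs1 : ((s, 0, 0) : ℝ × EuclideanSpace ℝ (Fin d) × (Fin I → ℝ)) = s • (1, 0, 0) := by simp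
  have e1 : D (s, y, r) = D (1, 0, 0) * s + D (0, y, 0) + D (0, 0, r) := by
    rw [hsplit, map_add, map_add, hs1, map_smul, smul_eq_mul, mul_comm]
  have e2 : D₂ (s, y, r) (s, y, r) = D₂ (s, 0, 0) (s, y, r) + D₂ (0, y, 0) (s, 0, 0) +
      D₂ (0, 0, r) (s, 0, 0) + D₂ (0, y, 0) (0, y, 0) + (D₂ (0, y, 0) (0, 0, r) +
      D₂ (0, 0, r) (0, y, 0)) + D₂ (0, 0, r) (0, 0, r) := by
    conv_lhs => rw [hsplit]
    rw [hsplit]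
    simp only [map_add, add_apply]
    ring
  have n1 : ‖((s, 0, 0) : ℝ × EuclideanSpace ℝ (Fin d) × (Fin I → ℝ))‖ = |s| := by
    simp [Prod.norm_def]
  have n2 : ‖((0, y, 0) : ℝ × EuclideanSpace ℝ (Fin d) × (Fin I → ℝ))‖ = ‖y‖ := by
    simp [Prod.norm_def]
  have n3 : ‖((0, 0, r) : ℝ × EuclideanSpace ℝ (Fin d) × (Fin I → ℝ))‖ = ‖r‖ := by
    simp [Prod.norm_def]
  have b1 := TestFn.abs_bilin_le D₂ (s, 0, 0) (s, y, r)
  have b2 := TestFn.abs_bilin_le D₂ (0, y, 0) (s, 0, 0)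
  have b3 := TestFn.abs_bilin_le D₂ (0, 0, r) (s, 0, 0)
  rw [n1] at b1 b2 b3
  rw [n2] at b2
  rw [n3] at b3
  have ps := abs_nonneg s
  have py := norm_nonneg y
  have pr := norm_nonneg r
  have hb : 0 ≤ b := by positivity
  have hle : ‖(s, y, r)‖ ≤ |s| + ‖y‖ + ‖r‖ := by
    rw [hnorm]
    exact max_le (by linarith) (max_le (by linarith) (by linarith))
  have hsq : ‖(s, y, r)‖ ^ 2 ≤ s ^ 2 + ‖y‖ ^ 2 + ‖r‖ ^ 2 := by
    rw [hnorm, ← sq_abs s]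
    exact max_max_sq_le _ _ _
  have b1' : b * |s| * ‖(s, y, r)‖ ≤ b * |s| * (|s| + ‖y‖ + ‖r‖) := by gcongr
  have young : ∀ a : ℝ, b * |s| * a ≤ η * a ^ 2 + b ^ 2 / (4 * η) * s ^ 2 := fun a ↦ by
    have h3 : 0 ≤ (2 * η * a - b * |s|) ^ 2 / (4 * η) := by positivity
    have h4 : (2 * η * a - b * |s|) ^ 2 / (4 * η) =
        η * a ^ 2 + b ^ 2 / (4 * η) * s ^ 2 - b * |s| * a := by
      rw [← sq_abs s]
      field_simp
      ring
    linarith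
  have y1 := young ‖y‖
  have y2 := young ‖r‖
  have hrr := TestFn.norm_sq_le_dotProduct_self r
  have hc := hconv _ hS
  change lam * (r ⬝ᵥ r) ≤ D₂ (0, 0, r) (0, 0, r) at hc
  have hss : |s| * |s| = s ^ 2 := by rw [← sq, sq_abs]
  have hC : b ^ 2 / (2 * η) = b ^ 2 / (4 * η) + b ^ 2 / (4 * η) := by field_simp; ring
  have hηsq := mul_le_mul_of_nonneg_left hsq hη.le
  have hηrr := mul_le_mul_of_nonneg_left hrr hη.le
  have hεy := mul_le_mul_of_nonneg_right hηε (sq_nonneg ‖y‖)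
  have hlr := mul_le_mul_of_nonneg_right hηl (TestFn.dotProduct_self_nonneg' r)
  have hbss : b * |s| * |s| = b * s ^ 2 := by rw [mul_assoc, hss]
  rw [e1, e2] at h1
  have h1' := (abs_le.1 h1).1
  rw [abs_le] at b1 b2 b3
  have c1 := b1.1
  have c2 := b2.1
  have c3 := b3.1
  rw [hC]
  linarith

/-- A quadratic lower bound near `p₀` extends to the whole simplex by convexity. -/
lemma exists_lower_bound_on_simplex {w : ℝ → EuclideanSpace ℝ (Fin d) → (Fin I → ℝ) → ℝ}
    {T t₀ : ℝ} {x₀ : EuclideanSpace ℝ (Fin d)} {p₀ : Fin I → ℝ} (hp₀ : p₀ ∈ simplex I)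
    (hconv : ∀ t ∈ Icc 0 T, ∀ x, ConvexOn ℝ (simplex I) (w t x))
    {A : ℝ → EuclideanSpace ℝ (Fin d) → ℝ}
    {Λ : EuclideanSpace ℝ (Fin d) → (Fin I → ℝ) →ₗ[ℝ] ℝ} {κ δ : ℝ} (hκ : 0 < κ) (hδ : 0 < δ)
    (hloc : ∀ t ∈ Icc 0 T, ∀ x, ∀ p ∈ simplex I, |t - t₀| < δ → ‖x - x₀‖ < δ → ‖p - p₀‖ < δ →
      A t x + Λ x (p - p₀) + κ * ((p - p₀) ⬝ᵥ (p - p₀)) ≤ w t x p)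
    (hcont : ∀ ε > 0, ∃ δ > 0, ∀ t ∈ Icc 0 T, ∀ x, |t - t₀| < δ → ‖x - x₀‖ < δ →
      w t x p₀ - A t x ≤ ε) :
    ∃ κ' δ' : ℝ, 0 < κ' ∧ 0 < δ' ∧ ∀ t ∈ Icc 0 T, ∀ x, ∀ p ∈ simplex I, |t - t₀| < δ' →
      ‖x - x₀‖ < δ' → A t x + Λ x (p - p₀) + κ' * ((p - p₀) ⬝ᵥ (p - p₀)) ≤ w t x p := by
  -- Contracting the simplex towards `p₀` by the factor `θ` brings every point within `δ` of `p₀`,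
  -- where the local bound holds.
  set θ := min (δ / 2) 1
  have hθ : 0 < θ := lt_min (by positivity) one_pos
  have hθ1 : θ ≤ 1 := min_le_right _ _
  have hθδ : θ < δ := (min_le_left _ _).trans_lt (by linarith)
  -- Undoing the contraction by convexity costs `w t x p₀ - A t x`, which must be at most half of
  -- the gain `κ θ² |p - p₀|²` for `‖p - p₀‖ ≥ δ`; division by `θ` leaves `κ θ / 2`.
  obtain ⟨δ₁, hδ₁, hc⟩ := hcont (κ * θ ^ 2 / 2 * δ ^ 2) (by positivity)
  refine ⟨κ * θ / 2, min δ δ₁, by positivity, lt_min hδ hδ₁, fun t ht x p hp ht' hx' ↦ ?_⟩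
  have hrr := TestFn.dotProduct_self_nonneg' (p - p₀)
  have htδ := ht'.trans_le (min_le_left _ _)
  have hxδ := hx'.trans_le (min_le_left _ _)
  rcases lt_or_ge ‖p - p₀‖ δ with hr | hr
  · refine le_trans ?_ (hloc t ht x p hp htδ hxδ hr)
    have : κ * θ / 2 * ((p - p₀) ⬝ᵥ (p - p₀)) ≤ κ * ((p - p₀) ⬝ᵥ (p - p₀)) := by
      gcongr
      nlinarith
    linarith
  · have h1 := hc t ht x (ht'.trans_le (min_le_right _ _)) (hx'.trans_le (min_le_right _ _))
    have h2 := hloc t ht x p₀ hp₀ htδ hxδ (by simpa using hδ)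
    simp only [sub_self, map_zero, zero_dotProduct, mul_zero, add_zero] at h2
    have hq := (hconv t ht x).2 hp₀ hp (sub_nonneg.2 hθ1) hθ.le (by ring)
    have hqm := convex_stdSimplex ℝ _ hp₀ hp (sub_nonneg.2 hθ1) hθ.le (by ring)
    have he : (1 - θ) • p₀ + θ • p - p₀ = θ • (p - p₀) := by
      rw [sub_smul, one_smul, smul_sub]; abel
    have h3 := hloc t ht x _ hqm htδ hxδ (by
      rw [he, norm_smul, Real.norm_eq_abs, abs_of_pos hθ]
      exact (mul_le_of_le_one_right hθ.le
        (TestFn.norm_sub_le_one_of_mem_simplex hp hp₀)).trans_lt hθδ)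
    rw [he, map_smul, smul_dotProduct, dotProduct_smul] at h3
    simp only [smul_eq_mul] at h3 hq
    have h4 : κ * θ ^ 2 / 2 * δ ^ 2 ≤ κ * θ ^ 2 / 2 * ((p - p₀) ⬝ᵥ (p - p₀)) := by
      gcongr
      exact le_trans (by gcongr) (TestFn.norm_sq_le_dotProduct_self _)
    have h5 : (1 - θ) * (w t x p₀ - A t x) ≤ w t x p₀ - A t x :=
      mul_le_of_le_one_left (by linarith) (by linarith)
    refine le_of_mul_le_mul_left ?_ hθ
    linarith

end

/-- The local bound already covers the whole simplex, so only `t` and `x` need a penalty. Near the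
base point the margins `ε` and `κ` force equality; away from it a large `K` overcomes the growth of
`ψ` and the lower bound on `w`. -/
lemma TestFn.exists_penalty {d I : ℕ} {w : ℝ → EuclideanSpace ℝ (Fin d) → (Fin I → ℝ) → ℝ}
    (ψ : TestFn d I) (hψ : ψ.K = 0) (hp₀ : ψ.p₀ ∈ simplex I) {T C₀ C ε κ δ : ℝ} (hC₀ : 0 ≤ C₀)
    (hC : 0 ≤ C) (hε : 0 < ε) (hκ : 0 < κ) (hδ : 0 < δ)
    (hw : ∀ t ∈ Icc 0 T, ∀ x, ∀ p ∈ simplex I, -C₀ ≤ w t x p)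
    (hloc : ∀ t ∈ Icc 0 T, ∀ x, ∀ p ∈ simplex I, |t - ψ.t₀| < δ → ‖x - ψ.x₀‖ < δ →
      ψ.eval t x p - C * (t - ψ.t₀) ^ 2 + ε * ‖x - ψ.x₀‖ ^ 2 +
        κ * ((p - ψ.p₀) ⬝ᵥ (p - ψ.p₀)) ≤ w t x p) :
    ∃ K, 0 < K ∧ ∀ t ∈ Icc 0 T, ∀ x, ∀ p ∈ simplex I,
      w t x p ≤ ({ψ with K := K} : TestFn d I).eval t x p →
        t = ψ.t₀ ∧ x = ψ.x₀ ∧ p = ψ.p₀ := by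
  obtain ⟨C₃, hC₃, hgr⟩ := ψ.exists_growth hψ.ge hp₀ T
  set a := 2 * C₃ + C₀ + 1
  have ha : 0 < a := by positivity
  -- `C + 1` beats the local loss in time, `C₃` the quadratic growth of `ψ`, and the last two terms
  -- give at least `a` once `|t - t₀| ≥ δ` or `‖x - x₀‖ ≥ δ`.
  refine ⟨C + 1 + C₃ + a / δ ^ 2 + a / δ ^ 4, by positivity, fun t ht x p hp hle ↦ ?_⟩
  set K := C + 1 + C₃ + a / δ ^ 2 + a / δ ^ 4 with hKdef
  have hK1 : C + 1 ≤ K := by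
    have : 0 ≤ a / δ ^ 2 := by positivity
    have : 0 ≤ a / δ ^ 4 := by positivity
    linarith
  have heval : ({ψ with K := K} : TestFn d I).eval t x p =
      ψ.eval t x p - K * (t - ψ.t₀) ^ 2 - K * ‖x - ψ.x₀‖ ^ 4 := by
    unfold eval
    rw [hψ]
    ring
  rw [heval] at hle
  have h4 : 0 ≤ ‖x - ψ.x₀‖ ^ 4 := by positivity
  have hs2 : 0 ≤ (t - ψ.t₀) ^ 2 := sq_nonneg _
  by_cases hnear : |t - ψ.t₀| < δ ∧ ‖x - ψ.x₀‖ < δ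
  · have h1 := hloc t ht x p hp hnear.1 hnear.2
    have h2 : (C + 1) * (t - ψ.t₀) ^ 2 ≤ K * (t - ψ.t₀) ^ 2 := by gcongr
    have h3 : 0 ≤ K * ‖x - ψ.x₀‖ ^ 4 := mul_nonneg (by linarith) h4
    have h5 : 0 ≤ ε * ‖x - ψ.x₀‖ ^ 2 := by positivity
    have h6 : 0 ≤ κ * ‖p - ψ.p₀‖ ^ 2 := by positivity
    have h7 := mul_le_mul_of_nonneg_left (norm_sq_le_dotProduct_self (p - ψ.p₀)) hκ.le
    have z1 : (t - ψ.t₀) ^ 2 = 0 := by linarith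
    have z2 : ε * ‖x - ψ.x₀‖ ^ 2 = 0 := by linarith
    have z3 : κ * ‖p - ψ.p₀‖ ^ 2 = 0 := by linarith
    refine ⟨?_, ?_, ?_⟩
    · simpa [sub_eq_zero] using z1
    · simpa [hε.ne', sub_eq_zero] using z2
    · simpa [hκ.ne', sub_eq_zero] using z3
  · exfalso
    have h1 := (abs_le.1 (hgr t ht x p hp)).2
    rw [hψ, zero_mul, add_zero] at h1
    have h2 := hw t ht x p hp
    set S := (t - ψ.t₀) ^ 2
    set Y := ‖x - ψ.x₀‖ ^ 4
    have h3 : a ≤ (a / δ ^ 2 + a / δ ^ 4) * (S + Y) := by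
      rw [not_and_or, not_lt, not_lt] at hnear
      rcases hnear with h | h
      · have h5 : δ ^ 2 ≤ S := by
          simp only [S]
          rw [← sq_abs (t - ψ.t₀)]
          gcongr
        calc a = a / δ ^ 2 * δ ^ 2 := by field_simp
          _ ≤ (a / δ ^ 2 + a / δ ^ 4) * (S + Y) := by
            gcongr
            · have : 0 ≤ a / δ ^ 4 := by positivity
              linarith
            · linarith
      · have h5 : δ ^ 4 ≤ Y := by
          simp only [Y]
          gcongr
        calc a = a / δ ^ 4 * δ ^ 4 := by field_simp
          _ ≤ (a / δ ^ 2 + a / δ ^ 4) * (S + Y) := by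
            gcongr
            · have : 0 ≤ a / δ ^ 2 := by positivity
              linarith
            · linarith
    have hy2 : ‖x - ψ.x₀‖ ^ 2 ≤ 1 + Y := by
      simp only [Y]
      nlinarith [sq_nonneg (‖x - ψ.x₀‖ ^ 2 - 1)]
    have h5 : C₃ * (1 + ‖x - ψ.x₀‖ ^ 2) ≤ C₃ * (2 + Y) :=
      mul_le_mul_of_nonneg_left (by linarith) hC₃
    have h6 : K * S + K * Y = (a / δ ^ 2 + a / δ ^ 4) * (S + Y) + (C + 1) * (S + Y) +
        C₃ * S + C₃ * Y := by rw [hKdef]; ring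
    have h7 : 0 ≤ (C + 1) * (S + Y) := by positivity
    have h8 : 0 ≤ C₃ * S := by positivity
    linarith

/-! ### Partial derivatives, traces and `lambdaMin`. -/

section Calculus

variable {E F : Type*} [NormedAddCommGroup E] [NormedSpace ℝ E] [NormedAddCommGroup F]
  [NormedSpace ℝ F] {f : F → ℝ} {j : E → F} {ι : E →L[ℝ] F}

lemma fderiv_comp_affine (hf : Differentiable ℝ f) (hj : ∀ y, HasFDerivAt j ι y) (y : E) :
    fderiv ℝ (fun y ↦ f (j y)) y = (fderiv ℝ f (j y)).comp ι :=
  ((hf (j y)).hasFDerivAt.comp y (hj y)).fderiv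

/-- The derivative of `j` is the same `ι` everywhere, so the chain rule has no term in a second
derivative of `j`. -/
lemma iteratedFDeriv_two_comp_affine (hf : ContDiff ℝ 2 f) (hj : ∀ y, HasFDerivAt j ι y) (y a b : E) :
    iteratedFDeriv ℝ 2 (fun y ↦ f (j y)) y ![a, b] =
      fderiv ℝ (fderiv ℝ f) (j y) (ι a) (ι b) := by
  have hd : Differentiable ℝ f := hf.differentiable (by norm_num)
  have hd2 : DifferentiableAt ℝ (fderiv ℝ f) (j y) :=
    ((hf.fderiv_right (m := 1) (by norm_num)).differentiable (by norm_num)) _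
  rw [iteratedFDeriv_two_apply]
  have h1 : fderiv ℝ (fun y ↦ f (j y)) = fun y ↦ (fderiv ℝ f (j y)).comp ι :=
    funext (fderiv_comp_affine hd hj)
  have h2 : HasFDerivAt (fun y ↦ (fderiv ℝ f (j y)).comp ι)
      (((ContinuousLinearMap.compL ℝ E F ℝ).flip ι).comp
        ((fderiv ℝ (fderiv ℝ f) (j y)).comp ι)) y :=
    ((ContinuousLinearMap.compL ℝ E F ℝ).flip ι).hasFDerivAt.comp y
      (hd2.hasFDerivAt.comp y (hj y))
  rw [h1, h2.fderiv]
  rfl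

end Calculus

/-- Identifies the trace term of the equation with the form in which `TestFn.diffusion` arises from
the covariance of the noise. The symmetry of `S * Sᵀ` suffices; `R` need not be symmetric. -/
lemma trace_mul_transpose_mul {d : ℕ} (S : Matrix (Fin d) (Fin d) ℝ)
    (R : EuclideanSpace ℝ (Fin d) →L[ℝ] EuclideanSpace ℝ (Fin d) →L[ℝ] ℝ) :
    (S * S.transpose * Matrix.of fun i j ↦
        R (EuclideanSpace.single i 1) (EuclideanSpace.single j 1)).trace =
      ∑ k, R (S.toEuclideanLin (EuclideanSpace.single k 1))
        (S.toEuclideanLin (EuclideanSpace.single k 1)) := by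
  have h : ∀ k, S.toEuclideanLin (EuclideanSpace.single k 1) =
      ∑ i, S i k • EuclideanSpace.single i (1 : ℝ) := fun k ↦ by
    conv_lhs => rw [euclidean_eq_sum (S.toEuclideanLin (EuclideanSpace.single k 1))]
    refine Finset.sum_congr rfl fun i _ ↦ ?_
    congr 1
    simp [Matrix.toEuclideanLin]
  simp only [h, map_sum, map_smul, sum_apply, smul_apply, smul_eq_mul, Finset.mul_sum,
    Matrix.trace, Matrix.diag, Matrix.mul_apply, Matrix.transpose_apply, Matrix.of_apply,
    Finset.sum_mul]
  rw [Finset.sum_comm]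
  calc _ = ∑ j, ∑ i, ∑ k, S i k * S j k *
        R (EuclideanSpace.single j 1) (EuclideanSpace.single i 1) := rfl
    _ = ∑ j, ∑ k, ∑ i, S i k * S j k *
        R (EuclideanSpace.single j 1) (EuclideanSpace.single i 1) :=
      Finset.sum_congr rfl fun j _ ↦ Finset.sum_comm
    _ = ∑ k, ∑ j, ∑ i, S i k * S j k *
        R (EuclideanSpace.single j 1) (EuclideanSpace.single i 1) := Finset.sum_comm
    _ = ∑ k, ∑ i, ∑ j, S i k * S j k *
        R (EuclideanSpace.single j 1) (EuclideanSpace.single i 1) :=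
      Finset.sum_congr rfl fun k _ ↦ Finset.sum_comm
    _ = _ := by
      refine Finset.sum_congr rfl fun k _ ↦ Finset.sum_congr rfl fun i _ ↦
        Finset.sum_congr rfl fun j _ ↦ by ring

lemma mulVec_dotProduct_bilin {I : ℕ} (R : (Fin I → ℝ) →L[ℝ] (Fin I → ℝ) →L[ℝ] ℝ)
    (z : Fin I → ℝ) :
    (Matrix.of fun i j ↦ R (Pi.single i 1) (Pi.single j 1)).mulVec z ⬝ᵥ z = R z z := by
  have h : z = ∑ i, z i • (Pi.single i (1 : ℝ) : Fin I → ℝ) := by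
    ext j; simp [Finset.sum_apply, Pi.single_apply]
  conv_rhs => rw [h]
  simp only [map_sum, map_smul, sum_apply, smul_apply, smul_eq_mul, Finset.mul_sum,
    Matrix.mulVec, dotProduct, Matrix.of_apply, Finset.sum_mul]
  rw [Finset.sum_comm]
  refine Finset.sum_congr rfl fun i _ ↦ Finset.sum_congr rfl fun j _ ↦ by ring

/-- A real number strictly between `0` and the infimum serves as the constant, so attainment plays
no role. If the cone is `{0}`, then `q = p` is the only case. -/
lemma exists_pos_of_lambdaMin_pos {I : ℕ} {p : Fin I → ℝ} {A : Matrix (Fin I) (Fin I) ℝ}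
    (h : 0 < lambdaMin p A) :
    ∃ lam : ℝ, 0 < lam ∧ ∀ q ∈ simplex I, lam * ((q - p) ⬝ᵥ (q - p)) ≤
      A.mulVec (q - p) ⬝ᵥ (q - p) := by
  obtain ⟨c, hc0, hc⟩ := EReal.lt_iff_exists_real_btwn.1 h
  refine ⟨c, by exact_mod_cast hc0, fun q hq ↦ ?_⟩
  by_cases hz : q - p = 0
  · simp [hz]
  have hmem : q - p ∈ tangentCone p \ {0} :=
    ⟨subset_closure ⟨1, one_pos, q, hq, by simp⟩, hz⟩
  have h1 : (c : EReal) < ((A.mulVec (q - p) ⬝ᵥ (q - p) / ((q - p) ⬝ᵥ (q - p)) : ℝ) : EReal) :=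
    hc.trans_le (iInf₂_le (q - p) hmem)
  have h2 := EReal.coe_lt_coe_iff.1 h1
  have h3 : 0 < (q - p) ⬝ᵥ (q - p) :=
    (pow_pos (norm_pos_iff.2 hz) 2).trans_le (TestFn.norm_sq_le_dotProduct_self _)
  exact ((lt_div_iff₀ h3).1 h2).le

/-! ### Properties of the limit. -/

namespace Game

variable {d I m n : ℕ} {G : Game d I m n} {Ω : Type*} [MeasurableSpace Ω] {P : Measure Ω}
  {B : ℝ≥0 → Ω → EuclideanSpace ℝ (Fin d)}
  {w : ℝ → EuclideanSpace ℝ (Fin d) → (Fin I → ℝ) → ℝ} {L : ℕ → ℕ}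

/-- The same grid times serve all `p`, as is needed to pass convexity in `p` to the limit. -/
lemma IsLimitAlong.exists_seq (hT : 0 < G.T) (hL : Tendsto L atTop atTop)
    (hw : G.IsLimitAlong P B w L) {t : ℝ} (ht : t ∈ Icc 0 G.T) (x : EuclideanSpace ℝ (Fin d)) :
    ∃ k : ℕ → ℕ, (∀ᶠ j in atTop, 0 < L j ∧ k j ≤ L j) ∧
      Tendsto (fun j ↦ G.gridTime (L j) (k j)) atTop (𝓝 t) ∧
      ∀ p ∈ simplex I, Tendsto (fun j ↦ G.scheme P B (L j) (k j) x p) atTop (𝓝 (w t x p)) := by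
  have h : ∀ j, ∃ k, 0 < L j → k ≤ L j ∧ |G.gridTime (L j) k - t| ≤ G.step (L j) := fun j ↦ by
    by_cases hj : 0 < L j
    · obtain ⟨k, hk⟩ := exists_gridTime_near hT hj ht
      exact ⟨k, fun _ ↦ hk⟩
    · exact ⟨0, fun h ↦ absurd h hj⟩
  choose k hk using h
  have hpos : ∀ᶠ j in atTop, 0 < L j := hL.eventually_gt_atTop 0
  have hgrid : Tendsto (fun j ↦ G.gridTime (L j) (k j)) atTop (𝓝 t) := by
    rw [tendsto_iff_dist_tendsto_zero]
    refine squeeze_zero' (Eventually.of_forall fun _ ↦ dist_nonneg) ?_ (tendsto_step (G := G) hL)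
    filter_upwards [hpos] with j hj using (hk j hj).2
  refine ⟨k, hpos.mono fun j hj ↦ ⟨hj, (hk j hj).1⟩, hgrid, fun p hp ↦ ?_⟩
  rw [Metric.tendsto_atTop']
  intro ε hε
  obtain ⟨δ, hδ, N, hN⟩ := hw t ht x p hp ε hε
  have hev : ∀ᶠ j in atTop, dist (G.scheme P B (L j) (k j) x p) (w t x p) < ε := by
    filter_upwards [hpos, eventually_ge_atTop N, (Metric.tendsto_nhds.1 hgrid) δ hδ]
      with j hj hjN hjd
    exact hN j hjN _ (hk j hj).1 x p hp hjd (by simpa using hδ) (by simpa using hδ)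
  obtain ⟨M, hM⟩ := eventually_atTop.1 hev
  exact ⟨M, fun j hj ↦ hM j hj.le⟩

/-- Values of `w` near a point are limits of scheme values that the convergence at that point
already keeps within `ε`. -/
lemma IsLimitAlong.continuous_at (hT : 0 < G.T) (hL : Tendsto L atTop atTop)
    (hw : G.IsLimitAlong P B w L) {t : ℝ} (ht : t ∈ Icc 0 G.T) (x : EuclideanSpace ℝ (Fin d))
    {p : Fin I → ℝ} (hp : p ∈ simplex I) {ε : ℝ} (hε : 0 < ε) :
    ∃ δ > 0, ∀ t' ∈ Icc 0 G.T, ∀ x', ∀ p' ∈ simplex I, |t' - t| < δ → ‖x' - x‖ < δ →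
      ‖p' - p‖ < δ → |w t' x' p' - w t x p| ≤ ε := by
  obtain ⟨δ, hδ, N, hN⟩ := hw t ht x p hp ε hε
  refine ⟨δ, hδ, fun t' ht' x' p' hp' h1 h2 h3 ↦ ?_⟩
  obtain ⟨k, hk, hgrid, hlim⟩ := hw.exists_seq hT hL ht' x'
  refine le_of_tendsto ((hlim p' hp').sub_const (w t x p)).abs ?_
  filter_upwards [hk, eventually_ge_atTop N, (hgrid.sub_const t).abs.eventually_lt_const h1]
    with j hj hjN hjd
  exact (hN j hjN _ hj.2 x' p' hp' hjd h2 h3).le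

lemma IsLimitAlong.lowerSemicontinuousOn (hT : 0 < G.T) (hL : Tendsto L atTop atTop)
    (hw : G.IsLimitAlong P B w L) :
    LowerSemicontinuousOn (fun q : ℝ × EuclideanSpace ℝ (Fin d) × (Fin I → ℝ) ↦
      w q.1 q.2.1 q.2.2) G.domain := by
  refine ContinuousOn.lowerSemicontinuousOn ?_
  rintro ⟨t, x, p⟩ ⟨ht, -, hp⟩
  rw [Metric.continuousWithinAt_iff]
  intro ε hε
  obtain ⟨δ, hδ, h⟩ := hw.continuous_at hT hL ht x hp (half_pos hε)
  refine ⟨δ, hδ, ?_⟩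
  rintro ⟨t', x', p'⟩ ⟨ht', -, hp'⟩ hdist
  rw [Prod.dist_eq, Prod.dist_eq, max_lt_iff, max_lt_iff, Real.dist_eq, dist_eq_norm,
    dist_eq_norm] at hdist
  rw [Real.dist_eq]
  exact (h t' ht' x' p' hp' hdist.1 hdist.2.1 hdist.2.2).trans_lt (half_lt_self hε)

lemma IsLimitAlong.eq_terminal (hT : 0 < G.T) (hL : Tendsto L atTop atTop)
    (hw : G.IsLimitAlong P B w L) (x : EuclideanSpace ℝ (Fin d)) {p : Fin I → ℝ}
    (hp : p ∈ simplex I) : w G.T x p = G.terminal x p := by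
  refine eq_of_abs_sub_le_all fun ε hε ↦ ?_
  obtain ⟨δ, hδ, N, hN⟩ := hw G.T ⟨hT.le, le_rfl⟩ x p hp ε hε
  obtain ⟨j, hj, hjN⟩ := ((hL.eventually_gt_atTop 0).and (eventually_ge_atTop N)).exists
  have h := hN j hjN (L j) le_rfl x p hp (by rw [gridTime, step_mul _ hj]; simpa using hδ)
    (by simpa using hδ) (by simpa using hδ)
  rw [scheme_self, abs_sub_comm] at h
  exact h.le

lemma IsLimitAlong.convexOn [IsProbabilityMeasure P] (hG : G.Assumptions) (hB : IsBrownian P B)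
    (hL : Tendsto L atTop atTop) (hw : G.IsLimitAlong P B w L) {t : ℝ} (ht : t ∈ Icc 0 G.T)
    (x : EuclideanSpace ℝ (Fin d)) : ConvexOn ℝ (simplex I) (w t x) := by
  obtain ⟨C, -, hsch⟩ := hG.exists_scheme_bound (P := P) hB
  obtain ⟨k, hk, -, hlim⟩ := hw.exists_seq hG.T_pos hL ht x
  refine ⟨convex_stdSimplex ℝ _, fun p hp q hq a b ha hb hab ↦ ?_⟩
  refine le_of_tendsto_of_tendsto (hlim _ (convex_stdSimplex ℝ _ hp hq ha hb hab))
    (((hlim p hp).const_mul a).add ((hlim q hq).const_mul b)) ?_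
  filter_upwards [hk] with j hj
  exact ((hsch (L j) (k j) hj.1 hj.2).2 x).2 hp hq ha hb hab

lemma IsLimitAlong.exists_bound [IsProbabilityMeasure P] (hG : G.Assumptions)
    (hB : IsBrownian P B) (hL : Tendsto L atTop atTop) (hw : G.IsLimitAlong P B w L) :
    ∃ C, 0 ≤ C ∧ ∀ t ∈ Icc 0 G.T, ∀ x, ∀ p ∈ simplex I, -C ≤ w t x p := by
  obtain ⟨C, hC, hsch⟩ := hG.exists_scheme_bound (P := P) hB
  refine ⟨C, hC, fun t ht x p hp ↦ ?_⟩
  obtain ⟨k, hk, -, hlim⟩ := hw.exists_seq hG.T_pos hL ht x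
  refine ge_of_tendsto (hlim p hp) ?_
  filter_upwards [hk] with j hj
  exact (abs_le.1 ((hsch (L j) (k j) hj.1 hj.2).1.1 x p hp)).1

end Game

/-! ### General test functions. -/

/-- The inner product as a continuous bilinear form. -/
def innerBilin (d : ℕ) : EuclideanSpace ℝ (Fin d) →L[ℝ] EuclideanSpace ℝ (Fin d) →L[ℝ] ℝ :=
  LinearMap.mkContinuous₂ (innerₗ (EuclideanSpace ℝ (Fin d))) 1
    fun x y ↦ by simpa using norm_inner_le_norm (𝕜 := ℝ) x y

lemma innerBilin_self {d : ℕ} (x : EuclideanSpace ℝ (Fin d)) : innerBilin d x x = ‖x‖ ^ 2 := by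
  simp [innerBilin]

/-- The inclusion of the space variable in the product of time, space and parameter. -/
def inclSpace (d I : ℕ) :
    EuclideanSpace ℝ (Fin d) →L[ℝ] ℝ × EuclideanSpace ℝ (Fin d) × (Fin I → ℝ) :=
  (ContinuousLinearMap.inr ℝ ℝ _).comp (ContinuousLinearMap.inl ℝ _ _)

/-- The inclusion of the parameter in the product of time, space and parameter. -/
def inclParam (d I : ℕ) :
    (Fin I → ℝ) →L[ℝ] ℝ × EuclideanSpace ℝ (Fin d) × (Fin I → ℝ) :=
  (ContinuousLinearMap.inr ℝ ℝ _).comp (ContinuousLinearMap.inr ℝ _ _)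

namespace Game

variable {d I m n : ℕ} {G : Game d I m n} {Ω : Type*} [MeasurableSpace Ω] {P : Measure Ω}
  {B : ℝ≥0 → Ω → EuclideanSpace ℝ (Fin d)}
  {w : ℝ → EuclideanSpace ℝ (Fin d) → (Fin I → ℝ) → ℝ} {L : ℕ → ℕ}

section Derivatives

variable {φ : ℝ × EuclideanSpace ℝ (Fin d) × (Fin I → ℝ) → ℝ} (t : ℝ)
  (x : EuclideanSpace ℝ (Fin d)) (p : Fin I → ℝ)

lemma hasFDerivAt_space (y : EuclideanSpace ℝ (Fin d)) :
    HasFDerivAt (fun y ↦ ((t, y, p) : ℝ × EuclideanSpace ℝ (Fin d) × (Fin I → ℝ)))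
      (inclSpace d I) y :=
  ((hasFDerivAt_const t y).prodMk ((hasFDerivAt_id y).prodMk (hasFDerivAt_const p y))
    ).congr_fderiv (ContinuousLinearMap.ext fun _ ↦ rfl)

lemma hasFDerivAt_param (q : Fin I → ℝ) :
    HasFDerivAt (fun q ↦ ((t, x, q) : ℝ × EuclideanSpace ℝ (Fin d) × (Fin I → ℝ)))
      (inclParam d I) q :=
  ((hasFDerivAt_const t q).prodMk ((hasFDerivAt_const x q).prodMk (hasFDerivAt_id q))
    ).congr_fderiv (ContinuousLinearMap.ext fun _ ↦ rfl)

lemma deriv_time (hφ : ContDiff ℝ 2 φ) :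
    deriv (fun s ↦ φ (s, x, p)) t = fderiv ℝ φ (t, x, p) (1, 0, 0) := by
  have h1 : HasDerivAt (fun s : ℝ ↦ (s, x, p)) ((1 : ℝ), (0 : EuclideanSpace ℝ (Fin d)),
      (0 : Fin I → ℝ)) t :=
    (hasDerivAt_id t).prodMk ((hasDerivAt_const t x).prodMk (hasDerivAt_const t p))
  exact ((hφ.differentiable (by norm_num) (t, x, p)).hasFDerivAt.comp_hasDerivAt t h1).deriv

lemma gradient_space (hφ : ContDiff ℝ 2 φ) :
    gradient (fun y ↦ φ (t, y, p)) x =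
      (InnerProductSpace.toDual ℝ (EuclideanSpace ℝ (Fin d))).symm
        ((fderiv ℝ φ (t, x, p)).comp (inclSpace d I)) := by
  unfold gradient
  rw [fderiv_comp_affine (hφ.differentiable (by norm_num)) (hasFDerivAt_space t p)]

lemma trace_hessianX (hφ : ContDiff ℝ 2 φ) (S : Matrix (Fin d) (Fin d) ℝ) :
    (S * S.transpose * hessianX (fun y ↦ φ (t, y, p)) x).trace =
      ∑ k, fderiv ℝ (fderiv ℝ φ) (t, x, p)
        (inclSpace d I (S.toEuclideanLin (EuclideanSpace.single k 1)))
        (inclSpace d I (S.toEuclideanLin (EuclideanSpace.single k 1))) := by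
  have h := trace_mul_transpose_mul S
    ((fderiv ℝ (fderiv ℝ φ) (t, x, p)).bilinearComp (inclSpace d I) (inclSpace d I))
  simp only [ContinuousLinearMap.bilinearComp_apply] at h
  rw [← h]
  congr 2
  ext i j
  exact iteratedFDeriv_two_comp_affine hφ (hasFDerivAt_space t p) x _ _

lemma hessianP_mulVec_dotProduct (hφ : ContDiff ℝ 2 φ) (z : Fin I → ℝ) :
    (hessianP (fun q ↦ φ (t, x, q)) p).mulVec z ⬝ᵥ z =
      fderiv ℝ (fderiv ℝ φ) (t, x, p) (0, 0, z) (0, 0, z) := by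
  have h := mulVec_dotProduct_bilin
    ((fderiv ℝ (fderiv ℝ φ) (t, x, p)).bilinearComp (inclParam d I) (inclParam d I)) z
  refine Eq.trans ?_ h
  congr 2
  ext i j
  exact iteratedFDeriv_two_comp_affine hφ (hasFDerivAt_param t x) p _ _

end Derivatives

/-- At a local minimum of `w - φ` where `φ` is strictly convex along the simplex, the
Hamilton-Jacobi-Isaacs operator is nonpositive up to any multiple of the trace of `σσ*`. -/
lemma Assumptions.hjiOperator_le [IsProbabilityMeasure P] (hG : G.Assumptions)
    (hB : IsBrownian P B) (hL : Tendsto L atTop atTop) (hw : G.IsLimitAlong P B w L)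
    {φ : ℝ × EuclideanSpace ℝ (Fin d) × (Fin I → ℝ) → ℝ} (hφ : ContDiff ℝ 2 φ) {t₀ : ℝ}
    (ht₀ : t₀ ∈ Ico 0 G.T) (x₀ : EuclideanSpace ℝ (Fin d)) {p₀ : Fin I → ℝ}
    (hp₀ : p₀ ∈ simplex I)
    (hmin : IsLocalMinOn (fun q ↦ w q.1 q.2.1 q.2.2 - φ q) G.domain (t₀, x₀, p₀))
    {lam ε : ℝ} (hlam : 0 < lam) (hε : 0 < ε)
    (hconv : ∀ q ∈ simplex I, lam * ((q - p₀) ⬝ᵥ (q - p₀)) ≤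
      fderiv ℝ (fderiv ℝ φ) (t₀, x₀, p₀) (0, 0, q - p₀) (0, 0, q - p₀)) :
    G.hjiOperator φ t₀ x₀ p₀ ≤ 2 * ε * ∑ k,
      ‖(G.σ t₀ x₀).toEuclideanLin (EuclideanSpace.single k 1)‖ ^ 2 := by
  have hT := hG.T_pos
  have ht₀' : t₀ ∈ Icc 0 G.T := Ico_subset_Icc_self ht₀
  set D := fderiv ℝ φ (t₀, x₀, p₀) with hD
  set D₂ := fderiv ℝ (fderiv ℝ φ) (t₀, x₀, p₀) with hD₂
  obtain ⟨C, κ₁, δ₁, hC, hκ₁, hδ₁, hloc⟩ := exists_quadratic_lower_bound hφ hD.symm hD₂.symm hmin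
    hlam hε fun q hq ↦ hconv q.2.2 hq.2.2
  -- The part of the quadratic lower bound that does not involve `p`; the rest is linear in `p - p₀`
  -- plus the `κ₁` term, as the extension by convexity requires.
  set A : ℝ → EuclideanSpace ℝ (Fin d) → ℝ := fun t x ↦
    w t₀ x₀ p₀ + D (1, 0, 0) * (t - t₀) - C * (t - t₀) ^ 2 + D (inclSpace d I (x - x₀)) +
      (1 / 2) * D₂ (inclSpace d I (x - x₀)) (inclSpace d I (x - x₀)) - ε * ‖x - x₀‖ ^ 2 with hA
  set ℓ : (Fin I → ℝ) →L[ℝ] ℝ := D.comp (inclParam d I)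
  set M : EuclideanSpace ℝ (Fin d) →L[ℝ] (Fin I → ℝ) →L[ℝ] ℝ := (1 / 2 : ℝ) •
    (D₂.bilinearComp (inclSpace d I) (inclParam d I) +
      (D₂.bilinearComp (inclParam d I) (inclSpace d I)).flip)
  have hM : ∀ y r, M y r = (1 / 2) * (D₂ (inclSpace d I y) (inclParam d I r) +
      D₂ (inclParam d I r) (inclSpace d I y)) := fun y r ↦ by
    simp [M]
    ring
  have hAcont : Continuous fun z : ℝ × EuclideanSpace ℝ (Fin d) ↦ A z.1 z.2 := by
    simp only [hA]
    fun_prop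
  have hcont : ∀ e > 0, ∃ δ > 0, ∀ t ∈ Icc 0 G.T, ∀ x, |t - t₀| < δ → ‖x - x₀‖ < δ →
      w t x p₀ - A t x ≤ e := by
    intro e he
    obtain ⟨δ, hδ, h1⟩ := hw.continuous_at hT hL ht₀' x₀ hp₀ (half_pos he)
    obtain ⟨δ', hδ', h2⟩ := Metric.continuousAt_iff.1 (hAcont.continuousAt (x := (t₀, x₀)))
      (e / 2) (half_pos he)
    refine ⟨min δ δ', lt_min hδ hδ', fun t ht x ht' hx' ↦ ?_⟩
    have h3 := h1 t ht x p₀ hp₀ (ht'.trans_le (min_le_left _ _))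
      (hx'.trans_le (min_le_left _ _)) (by simpa using hδ)
    have h4 := h2 (x := (t, x)) (by
      rw [Prod.dist_eq, Real.dist_eq, dist_eq_norm]
      exact max_lt (ht'.trans_le (min_le_right _ _)) (hx'.trans_le (min_le_right _ _)))
    have h5 : A t₀ x₀ = w t₀ x₀ p₀ := by simp [hA]
    rw [Real.dist_eq, h5, abs_lt] at h4
    linarith [(abs_le.1 h3).2]
  obtain ⟨κ₂, δ₂, hκ₂, hδ₂, hglob⟩ := exists_lower_bound_on_simplex (w := w) hp₀
    (fun t ht x ↦ hw.convexOn hG hB hL ht x) (A := A)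
    (Λ := fun x ↦ ((ℓ + M (x - x₀) : (Fin I → ℝ) →L[ℝ] ℝ) : (Fin I → ℝ) →ₗ[ℝ] ℝ)) hκ₁ hδ₁
    (fun t ht x p hp h1 h2 h3 ↦ by
      refine le_trans (le_of_eq ?_) (hloc t x p ⟨ht, mem_univ _, hp⟩ h1 h2 h3)
      simp only [ContinuousLinearMap.coe_coe, add_apply, hM]
      rfl) hcont
  obtain ⟨C₀, hC₀, hbound⟩ := hw.exists_bound hG hB hL
  -- Half of `κ₂` and one of the two `ε` in `Q` are the margins consumed by `TestFn.exists_penalty`;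
  -- the other `ε` is the Taylor loss already present in `A`. The value `K = 0` is provisional.
  set ψ : TestFn d I :=
    { t₀ := t₀, x₀ := x₀, p₀ := p₀, c := w t₀ x₀ p₀, α := D (1, 0, 0), K := 0, κ := κ₂ / 2,
      ξ := (InnerProductSpace.toDual ℝ (EuclideanSpace ℝ (Fin d))).symm (D.comp (inclSpace d I)),
      Q := (1 / 2 : ℝ) • D₂.bilinearComp (inclSpace d I) (inclSpace d I) -
        (2 * ε) • innerBilin d, ℓ := ℓ, M := M } with hψ
  obtain ⟨K, hK, hstrict⟩ := ψ.exists_penalty (w := w) rfl hp₀ hC₀ hC hε (half_pos hκ₂) hδ₂ hbound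
    fun t ht x p hp h1 h2 ↦ by
      refine le_trans (le_of_eq ?_) (hglob t ht x p hp h1 h2)
      simp only [hψ, TestFn.eval, hA, ContinuousLinearMap.coe_coe, add_apply, sub_apply, smul_apply,
        smul_eq_mul, ContinuousLinearMap.bilinearComp_apply, innerBilin_self,
        InnerProductSpace.toDual_symm_apply, ContinuousLinearMap.comp_apply]
      ring
  have hmain := hG.testFn_le_zero hB hL hw {ψ with K := K} hK (half_pos hκ₂) ht₀ hp₀ rfl hstrict
  have hdiff : TestFn.diffusion {ψ with K := K} (G.σ t₀ x₀) =
      (1 / 2) * (G.σ t₀ x₀ * (G.σ t₀ x₀).transpose * hessianX (fun y ↦ φ (t₀, y, p₀)) x₀).trace -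
      2 * ε * ∑ k, ‖(G.σ t₀ x₀).toEuclideanLin (EuclideanSpace.single k 1)‖ ^ 2 := by
    rw [trace_hessianX t₀ x₀ p₀ hφ, Finset.mul_sum, Finset.mul_sum, ← Finset.sum_sub_distrib]
    refine Finset.sum_congr rfl fun k _ ↦ ?_
    simp only [hψ, sub_apply, smul_apply, smul_eq_mul, ContinuousLinearMap.bilinearComp_apply,
      innerBilin_self, hD₂]
  change D (1, 0, 0) + TestFn.diffusion {ψ with K := K} (G.σ t₀ x₀) +
    G.hamiltonian t₀ x₀ ψ.ξ p₀ ≤ 0 at hmain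
  unfold hjiOperator
  rw [deriv_time t₀ x₀ p₀ hφ, gradient_space t₀ x₀ p₀ hφ]
  change D (1, 0, 0) + _ + G.hamiltonian t₀ x₀ ψ.ξ p₀ ≤ _
  rw [hdiff] at hmain
  linarith

end Game

end IncompleteInfoGame

end

/-! ### Conclusion. -/

theorem proposition4p5 {d I m n : ℕ} (G : IncompleteInfoGame.Game d I m n) (hG : G.Assumptions)
    {Ω : Type*} [MeasurableSpace Ω] (P : Measure Ω) [IsProbabilityMeasure P]
    (B : ℝ≥0 → Ω → EuclideanSpace ℝ (Fin d)) (hB : IncompleteInfoGame.IsBrownian P B)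
    (w : ℝ → EuclideanSpace ℝ (Fin d) → (Fin I → ℝ) → ℝ) (hw : G.IsLimitPoint P B w) :
    G.IsViscositySupersolution w ∧ ∀ x, ∀ p ∈ stdSimplex ℝ (Fin I), w G.T x p = ∑ i, p i * G.g i x := by
  obtain ⟨L, hL, hlim⟩ := hw
  replace hlim : G.IsLimitAlong P B w L := hlim
  refine ⟨⟨hlim.lowerSemicontinuousOn hG.T_pos hL, fun φ hφ t ht x p hp hmin ↦ ?_⟩,
    fun x p hp ↦ hlim.eq_terminal hG.T_pos hL x hp⟩
  -- A failure makes both entries positive: the second supplies the strict convexity in `p`, and the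
  -- first is then contradicted.
  by_contra hneg
  obtain ⟨h1, h2⟩ := lt_min_iff.1 (not_le.1 hneg)
  have hpos : 0 < G.hjiOperator φ t x p := by exact_mod_cast h1
  obtain ⟨lam, hlam, hconv⟩ := IncompleteInfoGame.exists_pos_of_lambdaMin_pos h2
  simp only [IncompleteInfoGame.Game.hessianP_mulVec_dotProduct t x p hφ] at hconv
  set s := ∑ k, ‖(G.σ t x).toEuclideanLin (EuclideanSpace.single k 1)‖ ^ 2
  have hs : 0 ≤ s := Finset.sum_nonneg fun _ _ ↦ sq_nonneg _
  -- This `ε` keeps the error `2 ε s` below half of the positive operator value; `s + 1` avoids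
  -- division by zero.
  have h3 := hG.hjiOperator_le hB hL hlim hφ ht x hp hmin hlam
    (ε := G.hjiOperator φ t x p / (4 * (s + 1))) (by positivity) hconv
  have h4 : 2 * (G.hjiOperator φ t x p / (4 * (s + 1))) * s < G.hjiOperator φ t x p := by
    rw [mul_div_assoc', div_mul_eq_mul_div, div_lt_iff₀ (by positivity)]
    nlinarith
  exact absurd h3 (not_le.2 h4)
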